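/- Let $\varGamma\subset\mathbb{R}^d$ be a lattice. A matrix $R\in\mathrm{O}(d,\mathbb{R})$ is called a coincidence isometry of $\varGamma$ if $\varGamma\cap R\varGamma$ has finite index both in $\varGamma$ and in $R\varGamma$; then $\varGamma\cap R\varGamma$ is called a coincidence site lattice (CSL) of $\varGamma$, and $\varSigma_\varGamma(R)=[\varGamma:\varGamma\cap R\varGamma]$ is its coincidence index. A coincidence rotation is a coincidence isometry in $\mathrm{SO}(d,\mathbb{R})$. Let $\mathrm{SO}(\varGamma)=\{R\in\mathrm{SO}(d,\mathbb{R}) : R\varGamma=\varGamma\}$. For $n\ge 1$, let $c^{\mathsf{rot}}_\varGamma(n)$ be the number of coincidence rotations of $\varGamma$ of index $n$ modulo $\mathrm{SO}(\varGamma)$, that is, the number of classes of such rotations under $R\sim RS$ with $S\in\mathrm{SO}(\varGamma)$, and let $c_\varGamma(n)$ be the number of distinct CSLs of $\varGamma$ of index $n$. Let $D_4^{*}=\mathbb{Z}^4\cup\bigl((\tfrac12,\tfrac12,\tfrac12,\tfrac12)+\mathbb{Z}^4\bigr)\subset\mathbb{R}^4$ be the centred hypercubic lattice (the lattice of Hurwitz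 quaternions), let $\varGamma_{\mathsf{bcc}}=\mathbb{Z}^3\cup\bigl((\tfrac12,\tfrac12,\tfrac12)+\mathbb{Z}^3\bigr)\subset\mathbb{R}^3$ be the body-centred cubic lattice, and write $c_{\mathsf{bcc}}=c_{\varGamma_{\mathsf{bcc}}}$. **Theorem.** For every $n\ge 1$, there are only finitely many coincidence rotations of $D_4^{*}$ of index $n$ and only finitely many CSLs of $\varGamma_{\mathsf{bcc}}$ of index $n$. The number of coincidence rotations of $D_4^{*}$ of index $n$ is $576\, c^{\mathsf{rot}}_{D_4^{*}}(n)$, and $c^{\mathsf{rot}}_{D_4^{*}}$ is a multiplicative arithmetic function (with value $1$ at $1$). It is determined by $c^{\mathsf{rot}}_{D_4^{*}}(2^r)=0$ for $r\ge 1$ together with \[ c^{\mathsf{rot}}_{D_4^{*}}(p^r) \,=\, \frac{p+1}{p-1}\; p^{\,r-1}\,\bigl(p^{\,r+1}+p^{\,r-1}-2\bigr) \] for odd primes $p$ and $r\ge 1$. Moreover, with $\Psi^{\mathsf{rot}}_{D_4^{*}}(s)=\sum_{n\ge 1} c^{\mathsf{rot}}_{D_4^{*}}(n)\, n^{-s}$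 and $\Psi_{\mathsf{bcc}}(s)=\sum_{n\ge 1} c_{\mathsf{bcc}}(n)\, n^{-s}$, one has \[ \Psi^{\mathsf{rot}}_{D_4^{*}}(s) \,=\, \Psi_{\mathsf{bcc}}(s)\,\Psi_{\mathsf{bcc}}(s-1) \] for all complex $s$ with $\operatorname{Re}(s)>3$, where all three series converge absolutely. -/

import Mathlib

/-- The image `R Γ` of a subgroup `Γ` of `ℝ^d` under the linear map `x ↦ R x`. -/
noncomputable def rotate {d : ℕ} (R : Matrix (Fin d) (Fin d) ℝ)
    (Γ : AddSubgroup (Fin d → ℝ)) : AddSubgroup (Fin d → ℝ) :=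
  Γ.map (Matrix.mulVecLin R).toAddMonoidHom

/-- The intersection `Γ(R) = Γ ∩ R Γ`. -/
noncomputable def csl {d : ℕ} (Γ : AddSubgroup (Fin d → ℝ))
    (R : Matrix (Fin d) (Fin d) ℝ) : AddSubgroup (Fin d → ℝ) :=
  Γ ⊓ rotate R Γ

/-- `R` is a coincidence isometry (if orthogonal) of `Γ`: the groups `Γ` and `R Γ` are
commensurate, that is, `Γ ∩ R Γ` has finite index in both. -/
def IsCoincidence {d : ℕ} (Γ : AddSubgroup (Fin d → ℝ))
    (R : Matrix (Fin d) (Fin d) ℝ) : Prop :=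
  AddSubgroup.Commensurable Γ (rotate R Γ)

/-- The coincidence index `Σ_Γ(R) = [Γ : Γ ∩ R Γ]`. -/
noncomputable def coincidenceIndex {d : ℕ} (Γ : AddSubgroup (Fin d → ℝ))
    (R : Matrix (Fin d) (Fin d) ℝ) : ℕ :=
  (csl Γ R).relIndex Γ

/-- The coincidence rotations `R ∈ SO(d, ℝ)` of `Γ` of coincidence index `n`. -/
def coincidenceRotations {d : ℕ} (Γ : AddSubgroup (Fin d → ℝ)) (n : ℕ) :
    Set (Matrix.specialOrthogonalGroup (Fin d) ℝ) :=
  {R | IsCoincidence Γ R.1 ∧ coincidenceIndex Γ R.1 = n}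

theorem rotate_one {d : ℕ} (Γ : AddSubgroup (Fin d → ℝ)) : rotate 1 Γ = Γ := by
  ext x; simp [rotate]

theorem rotate_mul {d : ℕ} (R S : Matrix (Fin d) (Fin d) ℝ) (Γ : AddSubgroup (Fin d → ℝ)) :
    rotate (R * S) Γ = rotate R (rotate S Γ) := by
  ext x; simp [rotate]

/-- The group `SO(Γ) = {R ∈ SO(d, ℝ) | R Γ = Γ}` of symmetry rotations of `Γ`. -/
def symmetryRotations {d : ℕ} (Γ : AddSubgroup (Fin d → ℝ)) :
    Subgroup (Matrix.specialOrthogonalGroup (Fin d) ℝ) where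
  carrier := {R | rotate R.1 Γ = Γ}
  one_mem' := rotate_one Γ
  mul_mem' {R S} hR hS := by
    change rotate (R.1 * S.1) Γ = Γ
    rw [rotate_mul, show rotate S.1 Γ = Γ from hS, show rotate R.1 Γ = Γ from hR]
  inv_mem' {R} hR := by
    change rotate (R⁻¹).1 Γ = Γ
    have h : rotate R.1 Γ = Γ := hR
    have h1 : (R⁻¹).1 * R.1 = 1 := congrArg Subtype.val (inv_mul_cancel R)
    calc rotate (R⁻¹).1 Γ = rotate (R⁻¹).1 (rotate R.1 Γ) := by rw [h]
      _ = Γ := by rw [← rotate_mul, h1, rotate_one]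

theorem coincidenceIndex_ne_zero {d : ℕ} {Γ : AddSubgroup (Fin d → ℝ)}
    {R : Matrix (Fin d) (Fin d) ℝ} (h : IsCoincidence Γ R) : coincidenceIndex Γ R ≠ 0 := by
  rw [coincidenceIndex, csl, AddSubgroup.inf_relIndex_left]
  exact h.2

theorem coincidenceRotations_zero {d : ℕ} (Γ : AddSubgroup (Fin d → ℝ)) :
    coincidenceRotations Γ 0 = ∅ := by
  ext R
  simp only [coincidenceRotations, Set.mem_ofPred_eq, Set.mem_empty_iff_false, iff_false]
  exact fun h => coincidenceIndex_ne_zero h.1 h.2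

/-- `c^rot_Γ(n)`: the number of coincidence rotations of index `n` modulo `SO(Γ)`, that is, the
number of classes of such rotations under `R ∼ R S` with `S ∈ SO(Γ)`. -/
noncomputable def cRot {d : ℕ} (Γ : AddSubgroup (Fin d → ℝ)) : ArithmeticFunction ℕ where
  toFun n := ((QuotientGroup.mk : _ → Matrix.specialOrthogonalGroup (Fin d) ℝ ⧸ symmetryRotations Γ) ''
    coincidenceRotations Γ n).ncard
  map_zero' := by simp [coincidenceRotations_zero]

/-- The coincidence site lattices of `Γ` of index `n`: the groups `Γ ∩ R Γ`, where `R ∈ O(d, ℝ)`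
is a coincidence isometry of `Γ` of coincidence index `n`. -/
def cslsOfIndex {d : ℕ} (Γ : AddSubgroup (Fin d → ℝ)) (n : ℕ) :
    Set (AddSubgroup (Fin d → ℝ)) :=
  {Λ | ∃ R ∈ Matrix.orthogonalGroup (Fin d) ℝ,
    IsCoincidence Γ R ∧ coincidenceIndex Γ R = n ∧ Λ = csl Γ R}

theorem cslsOfIndex_zero {d : ℕ} (Γ : AddSubgroup (Fin d → ℝ)) : cslsOfIndex Γ 0 = ∅ := by
  ext Λ
  simp only [cslsOfIndex, Set.mem_ofPred_eq, Set.mem_empty_iff_false, iff_false]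
  rintro ⟨R, -, h, h0, -⟩
  exact coincidenceIndex_ne_zero h h0

/-- `c_Γ(n)`: the number of coincidence site lattices of `Γ` of index `n`. -/
noncomputable def cCSL {d : ℕ} (Γ : AddSubgroup (Fin d → ℝ)) : ArithmeticFunction ℕ where
  toFun n := (cslsOfIndex Γ n).ncard
  map_zero' := by simp [cslsOfIndex_zero]

/-- The centred cubic lattice `ℤ^d ∪ (u + ℤ^d)` in `ℝ^d`, where `u = (1/2, …, 1/2)`. -/
noncomputable def centredCubic (d : ℕ) : AddSubgroup (Fin d → ℝ) where
  carrier := {x | (∀ i, ∃ m : ℤ, x i = m) ∨ (∀ i, ∃ m : ℤ, x i = m + 1 / 2)}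
  zero_mem' := Or.inl fun _ => ⟨0, by simp⟩
  add_mem' := by
    rintro x y (hx | hx) (hy | hy)
    · refine Or.inl fun i => ?_
      obtain ⟨a, ha⟩ := hx i
      obtain ⟨b, hb⟩ := hy i
      exact ⟨a + b, by simp [ha, hb]⟩
    · refine Or.inr fun i => ?_
      obtain ⟨a, ha⟩ := hx i
      obtain ⟨b, hb⟩ := hy i
      exact ⟨a + b, by simp [ha, hb]; ring⟩
    · refine Or.inr fun i => ?_
      obtain ⟨a, ha⟩ := hx i
      obtain ⟨b, hb⟩ := hy i
      exact ⟨a + b, by simp [ha, hb]; ring⟩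
    · refine Or.inl fun i => ?_
      obtain ⟨a, ha⟩ := hx i
      obtain ⟨b, hb⟩ := hy i
      exact ⟨a + b + 1, by simp [ha, hb]; ring⟩
  neg_mem' := by
    rintro x (hx | hx)
    · refine Or.inl fun i => ?_
      obtain ⟨a, ha⟩ := hx i
      exact ⟨-a, by simp [ha]⟩
    · refine Or.inr fun i => ?_
      obtain ⟨a, ha⟩ := hx i
      exact ⟨-a - 1, by simp [ha]; ring⟩

/-- The body-centred cubic lattice in `ℝ³`. -/
noncomputable def bcc : AddSubgroup (Fin 3 → ℝ) := centredCubic 3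

/-- The centred hypercubic lattice `D₄*` in `ℝ⁴`: the vectors whose coordinates are all integers
or all half-odd-integers, that is, the Hurwitz quaternions in the basis `1, i, j, k`. -/
noncomputable def D4star : AddSubgroup (Fin 4 → ℝ) := centredCubic 4

/-! Everything is transported to the Hurwitz order, whose left ideals are principal. A coincidence
rotation of `D4star` has rational entries, so it has the form `x ↦ q x p / c` with primitive Hurwitz
quaternions `q`, `p` satisfying `norm q * norm p = c ^ 2` (`exists_represents`), and the pair is
unique up to a common sign (`Represents.unique`). Since `x ↦ π x π / 2` with `π = 1 + i` permutes
the order, a factor `π` in both `q` and `p` does not affect the rotated lattice, so for the index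
only odd norms matter.

For odd norms, membership in the rotated lattice is the condition `c ∣ q̄ x p̄`. Modulo an odd prime
power the order becomes a full ring of 2 × 2 matrices (`exists_split`), a primitive element has
Smith form `diag(1, δ)` with `δ` equal to its norm up to a unit, and the index comes out as `lcm
(norm q) (norm p)` (`index_sandwichKer_of_norm_mul_eq_sq`). The sign and the `π`-twist contribute
factors 2 that cancel, and each ideal with a primitive generator has 24 generators. So there are
`576 = 24²` rotations for each pair of such ideals whose odd norms have square product and least
common multiple `n`.

In dimension three the same analysis with `p = q̄` shows that the CSLs of `bcc` of odd index `n`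
correspond to the left ideals generated by primitive elements of norm `n` (`cslOf_eq_iff`), and that
no even index occurs. At `p ^ r` these ideals are the points of the projective line over `ZMod (p ^
r)`, numbering `p ^ r + p ^ (r - 1)`, and intersection of ideals makes the count multiplicative.

Hence `cRot D4star n` is the sum of `cCSL bcc m₁ * cCSL bcc m₂` over the admissible norm pairs. This
is multiplicative, and at a prime power it reduces to a telescoping sum. The Dirichlet convolution
of `c_bcc(n)` with `n c_bcc(n)` is multiplicative with the same values at prime powers, which is the
identity of Dirichlet series; convergence follows from `c_bcc ≤ σ₁`. -/

/-! ### The Hurwitz order: norm, primitivity, Euclidean division, the prime above 2 -/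

/-- The Hurwitz quaternion `a ω + b i + c j + d k`, where `ω = (1 + i + j + k) / 2`. -/
@[ext]
structure Hurwitz where
  /-- The coefficient of `ω`. -/
  a : ℤ
  /-- The coefficient of `i`. -/
  b : ℤ
  /-- The coefficient of `j`. -/
  c : ℤ
  /-- The coefficient of `k`. -/
  d : ℤ

namespace Hurwitz

instance : Zero Hurwitz := ⟨⟨0, 0, 0, 0⟩⟩
-- In this basis `1 = 2ω - i - j - k`; the casts of integers follow the same pattern.
instance : One Hurwitz := ⟨⟨2, -1, -1, -1⟩⟩
instance : Add Hurwitz := ⟨fun x y => ⟨x.a + y.a, x.b + y.b, x.c + y.c, x.d + y.d⟩⟩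
instance : Neg Hurwitz := ⟨fun x => ⟨-x.a, -x.b, -x.c, -x.d⟩⟩
instance : Sub Hurwitz := ⟨fun x y => ⟨x.a - y.a, x.b - y.b, x.c - y.c, x.d - y.d⟩⟩
instance : NatCast Hurwitz := ⟨fun n => ⟨2 * n, -n, -n, -n⟩⟩
instance : IntCast Hurwitz := ⟨fun n => ⟨2 * n, -n, -n, -n⟩⟩
instance : Mul Hurwitz := ⟨fun x y =>
  ⟨-(x.a * y.a) - x.a * (y.b + y.c + y.d) - (x.b + x.c + x.d) * y.a
      - 2 * (x.b * y.b + x.c * y.c + x.d * y.d),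
    x.a * y.a + x.a * y.b + x.a * y.d + x.b * y.a + x.c * y.a
      + (x.b * y.b + x.c * y.c + x.d * y.d) + (x.c * y.d - x.d * y.c),
    x.a * y.a + x.a * y.b + x.a * y.c + x.c * y.a + x.d * y.a
      + (x.b * y.b + x.c * y.c + x.d * y.d) + (x.d * y.b - x.b * y.d),
    x.a * y.a + x.a * y.c + x.a * y.d + x.b * y.a + x.d * y.a
      + (x.b * y.b + x.c * y.c + x.d * y.d) + (x.b * y.c - x.c * y.b)⟩⟩

section coordinates
variable (x y : Hurwitz) (n : ℕ) (m : ℤ)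

@[simp] theorem zero_a : (0 : Hurwitz).a = 0 := rfl
@[simp] theorem zero_b : (0 : Hurwitz).b = 0 := rfl
@[simp] theorem zero_c : (0 : Hurwitz).c = 0 := rfl
@[simp] theorem zero_d : (0 : Hurwitz).d = 0 := rfl
@[simp] theorem one_a : (1 : Hurwitz).a = 2 := rfl
@[simp] theorem one_b : (1 : Hurwitz).b = -1 := rfl
@[simp] theorem one_c : (1 : Hurwitz).c = -1 := rfl
@[simp] theorem one_d : (1 : Hurwitz).d = -1 := rfl
@[simp] theorem add_a : (x + y).a = x.a + y.a := rfl
@[simp] theorem add_b : (x + y).b = x.b + y.b := rfl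
@[simp] theorem add_c : (x + y).c = x.c + y.c := rfl
@[simp] theorem add_d : (x + y).d = x.d + y.d := rfl
@[simp] theorem neg_a : (-x).a = -x.a := rfl
@[simp] theorem neg_b : (-x).b = -x.b := rfl
@[simp] theorem neg_c : (-x).c = -x.c := rfl
@[simp] theorem neg_d : (-x).d = -x.d := rfl
@[simp] theorem sub_a : (x - y).a = x.a - y.a := rfl
@[simp] theorem sub_b : (x - y).b = x.b - y.b := rfl
@[simp] theorem sub_c : (x - y).c = x.c - y.c := rfl
@[simp] theorem sub_d : (x - y).d = x.d - y.d := rfl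
@[simp] theorem natCast_a : (n : Hurwitz).a = 2 * n := rfl
@[simp] theorem natCast_b : (n : Hurwitz).b = -n := rfl
@[simp] theorem natCast_c : (n : Hurwitz).c = -n := rfl
@[simp] theorem natCast_d : (n : Hurwitz).d = -n := rfl
@[simp] theorem intCast_a : (m : Hurwitz).a = 2 * m := rfl
@[simp] theorem intCast_b : (m : Hurwitz).b = -m := rfl
@[simp] theorem intCast_c : (m : Hurwitz).c = -m := rfl
@[simp] theorem intCast_d : (m : Hurwitz).d = -m := rfl

@[simp] theorem mul_a : (x * y).a =
    -(x.a * y.a) - x.a * (y.b + y.c + y.d) - (x.b + x.c + x.d) * y.a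
      - 2 * (x.b * y.b + x.c * y.c + x.d * y.d) := rfl
@[simp] theorem mul_b : (x * y).b =
    x.a * y.a + x.a * y.b + x.a * y.d + x.b * y.a + x.c * y.a
      + (x.b * y.b + x.c * y.c + x.d * y.d) + (x.c * y.d - x.d * y.c) := rfl
@[simp] theorem mul_c : (x * y).c =
    x.a * y.a + x.a * y.b + x.a * y.c + x.c * y.a + x.d * y.a
      + (x.b * y.b + x.c * y.c + x.d * y.d) + (x.d * y.b - x.b * y.d) := rfl
@[simp] theorem mul_d : (x * y).d =
    x.a * y.a + x.a * y.c + x.a * y.d + x.b * y.a + x.d * y.a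
      + (x.b * y.b + x.c * y.c + x.d * y.d) + (x.b * y.c - x.c * y.b) := rfl

end coordinates

instance : Ring Hurwitz where
  add_assoc x y z := by ext <;> simp [add_assoc]
  zero_add x := by ext <;> simp
  add_zero x := by ext <;> simp
  add_comm x y := by ext <;> simp [add_comm]
  left_distrib x y z := by ext <;> simp <;> ring
  right_distrib x y z := by ext <;> simp <;> ring
  zero_mul x := by ext <;> simp
  mul_zero x := by ext <;> simp
  mul_assoc x y z := by ext <;> simp <;> ring
  one_mul x := by ext <;> simp <;> ring
  mul_one x := by ext <;> simp <;> ring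
  natCast_zero := by ext <;> simp
  natCast_succ n := by ext <;> simp <;> ring
  intCast_ofNat n := by ext <;> simp
  intCast_negSucc n := by ext <;> simp [Int.negSucc_eq] <;> ring
  neg_add_cancel x := by ext <;> simp
  sub_eq_add_neg x y := by ext <;> simp [sub_eq_add_neg]
  nsmul := nsmulRec
  zsmul := zsmulRec

/-- Quaternion conjugation. -/
def conj (x : Hurwitz) : Hurwitz := ⟨x.a, -x.a - x.b, -x.a - x.c, -x.a - x.d⟩

@[simp] theorem conj_a (x : Hurwitz) : (conj x).a = x.a := rfl
@[simp] theorem conj_b (x : Hurwitz) : (conj x).b = -x.a - x.b := rfl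
@[simp] theorem conj_c (x : Hurwitz) : (conj x).c = -x.a - x.c := rfl
@[simp] theorem conj_d (x : Hurwitz) : (conj x).d = -x.a - x.d := rfl

@[simp] theorem conj_conj (x : Hurwitz) : conj (conj x) = x := by ext <;> simp
theorem conj_mul (x y : Hurwitz) : conj (x * y) = conj y * conj x := by ext <;> simp <;> ring
@[simp] theorem conj_natCast (n : ℕ) : conj (n : Hurwitz) = n := by ext <;> simp <;> ring

/-- The reduced norm as an integer. -/
def normZ (x : Hurwitz) : ℤ :=
  x.a ^ 2 + x.a * (x.b + x.c + x.d) + x.b ^ 2 + x.c ^ 2 + x.d ^ 2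

/-- Doubling a Hurwitz quaternion gives integer coordinates `a, a + 2b, a + 2c, a + 2d`. Positivity,
definiteness and all finiteness bounds are read off this sum of squares. -/
theorem four_mul_normZ (x : Hurwitz) : 4 * normZ x =
    x.a ^ 2 + (x.a + 2 * x.b) ^ 2 + (x.a + 2 * x.c) ^ 2 + (x.a + 2 * x.d) ^ 2 := by
  simp only [normZ]; ring

theorem normZ_nonneg (x : Hurwitz) : 0 ≤ normZ x := by
  have := four_mul_normZ x
  have : 0 ≤ 4 * normZ x := by rw [this]; positivity
  linarith

/-- The reduced norm. -/
def norm (x : Hurwitz) : ℕ := (normZ x).natAbs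

theorem norm_cast (x : Hurwitz) : (norm x : ℤ) = normZ x := by
  rw [norm, Int.natAbs_of_nonneg (normZ_nonneg x)]

theorem normZ_mul (x y : Hurwitz) : normZ (x * y) = normZ x * normZ y := by
  simp only [normZ, mul_a, mul_b, mul_c, mul_d]; ring

theorem norm_mul (x y : Hurwitz) : norm (x * y) = norm x * norm y := by
  simp only [norm, normZ_mul, Int.natAbs_mul]

@[simp] theorem norm_conj (x : Hurwitz) : norm (conj x) = norm x := by
  simp only [norm, normZ, conj_a, conj_b, conj_c, conj_d]; ring_nf

@[simp] theorem norm_neg (x : Hurwitz) : norm (-x) = norm x := by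
  simp only [norm, normZ, neg_a, neg_b, neg_c, neg_d]; ring_nf

@[simp] theorem norm_natCast (n : ℕ) : norm (n : Hurwitz) = n ^ 2 := by
  zify; rw [norm_cast]; simp [normZ]; ring

@[simp] theorem norm_one : norm 1 = 1 := rfl

theorem mul_conj (x : Hurwitz) : x * conj x = (norm x : Hurwitz) := by
  ext <;> simp [norm_cast, normZ] <;> ring

theorem conj_mul_self (x : Hurwitz) : conj x * x = (norm x : Hurwitz) := by
  ext <;> simp [norm_cast, normZ] <;> ring

theorem norm_eq_zero {x : Hurwitz} : norm x = 0 ↔ x = 0 := by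
  constructor
  · intro h
    have h0 : normZ x = 0 := by rw [← norm_cast, h]; rfl
    have h4 := four_mul_normZ x
    rw [h0] at h4
    have h1 := sq_nonneg x.a
    have h2 := sq_nonneg (x.a + 2 * x.b)
    have h3 := sq_nonneg (x.a + 2 * x.c)
    have h5 := sq_nonneg (x.a + 2 * x.d)
    have ha : x.a = 0 := pow_eq_zero_iff two_ne_zero |>.1 (by linarith)
    have hb : x.a + 2 * x.b = 0 := pow_eq_zero_iff two_ne_zero |>.1 (by linarith)
    have hc : x.a + 2 * x.c = 0 := pow_eq_zero_iff two_ne_zero |>.1 (by linarith)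
    have hd : x.a + 2 * x.d = 0 := pow_eq_zero_iff two_ne_zero |>.1 (by linarith)
    ext
    · exact ha
    · simp; omega
    · simp; omega
    · simp; omega
  · rintro rfl; rfl

instance : NoZeroDivisors Hurwitz where
  eq_zero_or_eq_zero_of_mul_eq_zero {x y} h := by
    rw [← norm_eq_zero, norm_mul] at h
    simpa [norm_eq_zero] using h

instance : Nontrivial Hurwitz := ⟨⟨0, 1, fun h => by simpa using congrArg Hurwitz.a h⟩⟩

instance : IsDomain Hurwitz := NoZeroDivisors.to_isDomain _

instance : CharZero Hurwitz where
  cast_injective m n h := by simpa using congrArg Hurwitz.b h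

theorem natCast_dvd_iff {n : ℕ} {x : Hurwitz} :
    (n : Hurwitz) ∣ x ↔ (n : ℤ) ∣ x.a ∧ (n : ℤ) ∣ x.b ∧ (n : ℤ) ∣ x.c ∧ (n : ℤ) ∣ x.d := by
  constructor
  · rintro ⟨y, rfl⟩
    refine ⟨⟨y.a, ?_⟩, ⟨y.b, ?_⟩, ⟨y.c, ?_⟩, ⟨y.d, ?_⟩⟩ <;> simp <;> ring
  · rintro ⟨⟨a, ha⟩, ⟨b, hb⟩, ⟨c, hc⟩, ⟨d, hd⟩⟩
    refine ⟨⟨a, b, c, d⟩, ?_⟩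
    ext <;> simp [*] <;> ring

theorem natCast_mul_left_comm (n : ℕ) (x y : Hurwitz) : x * (n * y) = n * (x * y) := by
  rw [← mul_assoc, ← (Nat.cast_commute n x).eq, mul_assoc]

theorem natCast_dvd_mul_left {n : ℕ} {x : Hurwitz} (h : (n : Hurwitz) ∣ x) (y : Hurwitz) :
    (n : Hurwitz) ∣ y * x := by
  obtain ⟨z, rfl⟩ := h
  exact ⟨y * z, natCast_mul_left_comm n y z⟩

theorem natCast_dvd_mul_right {n : ℕ} {x : Hurwitz} (h : (n : Hurwitz) ∣ x) (y : Hurwitz) :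
    (n : Hurwitz) ∣ x * y := by
  obtain ⟨z, rfl⟩ := h
  exact ⟨z * y, mul_assoc _ _ _⟩

theorem natCast_dvd_conj {n : ℕ} {x : Hurwitz} :
    (n : Hurwitz) ∣ conj x ↔ (n : Hurwitz) ∣ x := by
  have key : ∀ x : Hurwitz, (n : Hurwitz) ∣ x → (n : Hurwitz) ∣ conj x := by
    rintro x ⟨y, rfl⟩
    exact ⟨conj y, by rw [conj_mul, conj_natCast, (Nat.cast_commute n (conj y)).eq]⟩
  exact ⟨fun h => by simpa using key _ h, key x⟩

theorem natCast_dvd_of_coprime {m n : ℕ} (h : m.Coprime n) {x : Hurwitz}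
    (h1 : (m : Hurwitz) ∣ n * x) : (m : Hurwitz) ∣ x := by
  have e := Nat.gcd_eq_gcd_ab m n
  rw [h.gcd_eq_one] at e
  have e' : (1 : Hurwitz) = m * (m.gcdA n : ℤ) + n * (m.gcdB n : ℤ) := by
    have := congrArg (Int.cast : ℤ → Hurwitz) e
    push_cast at this
    exact this
  have : x = m * ((m.gcdA n : ℤ) * x) + (m.gcdB n : ℤ) * (n * x) := by
    calc x = 1 * x := (one_mul x).symm
      _ = _ := by rw [e', (Nat.cast_commute n (m.gcdB n : Hurwitz)).eq]; noncomm_ring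
  rw [this]
  exact dvd_add ⟨_, rfl⟩ (natCast_dvd_mul_left h1 _)

theorem natCast_mul_dvd_of_coprime {m n : ℕ} (h : m.Coprime n) {x : Hurwitz}
    (hm : (m : Hurwitz) ∣ x) (hn : (n : Hurwitz) ∣ x) : ((m * n : ℕ) : Hurwitz) ∣ x := by
  obtain ⟨y, rfl⟩ := hm
  rw [Nat.cast_mul]
  exact mul_dvd_mul_left _ (natCast_dvd_of_coprime h.symm hn)

/-- `x` is primitive at `m`: no prime divisor of `m` divides `x`. -/
def PrimitiveAt (m : ℕ) (x : Hurwitz) : Prop :=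
  ∀ p : ℕ, p.Prime → p ∣ m → ¬ (p : Hurwitz) ∣ x

/-- `x` is primitive: no prime number divides `x`. -/
def IsPrimitive (x : Hurwitz) : Prop := ∀ p : ℕ, p.Prime → ¬ (p : Hurwitz) ∣ x

theorem IsPrimitive.at {x : Hurwitz} (h : IsPrimitive x) (m : ℕ) : PrimitiveAt m x :=
  fun p hp _ => h p hp

theorem IsPrimitive.ne_zero {x : Hurwitz} (h : IsPrimitive x) : x ≠ 0 := by
  rintro rfl
  exact h 2 Nat.prime_two (dvd_zero _)

theorem IsPrimitive.norm_pos {x : Hurwitz} (h : IsPrimitive x) : 0 < norm x :=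
  Nat.pos_of_ne_zero fun h0 => h.ne_zero (norm_eq_zero.1 h0)

theorem IsPrimitive.conj {x : Hurwitz} (h : IsPrimitive x) : IsPrimitive (conj x) :=
  fun p hp hd => h p hp (natCast_dvd_conj.1 hd)

theorem IsPrimitive.neg {x : Hurwitz} (h : IsPrimitive x) : IsPrimitive (-x) :=
  fun p hp hd => h p hp ((dvd_neg).1 hd)

theorem PrimitiveAt.mono {m n : ℕ} {x : Hurwitz} (h : PrimitiveAt m x) (hn : n ∣ m) :
    PrimitiveAt n x := fun p hp hpn => h p hp (hpn.trans hn)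

theorem isPrimitive_one : IsPrimitive 1 := by
  intro p hp hd
  have := (natCast_dvd_iff.1 hd).2.1
  simp only [one_b, dvd_neg] at this
  exact hp.one_lt.ne' (by simpa using Int.natAbs_dvd_natAbs.2 this)

/-- A primitive element of norm `n` is characterised by its behaviour at the prime divisors of
its norm. -/

theorem exists_primitive {x : Hurwitz} (hx : x ≠ 0) :
    ∃ (n : ℕ) (y : Hurwitz), 0 < n ∧ IsPrimitive y ∧ x = n * y := by
  induction h : norm x using Nat.strong_induction_on generalizing x with
  | _ N ih =>
    by_cases hp : IsPrimitive x
    · exact ⟨1, x, one_pos, hp, by simp⟩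
    · simp only [IsPrimitive, not_forall, not_not] at hp
      obtain ⟨p, hp, z, rfl⟩ := hp
      have hz : z ≠ 0 := right_ne_zero_of_mul hx
      have hlt : norm z < N := by
        rw [← h, norm_mul, norm_natCast]
        have := Nat.pos_of_ne_zero (mt norm_eq_zero.1 hz)
        have h4 : 2 ^ 2 ≤ p ^ 2 := Nat.pow_le_pow_left hp.two_le 2
        nlinarith
      obtain ⟨n, y, hn, hy, rfl⟩ := ih _ hlt hz rfl
      exact ⟨p * n, y, Nat.mul_pos hp.pos hn, hy, by push_cast; rw [mul_assoc]⟩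

/-- Primitive elements that are integrally proportional agree up to sign. -/
theorem IsPrimitive.eq_or_eq_neg {x y : Hurwitz} (hx : IsPrimitive x) (hy : IsPrimitive y)
    {m : ℕ} {n : ℤ} (hm : m ≠ 0) (h : (m : Hurwitz) * x = (n : Hurwitz) * y) :
    ((m : ℤ) = n ∧ x = y) ∨ ((m : ℤ) = -n ∧ x = -y) := by
  -- After removal of the common factor of `m` and `n`, what is left of `n` divides the primitive
  -- `x`, so it is 1. Applied in both directions this gives equality up to sign.
  have key : ∀ (x y : Hurwitz) (m n : ℕ), IsPrimitive x → m ≠ 0 → n ≠ 0 →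
      (m : Hurwitz) * x = n * y → n ∣ m := by
    intro x y m n hx hm hn h
    obtain ⟨g, m', n', hg, hco, rfl, rfl⟩ := Nat.exists_coprime' (m := m) (n := n)
      (Nat.gcd_pos_of_pos_left _ (Nat.pos_of_ne_zero hm))
    have h' : (m' : Hurwitz) * x = n' * y := by
      have hg0 : (g : Hurwitz) ≠ 0 := by exact_mod_cast hg.ne'
      apply mul_left_cancel₀ hg0
      rw [← mul_assoc, ← mul_assoc, ← Nat.cast_mul, ← Nat.cast_mul, mul_comm g, mul_comm g, h]
    have hd : (n' : Hurwitz) ∣ x := natCast_dvd_of_coprime hco.symm ⟨y, h'⟩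
    have : n' = 1 := by
      by_contra h1
      obtain ⟨p, hp, hpn⟩ := Nat.exists_prime_and_dvd h1
      exact hx p hp ((Nat.cast_dvd_cast hpn).trans hd)
    subst this
    exact ⟨m', by ring⟩
  have hm0 : (m : Hurwitz) ≠ 0 := by exact_mod_cast hm
  have hn : n ≠ 0 := by
    rintro rfl
    simp [hm, hx.ne_zero] at h
  obtain ⟨k, rfl | rfl⟩ := n.eq_nat_or_neg
  · left
    have hk : k ≠ 0 := by simpa using hn
    rw [Int.cast_natCast] at h
    have := Nat.dvd_antisymm (key x y m k hx hm hk h) (key y x k m hy hk hm h.symm)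
    subst this
    exact ⟨rfl, mul_left_cancel₀ hm0 h⟩
  · right
    have hk : k ≠ 0 := by simpa using hn
    have h' : (m : Hurwitz) * x = k * (-y) := by rw [h]; simp
    have := Nat.dvd_antisymm (key x (-y) m k hx hm hk h') (key (-y) x k m hy.neg hk hm h'.symm)
    subst this
    exact ⟨by simp, mul_left_cancel₀ hm0 h'⟩

theorem exists_int_close (u : ℤ) {n : ℕ} (hn : 0 < n) : ∃ k : ℤ, |2 * (u - n * k)| ≤ n := by
  -- The floor of `u / n + 1 / 2`, that is, a nearest integer to `u / n`.
  refine ⟨(2 * u + n) / (2 * n), ?_⟩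
  have h1 := Int.emod_add_mul_ediv (2 * u + n) (2 * n)
  have h2 := Int.emod_nonneg (2 * u + n) (b := 2 * n) (by positivity)
  have h3 := Int.emod_lt_of_pos (2 * u + n) (b := 2 * n) (by positivity)
  rw [abs_le]
  constructor <;> nlinarith

/-- The `ω`-coordinate is rounded first, leaving a remainder of size at most `n / 2`; the others are
then rounded so that each of the remaining three terms in `four_mul_normZ` is at most `n²`. Four
times the norm is thus at most `n² / 4 + 3n² < 4n²`. The finer first rounding is what makes the
inequality strict. -/
theorem exists_close (x : Hurwitz) {n : ℕ} (hn : 0 < n) :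
    ∃ z : Hurwitz, norm (x - n * z) < n ^ 2 := by
  have aux : ∀ α u : ℤ, ∃ k : ℤ, |α + 2 * (u - n * k)| ≤ n := by
    intro α u
    obtain ⟨k, hk⟩ := exists_int_close (α + 2 * u) (n := 2 * n) (by positivity)
    refine ⟨k, ?_⟩
    push_cast at hk
    rw [abs_le] at hk ⊢
    constructor <;> linarith [hk.1, hk.2]
  obtain ⟨a', ha⟩ := exists_int_close x.a hn
  obtain ⟨b', hb⟩ := aux (x.a - n * a') x.b
  obtain ⟨c', hc⟩ := aux (x.a - n * a') x.c
  obtain ⟨d', hd⟩ := aux (x.a - n * a') x.d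
  refine ⟨⟨a', b', c', d'⟩, ?_⟩
  zify
  rw [norm_cast]
  have h4 := four_mul_normZ (x - n * ⟨a', b', c', d'⟩)
  have e : x - n * ⟨a', b', c', d'⟩ =
      ⟨x.a - n * a', x.b - n * b', x.c - n * c', x.d - n * d'⟩ := by ext <;> simp <;> ring
  rw [e] at h4 ⊢
  simp only at h4
  have ha2 := sq_le_sq' (abs_le.1 ha).1 (abs_le.1 ha).2
  have hb2 := sq_le_sq' (abs_le.1 hb).1 (abs_le.1 hb).2
  have hc2 := sq_le_sq' (abs_le.1 hc).1 (abs_le.1 hc).2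
  have hd2 := sq_le_sq' (abs_le.1 hd).1 (abs_le.1 hd).2
  have hn' : (0 : ℤ) < (n : ℤ) ^ 2 := by positivity
  nlinarith

/-- The quotient approximates `x y⁻¹ = x ȳ / norm y`. It stands to the left of `y`, so the Euclidean
algorithm works for left ideals. -/
theorem exists_norm_sub_lt (x : Hurwitz) {y : Hurwitz} (hy : y ≠ 0) :
    ∃ z : Hurwitz, norm (x - z * y) < norm y := by
  have hpos := Nat.pos_of_ne_zero (mt norm_eq_zero.1 hy)
  obtain ⟨z, hz⟩ := exists_close (x * conj y) hpos
  refine ⟨z, ?_⟩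
  have e : x * conj y - norm y * z = (x - z * y) * conj y := by
    rw [sub_mul, mul_assoc z, mul_conj, (Nat.cast_commute _ z).eq]
  rw [e, norm_mul, norm_conj, sq] at hz
  exact lt_of_mul_lt_mul_right hz (Nat.zero_le _)

/-- Every left ideal of the Hurwitz order is principal. -/
theorem ideal_eq_span (I : Ideal Hurwitz) : ∃ q, I = Ideal.span {q} := by
  by_cases hI : ∃ x ∈ I, x ≠ 0
  · obtain ⟨q, ⟨hqI, hq0⟩, hmin⟩ :=
      WellFounded.has_min (measure norm).wf {x | x ∈ I ∧ x ≠ 0} hI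
    refine ⟨q, le_antisymm (fun x hx => ?_) (by simpa [Ideal.span_le] using hqI)⟩
    obtain ⟨z, hz⟩ := exists_norm_sub_lt x hq0
    rw [Ideal.mem_span_singleton']
    refine ⟨z, ?_⟩
    by_contra hne
    exact hmin (x - z * q) ⟨I.sub_mem hx (I.mul_mem_left z hqI),
      sub_ne_zero.2 (Ne.symm hne)⟩ hz
  · push Not at hI
    exact ⟨0, le_antisymm (fun x hx => by simp [hI x hx]) (by simp)⟩

/-- The element `1 + i` of norm `2`. -/
def pi : Hurwitz := ⟨2, 0, -1, -1⟩

@[simp] theorem norm_pi : norm pi = 2 := rfl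

/-- Because `u² ≡ u` modulo 2, the norm is congruent to `(1 + a)(1 + b + c + d) - 1`; it is even
only if both factors are odd. -/
theorem even_coords {x : Hurwitz} (h : 2 ∣ norm x) :
    ∃ a s, x.a = 2 * a ∧ x.b + x.c + x.d = 2 * s := by
  have h1 : (2 : ℤ) ∣ normZ x := by rw [← norm_cast]; exact_mod_cast h
  have h2 : Even (normZ x) := even_iff_two_dvd.2 h1
  have e : normZ x + 1 = (1 + x.a) * (1 + (x.b + x.c + x.d))
      + (x.a * (x.a - 1) + x.b * (x.b - 1) + x.c * (x.c - 1) + x.d * (x.d - 1)) := by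
    simp only [normZ]; ring
  have ev : ∀ u : ℤ, Even (u * (u - 1)) := fun u => Int.even_mul_pred_self u
  have h3 : Odd ((1 + x.a) * (1 + (x.b + x.c + x.d))) := by
    have h4 : Odd (normZ x + 1) := h2.add_one
    rw [e] at h4
    exact (Int.odd_add.1 h4).2 (((ev _).add (ev _)).add (ev _) |>.add (ev _))
  rw [Int.odd_mul] at h3
  obtain ⟨⟨u, hu⟩, ⟨v, hv⟩⟩ := h3
  exact ⟨u, v, by linarith, by linarith⟩

theorem exists_mul_pi {x : Hurwitz} (h : 2 ∣ norm x) : ∃ y, x = y * pi := by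
  obtain ⟨a, s, ha, hs⟩ := even_coords h
  -- The coordinates of `x * conj pi / 2`, integral by `even_coords`.
  refine ⟨⟨x.a + x.b, -a, x.c - a - s, s - x.b⟩, ?_⟩
  ext <;> simp [pi] <;> linarith

theorem exists_pi_mul {x : Hurwitz} (h : 2 ∣ norm x) : ∃ y, x = pi * y := by
  obtain ⟨a, s, ha, hs⟩ := even_coords h
  refine ⟨⟨x.a + x.b, -a, s - x.b, x.d - a - s⟩, ?_⟩
  ext <;> simp [pi] <;> linarith

end Hurwitz

/-! ### Splitting of the order at odd prime powers -/

namespace Hurwitz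

open Matrix

/-- The ring homomorphism from the Hurwitz order to `2 × 2` matrices given by a solution of
`x² + y² = -1` and an inverse of `2`. -/
def splitHom {K : Type*} [CommRing K] {h x y : K} (hh : 2 * h = 1) (hxy : x ^ 2 + y ^ 2 = -1) :
    Hurwitz →+* Matrix (Fin 2) (Fin 2) K where
  -- Here `i ↦ !![0, -1; 1, 0]`, `j ↦ !![x, y; y, -x]`, `k ↦ !![-y, x; x, y]`, and `ω` goes to `h`
  -- times the sum of `1` and these three.
  toFun v := !![v.a * h * (1 + x - y) + v.c * x - v.d * y,
      v.a * h * (-1 + x + y) - v.b + v.c * y + v.d * x;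
    v.a * h * (1 + x + y) + v.b + v.c * y + v.d * x,
      v.a * h * (1 - x + y) - v.c * x + v.d * y]
  map_zero' := by ext i j; fin_cases i <;> fin_cases j <;> simp
  map_one' := by
    ext i j
    fin_cases i <;> fin_cases j <;> simp
    · linear_combination (1 + x - y) * hh
    · linear_combination (-1 + x + y) * hh
    · linear_combination (1 + x + y) * hh
    · linear_combination (1 - x + y) * hh
  map_add' u v := by
    ext i j
    fin_cases i <;> fin_cases j <;> simp <;> ring
  map_mul' u v := by
    -- With `A = a h` as the variable in place of `a`, the factor `h` disappears and only polynomial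
    -- identities modulo `x² + y² + 1` remain.
    have e : ∀ z : ℤ, (z : K) = 2 * (z * h) := fun z => by linear_combination -(z : K) * hh
    have e' : ((u * v).a : K) * h = -(2 * (u.a * h) * (v.a * h))
        - u.a * h * (v.b + v.c + v.d) - (u.b + u.c + u.d) * (v.a * h)
        - (u.b * v.b + u.c * v.c + u.d * v.d) := by
      rw [mul_a]
      push_cast
      linear_combination (u.a * v.a * h - (u.b * v.b + u.c * v.c + u.d * v.d)) * hh
    rw [e']
    simp only [mul_b, mul_c, mul_d, Int.cast_add, Int.cast_sub, Int.cast_mul]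
    rw [e u.a, e v.a]
    have e1 : 2 * ((u.a : K) * h) * h = u.a * h := by linear_combination (u.a : K) * h * hh
    have e2 : 2 * ((v.a : K) * h) * h = v.a * h := by linear_combination (v.a : K) * h * hh
    rw [e1, e2]
    generalize (u.a : K) * h = A
    generalize (v.a : K) * h = B
    ext i j
    fin_cases i <;> fin_cases j <;> simp [Matrix.mul_apply, Fin.sum_univ_two]
    · linear_combination (-2 * A * B - A * v.c - u.c * B - u.c * v.c - A * v.d - u.d * B
        - u.d * v.d) * hxy
    · linear_combination (-A * v.d - u.c * B - u.c * v.d + A * v.c + u.d * B + u.d * v.c) * hxy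
    · linear_combination (-A * v.c - u.d * B - u.d * v.c + A * v.d + u.c * B + u.c * v.d) * hxy
    · linear_combination (-2 * A * B - A * v.d - u.d * B - u.d * v.d - A * v.c - u.c * B
        - u.c * v.c) * hxy

theorem splitHom_apply {K : Type*} [CommRing K] {h x y : K} (hh : 2 * h = 1)
    (hxy : x ^ 2 + y ^ 2 = -1) (v : Hurwitz) : splitHom hh hxy v =
    !![v.a * h * (1 + x - y) + v.c * x - v.d * y,
      v.a * h * (-1 + x + y) - v.b + v.c * y + v.d * x;
    v.a * h * (1 + x + y) + v.b + v.c * y + v.d * x,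
      v.a * h * (1 - x + y) - v.c * x + v.d * y] := rfl

theorem det_splitHom {K : Type*} [CommRing K] {h x y : K} (hh : 2 * h = 1)
    (hxy : x ^ 2 + y ^ 2 = -1) (v : Hurwitz) :
    (splitHom hh hxy v).det = (norm v : K) := by
  have e : (norm v : K) = ((normZ v : ℤ) : K) := by rw [← norm_cast]; simp
  rw [e, splitHom_apply, det_fin_two_of]
  simp only [normZ]
  push_cast
  have ea : (v.a : K) = 2 * (v.a * h) := by linear_combination -(v.a : K) * hh
  have e1 : 2 * ((v.a : K) * h) * h = v.a * h := by linear_combination (v.a : K) * h * hh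
  rw [ea, e1]
  generalize (v.a : K) * h = A
  linear_combination (-(2 * A ^ 2) - 2 * A * v.c - v.c ^ 2 - 2 * A * v.d - v.d ^ 2) * hxy

theorem splitHom_surjective {K : Type*} [CommRing K] {h x y : K} (hh : 2 * h = 1)
    (hxy : x ^ 2 + y ^ 2 = -1) (hK : Function.Surjective (Int.cast : ℤ → K)) :
    Function.Surjective (splitHom hh hxy) := by
  intro M
  -- The trace of the image is the `ω`-coordinate. Subtracting that multiple of the image of `ω`
  -- leaves a trace-zero matrix, which is expanded in the images of `i`, `j`, `k`.
  obtain ⟨a, ha⟩ := hK (M 0 0 + M 1 1)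
  set s := M 0 0 - (M 0 0 + M 1 1) * h * (1 + x - y) with hs
  set t := M 0 1 - (M 0 0 + M 1 1) * h * (-1 + x + y) with ht
  set u := M 1 0 - (M 0 0 + M 1 1) * h * (1 + x + y) with hu
  obtain ⟨b, hb⟩ := hK (h * (u - t))
  obtain ⟨c, hc⟩ := hK (-(x * s + y * (h * (t + u))))
  obtain ⟨d, hd⟩ := hK (y * s - x * (h * (t + u)))
  refine ⟨⟨a, b, c, d⟩, ?_⟩
  rw [splitHom_apply]
  ext i j
  fin_cases i <;> fin_cases j <;> simp [ha, hb, hc, hd]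
  · linear_combination (-s) * hxy - hs
  · linear_combination (-(h * (t + u))) * hxy + t * hh - ht
  · linear_combination (-(h * (t + u))) * hxy + u * hh - hu
  · linear_combination s * hxy + hs + (M 0 0 + M 1 1) * hh

theorem splitHom_eq_zero {K : Type*} [CommRing K] {h x y : K} (hh : 2 * h = 1)
    (hxy : x ^ 2 + y ^ 2 = -1) (v : Hurwitz) : splitHom hh hxy v = 0 ↔
      (v.a : K) = 0 ∧ (v.b : K) = 0 ∧ (v.c : K) = 0 ∧ (v.d : K) = 0 := by
  rw [splitHom_apply]
  constructor
  · intro H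
    have h00 := congrFun (congrFun H 0) 0
    have h01 := congrFun (congrFun H 0) 1
    have h10 := congrFun (congrFun H 1) 0
    have h11 := congrFun (congrFun H 1) 1
    simp at h00 h01 h10 h11
    have ha : (v.a : K) = 0 := by linear_combination h00 + h11 - v.a * hh
    rw [ha] at h00 h01 h10 h11
    refine ⟨ha, ?_, ?_, ?_⟩
    · linear_combination h * (h10 - h01) - v.b * hh
    · linear_combination v.c * hxy - x * h00 - y * h * (h01 + h10) + y * (v.c * y + v.d * x) * hh
    · linear_combination v.d * hxy + y * h00 - x * h * (h01 + h10) + x * (v.c * y + v.d * x) * hh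
  · rintro ⟨ha, hb, hc, hd⟩
    ext i j
    fin_cases i <;> fin_cases j <;> simp [ha, hb, hc, hd]

/-- Hensel lifting in the variable `x` of a solution modulo `p`. The derivative `2x` must be a unit,
so the induction carries `p ∤ x`; at the start one of the two variables has this property, since `p`
cannot divide both. -/
theorem exists_sq_add_sq {p : ℕ} (hp : p.Prime) (hp2 : p ≠ 2) (k : ℕ) :
    ∃ x y : ℤ, (p : ℤ) ^ k ∣ x ^ 2 + y ^ 2 + 1 := by
  have : Fact p.Prime := ⟨hp⟩
  have hpZ : Prime (p : ℤ) := Nat.prime_iff_prime_int.1 hp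
  have key : ∀ k : ℕ, ∃ x y : ℤ, ¬ (p : ℤ) ∣ x ∧ (p : ℤ) ^ (k + 1) ∣ x ^ 2 + y ^ 2 + 1 := by
    intro k
    induction k with
    | zero =>
      obtain ⟨a, b, hab⟩ := Nat.sq_add_sq_zmodEq p (-1)
      obtain ⟨-, -, hab⟩ := hab
      have h : (p : ℤ) ∣ (a : ℤ) ^ 2 + (b : ℤ) ^ 2 + 1 := by
        have := hab.symm.dvd
        simpa using this
      by_cases ha : (p : ℤ) ∣ a
      · refine ⟨b, a, fun hb => ?_, by simpa [add_comm] using h⟩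
        have h1 : (p : ℤ) ∣ 1 := by
          have e : (1 : ℤ) = ((a : ℤ) ^ 2 + (b : ℤ) ^ 2 + 1) - (a : ℤ) ^ 2 - (b : ℤ) ^ 2 := by ring
          rw [e]
          exact dvd_sub (dvd_sub h (dvd_pow ha two_ne_zero)) (dvd_pow hb two_ne_zero)
        exact hpZ.not_dvd_one h1
      · exact ⟨a, b, ha, by simpa using h⟩
    | succ k ih =>
      obtain ⟨x, y, hx, t, ht⟩ := ih
      have hco : IsCoprime (p : ℤ) (2 * x) := by
        refine (Prime.coprime_iff_not_dvd hpZ).2 fun hd => ?_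
        rcases hpZ.dvd_or_dvd hd with h | h
        · have h2 : p ∣ 2 := by exact_mod_cast h
          exact hp2 ((Nat.prime_dvd_prime_iff_eq hp Nat.prime_two).1 h2)
        · exact hx h
      obtain ⟨u, v, huv⟩ := hco
      -- Newton's correction: `v` inverts `2x` modulo `p`, so the linear term cancels `t` modulo
      -- `p`.
      refine ⟨x + (p : ℤ) ^ (k + 1) * (-(v * t)), y, fun hd => hx ?_, ?_⟩
      · have := dvd_sub hd (Dvd.dvd.mul_right (dvd_pow_self (p : ℤ) k.succ_ne_zero) (-(v * t)))
        simpa using this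
      · refine ⟨u * t + (p : ℤ) ^ k * (v * t) ^ 2, ?_⟩
        linear_combination ht - (p : ℤ) ^ (k + 1) * t * huv
  rcases k with _ | k
  · exact ⟨0, 0, by simp⟩
  · obtain ⟨x, y, -, h⟩ := key k
    exact ⟨x, y, h⟩

/-- Modulo `p ^ k` the number 2 is invertible and `-1` is a sum of two squares, so `splitHom`
applies. Local indices and ideal counts thereby become computations with 2 × 2 matrices. -/
theorem exists_split {p : ℕ} (hp : p.Prime) (hp2 : p ≠ 2) (k : ℕ) :
    ∃ φ : Hurwitz →+* Matrix (Fin 2) (Fin 2) (ZMod (p ^ k)), Function.Surjective φ ∧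
      (∀ v, φ v = 0 ↔ ((p ^ k : ℕ) : Hurwitz) ∣ v) ∧ ∀ v, (φ v).det = (norm v : ZMod (p ^ k)) := by
  obtain ⟨x, y, hxy⟩ := exists_sq_add_sq hp hp2 k
  have hxy' : (x : ZMod (p ^ k)) ^ 2 + (y : ZMod (p ^ k)) ^ 2 = -1 := by
    have := (ZMod.intCast_zmod_eq_zero_iff_dvd (x ^ 2 + y ^ 2 + 1) (p ^ k)).2
      (by exact_mod_cast hxy)
    push_cast at this
    linear_combination this
  have hco : Nat.Coprime 2 (p ^ k) :=
    Nat.Coprime.pow_right k ((Nat.coprime_primes Nat.prime_two hp).2 (Ne.symm hp2))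
  have hh : (2 : ZMod (p ^ k)) * (2 : ZMod (p ^ k))⁻¹ = 1 := by
    exact_mod_cast ZMod.coe_mul_inv_eq_one 2 hco
  refine ⟨splitHom hh hxy', splitHom_surjective hh hxy' ZMod.intCast_surjective, fun v => ?_,
    det_splitHom hh hxy'⟩
  rw [splitHom_eq_zero, natCast_dvd_iff]
  simp only [ZMod.intCast_zmod_eq_zero_iff_dvd]

end Hurwitz

/-! ### Index of the kernel of `y ↦ q y r` modulo an odd number -/

namespace Hurwitz

open Matrix

/-- The kernel of `y ↦ q y r` modulo `m`. -/
def sandwichKer (q r : Hurwitz) (m : ℕ) : AddSubgroup Hurwitz where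
  carrier := {y | (m : Hurwitz) ∣ q * y * r}
  zero_mem' := by simp
  add_mem' {x y} hx hy := by
    simp only [Set.mem_ofPred_eq] at *
    rw [mul_add, add_mul]
    exact dvd_add hx hy
  neg_mem' {x} hx := by
    simp only [Set.mem_ofPred_eq] at *
    simpa using hx

theorem mem_sandwichKer {q r y : Hurwitz} {m : ℕ} :
    y ∈ sandwichKer q r m ↔ (m : Hurwitz) ∣ q * y * r := Iff.rfl

/-- A unit entry serves as pivot for clearing its row and column; if it is not in the top left
corner, the swap matrix `S` moves it there. -/
theorem exists_smith_form {K : Type*} [CommRing K] (Q : Matrix (Fin 2) (Fin 2) K) {i j : Fin 2}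
    (h : IsUnit (Q i j)) : ∃ (U V : (Matrix (Fin 2) (Fin 2) K)ˣ) (δ : K),
      Q = U * !![1, 0; 0, δ] * V := by
  have key : ∀ Q : Matrix (Fin 2) (Fin 2) K, IsUnit (Q 0 0) →
      ∃ (U V : (Matrix (Fin 2) (Fin 2) K)ˣ) (δ : K), Q = U * !![1, 0; 0, δ] * V := by
    rintro Q ⟨u, hu⟩
    have hU : IsUnit !![1, 0; Q 1 0 * (u⁻¹ : Kˣ), 1].det := by simp [det_fin_two_of]
    have hV : IsUnit !![Q 0 0, Q 0 1; 0, 1].det := by simp [det_fin_two_of, ← hu]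
    have huu : (u⁻¹ : Kˣ) * Q 0 0 = 1 := by rw [← hu]; simp
    refine ⟨((isUnit_iff_isUnit_det _).2 hU).unit, ((isUnit_iff_isUnit_det _).2 hV).unit,
      Q 1 1 - Q 1 0 * (u⁻¹ : Kˣ) * Q 0 1, ?_⟩
    ext a b
    fin_cases a <;> fin_cases b <;> simp
    linear_combination -Q 1 0 * huu
  have hS : (!![0, 1; 1, 0] : Matrix (Fin 2) (Fin 2) K) * !![0, 1; 1, 0] = 1 := by
    ext a b; fin_cases a <;> fin_cases b <;> simp
  let S : (Matrix (Fin 2) (Fin 2) K)ˣ := ⟨!![0, 1; 1, 0], !![0, 1; 1, 0], hS, hS⟩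
  have hl : ∀ Q : Matrix (Fin 2) (Fin 2) K, IsUnit (Q 1 0) →
      ∃ (U V : (Matrix (Fin 2) (Fin 2) K)ˣ) (δ : K), Q = U * !![1, 0; 0, δ] * V := by
    intro Q hQ
    obtain ⟨U, V, δ, h⟩ := key (S * Q) (by simpa [S, Matrix.mul_apply, Fin.sum_univ_two] using hQ)
    refine ⟨S * U, V, δ, ?_⟩
    have e : (U : Matrix (Fin 2) (Fin 2) K) * (!![1, 0; 0, δ] * V) = S * Q := by
      rw [h, mul_assoc]
    rw [Units.val_mul, mul_assoc, mul_assoc, e, ← mul_assoc]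
    change Q = !![0, 1; 1, 0] * !![0, 1; 1, 0] * Q
    rw [hS, one_mul]
  have hr : ∀ Q : Matrix (Fin 2) (Fin 2) K, (IsUnit (Q 0 1) ∨ IsUnit (Q 1 1)) →
      ∃ (U V : (Matrix (Fin 2) (Fin 2) K)ˣ) (δ : K), Q = U * !![1, 0; 0, δ] * V := by
    intro Q hQ
    have : ∃ (U V : (Matrix (Fin 2) (Fin 2) K)ˣ) (δ : K), Q * S = U * !![1, 0; 0, δ] * V := by
      rcases hQ with hQ | hQ
      · exact key (Q * S) (by simpa [S, Matrix.mul_apply, Fin.sum_univ_two] using hQ)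
      · exact hl (Q * S) (by simpa [S, Matrix.mul_apply, Fin.sum_univ_two] using hQ)
    obtain ⟨U, V, δ, h⟩ := this
    refine ⟨U, V * S, δ, ?_⟩
    rw [Units.val_mul, ← mul_assoc, ← h, mul_assoc]
    change Q = Q * (!![0, 1; 1, 0] * !![0, 1; 1, 0])
    rw [hS, mul_one]
  fin_cases i <;> fin_cases j
  · exact key Q h
  · exact hr Q (Or.inl h)
  · exact hl Q h
  · exact hr Q (Or.inr h)

/-- The elements `δ` and `n` are associated, so they have the same multiples, and the additive order
of `n` modulo `N` is `N / gcd(N, n)`. -/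
theorem card_range_mul_left {N : ℕ} (hN : N ≠ 0) {δ : ZMod N} {u : ZMod N} (hu : IsUnit u) {n : ℕ}
    (h : (n : ZMod N) = u * δ) : (Set.range fun x : ZMod N => δ * x).ncard = N / N.gcd n := by
  have e : (Set.range fun x : ZMod N => δ * x) = Set.range fun x : ZMod N => (n : ZMod N) * x := by
    obtain ⟨v, rfl⟩ := hu
    ext z
    constructor
    · rintro ⟨x, rfl⟩
      exact ⟨(v⁻¹ : (ZMod N)ˣ) * x, by simp only [h]; linear_combination δ * x * v.mul_inv⟩
    · rintro ⟨x, rfl⟩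
      exact ⟨v * x, by simp only [h]; ring⟩
  have e2 : (Set.range fun x : ZMod N => (n : ZMod N) * x) =
      (AddSubgroup.zmultiples (n : ZMod N) : Set (ZMod N)) := by
    ext z
    simp only [Set.mem_range, SetLike.mem_coe, AddSubgroup.mem_zmultiples_iff, zsmul_eq_mul]
    constructor
    · rintro ⟨x, rfl⟩
      obtain ⟨k, rfl⟩ := ZMod.intCast_surjective x
      exact ⟨k, mul_comm _ _⟩
    · rintro ⟨k, rfl⟩
      exact ⟨k, mul_comm _ _⟩
  rw [e, e2, ← Nat.card_coe_set_eq, SetLike.coe_sort_coe, Nat.card_zmultiples,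
    ZMod.addOrderOf_coe _ hN]

/-- The four entries are multiplied independently by `1`, `δ`, `ε` and `δ ε`, so the image is a
product of four sets. -/
theorem card_range_diagonal {K : Type*} [CommRing K] [Finite K] (δ ε : K) :
    (Set.range fun M : Matrix (Fin 2) (Fin 2) K =>
      !![1, 0; 0, δ] * M * !![1, 0; 0, ε]).ncard =
    Nat.card K * (Set.range fun x : K => δ * x).ncard * (Set.range fun x : K => ε * x).ncard *
      (Set.range fun x : K => δ * ε * x).ncard := by
  let g : Matrix (Fin 2) (Fin 2) K → K × K × K × K := fun X => (X 0 0, X 1 0, X 0 1, X 1 1)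
  have hg : Function.Injective g := by
    intro X Y h
    simp only [g, Prod.mk.injEq] at h
    ext i j
    fin_cases i <;> fin_cases j <;> simp [h]
  rw [← Set.ncard_image_of_injective _ hg]
  have : g '' (Set.range fun M : Matrix (Fin 2) (Fin 2) K =>
      !![1, 0; 0, δ] * M * !![1, 0; 0, ε]) =
      Set.univ ×ˢ (Set.range fun x : K => δ * x) ×ˢ (Set.range fun x : K => ε * x) ×ˢ
        (Set.range fun x : K => δ * ε * x) := by
    ext ⟨a, b, c, d⟩
    simp only [Set.mem_image, Set.mem_range, exists_exists_eq_and, Set.mem_prod, Set.mem_univ,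
      true_and, g]
    constructor
    · rintro ⟨M, hM⟩
      simp [Matrix.mul_apply, Fin.sum_univ_two] at hM
      obtain ⟨rfl, rfl, rfl, rfl⟩ := hM
      refine ⟨⟨M 1 0, ?_⟩, ⟨M 0 1, ?_⟩, ⟨M 1 1, ?_⟩⟩ <;>
        simp [Matrix.vecMul, dotProduct, Fin.sum_univ_two] <;> ring
    · rintro ⟨⟨x, rfl⟩, ⟨y, rfl⟩, ⟨z, rfl⟩⟩
      refine ⟨!![a, y; x, z], ?_⟩
      simp [Matrix.mul_apply, Fin.sum_univ_two]
      constructor <;> ring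
  rw [this, Set.ncard_prod, Set.ncard_prod, Set.ncard_prod, Set.ncard_univ]
  ring

theorem ncard_range_units_mul {K : Type*} [CommRing K] [Finite K]
    (U V U' V' : (Matrix (Fin 2) (Fin 2) K)ˣ) (D E : Matrix (Fin 2) (Fin 2) K) :
    (Set.range fun M : Matrix (Fin 2) (Fin 2) K => (U * D * V) * M * (U' * E * V')).ncard =
    (Set.range fun M : Matrix (Fin 2) (Fin 2) K => D * M * E).ncard := by
  have hinj : Function.Injective fun X : Matrix (Fin 2) (Fin 2) K => 
      (U : Matrix (Fin 2) (Fin 2) K) * X * (V' : Matrix (Fin 2) (Fin 2) K) :=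
    fun X Y h => by
      have h' := congrArg (fun Z : Matrix (Fin 2) (Fin 2) K => (U⁻¹ : (Matrix (Fin 2) (Fin 2) K)ˣ) * Z *
        (V'⁻¹ : (Matrix (Fin 2) (Fin 2) K)ˣ)) h
      simpa only [mul_assoc, Units.inv_mul_cancel_left, Units.mul_inv, mul_one] using h'
  rw [← Set.ncard_image_of_injective (Set.range fun M => D * M * E) hinj]
  congr 1
  ext X
  simp only [Set.mem_range, Set.mem_image, exists_exists_eq_and]
  constructor
  · rintro ⟨M, rfl⟩
    exact ⟨V * M * U', by simp only [mul_assoc]⟩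
  · rintro ⟨M, rfl⟩
    refine ⟨(V⁻¹ : (Matrix (Fin 2) (Fin 2) K)ˣ) * M * (U'⁻¹ : (Matrix (Fin 2) (Fin 2) K)ˣ), ?_⟩
    simp only [mul_assoc, Units.mul_inv_cancel_left, Units.inv_mul_cancel_left]

/-- At an odd prime power, a primitive element has a matrix with an invertible entry. -/
theorem exists_isUnit_entry {p k : ℕ} (hp : p.Prime)
    {φ : Hurwitz →+* Matrix (Fin 2) (Fin 2) (ZMod (p ^ k))} (hφ : Function.Surjective φ)
    (hker : ∀ v, φ v = 0 ↔ ((p ^ k : ℕ) : Hurwitz) ∣ v) {q : Hurwitz}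
    (hq : PrimitiveAt (p ^ k) q) : ∃ i j, IsUnit (φ q i j) := by
  rcases Nat.eq_zero_or_pos k with rfl | hk
  · have : Subsingleton (ZMod (p ^ 0)) := by rw [pow_zero]; infer_instance
    exact ⟨0, 0, isUnit_of_subsingleton _⟩
  by_contra hno
  push Not at hno
  -- If no entry is a unit, every entry is a multiple of `p`; lifting the cofactor matrix through
  -- `φ` shows that `p` divides `q`.
  have hdiv : ∀ z : ZMod (p ^ k), ¬ IsUnit z → ∃ w, z = p * w := by
    intro z hz
    have : NeZero (p ^ k) := ⟨pow_ne_zero _ hp.ne_zero⟩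
    obtain ⟨n, rfl⟩ := ZMod.natCast_zmod_surjective z
    rw [ZMod.isUnit_iff_coprime, Nat.coprime_pow_right_iff hk, Nat.coprime_comm,
      hp.coprime_iff_not_dvd, not_not] at hz
    obtain ⟨w, rfl⟩ := hz
    exact ⟨w, by push_cast; rfl⟩
  choose w hw using fun i j => hdiv _ (hno i j)
  obtain ⟨y, hy⟩ := hφ (Matrix.of w)
  have h0 : φ (q - p * y) = 0 := by
    rw [map_sub, map_mul, hy, map_natCast]
    ext i j
    rw [Matrix.sub_apply, hw, ← nsmul_eq_mul p (Matrix.of w), Matrix.smul_apply, nsmul_eq_mul,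
      Matrix.of_apply, sub_self, Matrix.zero_apply]
  have h1 := (hker _).1 h0
  refine hq p hp (dvd_pow_self p hk.ne') ?_
  have h2 : (p : Hurwitz) ∣ q - p * y :=
    (Nat.cast_dvd_cast (dvd_pow_self p hk.ne')).trans h1
  simpa using dvd_add h2 (Dvd.intro y rfl)

/-- The index is the size of the image of `M ↦ φ q * M * φ r`. Replacing both matrices by their
Smith forms `diag(1, δ)` and `diag(1, ε)` does not change it, and taking determinants identifies `δ`
and `ε` with the norms up to units. -/
theorem index_sandwichKer_prime_pow {p k : ℕ} (hp : p.Prime) (hp2 : p ≠ 2) {q r : Hurwitz}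
    (hq : PrimitiveAt (p ^ k) q) (hr : PrimitiveAt (p ^ k) r) :
    (sandwichKer q r (p ^ k)).index = p ^ k * (p ^ k / (p ^ k).gcd (norm q)) *
      (p ^ k / (p ^ k).gcd (norm r)) * (p ^ k / (p ^ k).gcd (norm q * norm r)) := by
  obtain ⟨φ, hφ, hker, hdet⟩ := exists_split hp hp2 k
  have hN : p ^ k ≠ 0 := pow_ne_zero _ hp.ne_zero
  have : NeZero (p ^ k) := ⟨hN⟩
  let f : Hurwitz →+ Matrix (Fin 2) (Fin 2) (ZMod (p ^ k)) :=
    (AddMonoidHom.mulRight (φ r)).comp ((AddMonoidHom.mulLeft (φ q)).comp φ.toAddMonoidHom)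
  have hf : ∀ y, f y = φ q * φ y * φ r := fun y => rfl
  have hK : sandwichKer q r (p ^ k) = f.ker := by
    ext y
    rw [mem_sandwichKer, AddMonoidHom.mem_ker, hf, ← map_mul, ← map_mul, hker]
  have hrange : (f.range : Set _) = Set.range fun M => φ q * M * φ r := by
    ext X
    simp only [SetLike.mem_coe, AddMonoidHom.mem_range, Set.mem_range]
    constructor
    · rintro ⟨y, rfl⟩
      exact ⟨φ y, rfl⟩
    · rintro ⟨M, rfl⟩
      obtain ⟨y, rfl⟩ := hφ M
      exact ⟨y, rfl⟩
  obtain ⟨i, j, hij⟩ := exists_isUnit_entry hp hφ hker hq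
  obtain ⟨U, V, δ, hQ⟩ := exists_smith_form _ hij
  obtain ⟨i, j, hij⟩ := exists_isUnit_entry hp hφ hker hr
  obtain ⟨U', V', ε, hR⟩ := exists_smith_form _ hij
  have hu : ∀ W : (Matrix (Fin 2) (Fin 2) (ZMod (p ^ k)))ˣ,
      IsUnit (W : Matrix (Fin 2) (Fin 2) (ZMod (p ^ k))).det :=
    fun W => (isUnit_iff_isUnit_det _).1 W.isUnit
  have hdq : (norm q : ZMod (p ^ k)) = U.1.det * V.1.det * δ := by
    rw [← hdet, hQ, det_mul, det_mul, det_fin_two_of]; ring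
  have hdr : (norm r : ZMod (p ^ k)) = U'.1.det * V'.1.det * ε := by
    rw [← hdet, hR, det_mul, det_mul, det_fin_two_of]; ring
  have hdqr : ((norm q * norm r : ℕ) : ZMod (p ^ k)) =
      U.1.det * V.1.det * (U'.1.det * V'.1.det) * (δ * ε) := by
    push_cast; rw [hdq, hdr]; ring
  rw [hK, AddSubgroup.index_ker, ← SetLike.coe_sort_coe, Nat.card_coe_set_eq, hrange, hQ, hR,
    ncard_range_units_mul, card_range_diagonal,
    card_range_mul_left hN ((hu U).mul (hu V)) hdq,
    card_range_mul_left hN ((hu U').mul (hu V')) hdr,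
    card_range_mul_left hN (((hu U).mul (hu V)).mul ((hu U').mul (hu V'))) hdqr, Nat.card_zmod]

theorem index_inf_of_coprime {G : Type*} [AddGroup G] {H K : AddSubgroup G} (hH : H.index ≠ 0)
    (hK : K.index ≠ 0) (h : H.index.Coprime K.index) : (H ⊓ K).index = H.index * K.index := by
  refine le_antisymm AddSubgroup.index_inf_le (Nat.le_of_dvd
    (Nat.pos_of_ne_zero (AddSubgroup.index_inf_ne_zero hH hK)) ?_)
  exact h.mul_dvd_of_dvd_of_dvd (AddSubgroup.index_dvd_of_le inf_le_left)
    (AddSubgroup.index_dvd_of_le inf_le_right)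

theorem sandwichKer_mul {q r : Hurwitz} {m n : ℕ} (h : m.Coprime n) :
    sandwichKer q r (m * n) = sandwichKer q r m ⊓ sandwichKer q r n := by
  ext y
  rw [AddSubgroup.mem_inf, mem_sandwichKer, mem_sandwichKer, mem_sandwichKer]
  refine ⟨fun hy => ⟨?_, ?_⟩, fun hy => natCast_mul_dvd_of_coprime h hy.1 hy.2⟩
  · exact (Nat.cast_dvd_cast (dvd_mul_right m n)).trans hy
  · exact (Nat.cast_dvd_cast (dvd_mul_left n m)).trans hy

theorem div_gcd_mul {m n : ℕ} (h : m.Coprime n) (a : ℕ) :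
    m * n / (m * n).gcd a = (m / m.gcd a) * (n / n.gcd a) := by
  rw [Nat.gcd_comm, h.gcd_mul, Nat.gcd_comm a, Nat.gcd_comm a,
    Nat.mul_div_mul_comm (Nat.gcd_dvd_left _ _) (Nat.gcd_dvd_left _ _)]

/-- The index of the kernel of `y ↦ q y r` modulo an odd number `m` at which `q` and `r` are
primitive. -/
theorem index_sandwichKer {m : ℕ} (hm : Odd m) {q r : Hurwitz} (hq : PrimitiveAt m q)
    (hr : PrimitiveAt m r) : (sandwichKer q r m).index = m * (m / m.gcd (norm q)) *
      (m / m.gcd (norm r)) * (m / m.gcd (norm q * norm r)) := by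
  induction m using Nat.recOnPosPrimePosCoprime with
  | zero => simp at hm
  | one =>
    -- The modulus 1 is the zeroth power of an odd prime; the choice of 3 is arbitrary.
    have := index_sandwichKer_prime_pow (k := 0) Nat.prime_three (by norm_num)
      (by rwa [pow_zero]) (by rwa [pow_zero]) (q := q) (r := r)
    rwa [pow_zero] at this
  | prime_pow p k hp hk =>
    refine index_sandwichKer_prime_pow hp ?_ hq hr
    rintro rfl
    exact (Nat.not_odd_iff_even.2 ((even_two).pow_of_ne_zero hk.ne')) hm
  | coprime a b ha hb hab iha ihb =>
    rw [Nat.odd_mul] at hm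
    have ha' := iha hm.1 (hq.mono (dvd_mul_right a b)) (hr.mono (dvd_mul_right a b))
    have hb' := ihb hm.2 (hq.mono (dvd_mul_left b a)) (hr.mono (dvd_mul_left b a))
    have ndvd : ∀ m x : ℕ, (m / m.gcd x) ∣ m := fun m x => Nat.div_dvd_of_dvd (Nat.gcd_dvd_left _ _)
    -- The index divides the fourth power of the modulus, so coprime moduli give coprime indices and
    -- these multiply.
    have dv : ∀ m x y z : ℕ, m * (m / m.gcd x) * (m / m.gcd y) * (m / m.gcd z) ∣ m ^ 4 := by
      intro m x y z
      have : m ^ 4 = m * m * m * m := by ring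
      rw [this]
      exact mul_dvd_mul (mul_dvd_mul (mul_dvd_mul dvd_rfl (ndvd _ _)) (ndvd _ _)) (ndvd _ _)
    have da := dv a (norm q) (norm r) (norm q * norm r)
    have db := dv b (norm q) (norm r) (norm q * norm r)
    rw [← ha'] at da
    rw [← hb'] at db
    rw [sandwichKer_mul hab, index_inf_of_coprime, ha', hb', div_gcd_mul hab, div_gcd_mul hab,
      div_gcd_mul hab]
    · ring
    · exact ne_zero_of_dvd_ne_zero (by positivity) da
    · exact ne_zero_of_dvd_ne_zero (by positivity) db
    · exact ((hab.pow 4 4).coprime_dvd_left da).coprime_dvd_right db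

theorem index_sandwichKer_ne_zero {m : ℕ} (hm : Odd m) {q r : Hurwitz} (hq : PrimitiveAt m q)
    (hr : PrimitiveAt m r) : (sandwichKer q r m).index ≠ 0 := by
  rw [index_sandwichKer hm hq hr]
  have h : ∀ x, m / m.gcd x ≠ 0 := fun x =>
    (Nat.div_pos (Nat.le_of_dvd hm.pos (Nat.gcd_dvd_left _ _)) (Nat.gcd_pos_of_pos_left _ hm.pos)).ne'
  exact mul_ne_zero (mul_ne_zero (mul_ne_zero hm.pos.ne' (h _)) (h _)) (h _)

/-- Write `a`, `b` for the norms. Expanding `gcd(c, a) gcd(c, b)` and using `a b = c²` gives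
`gcd(c², c a, c b) = c gcd(a, b)`, because `gcd(a, b) ∣ c`. The general index formula then collapses
to `c² / gcd(a, b)`, which is the least common multiple. -/
theorem index_sandwichKer_of_norm_mul_eq_sq {c : ℕ} (hc : Odd c) {q r : Hurwitz}
    (hq : IsPrimitive q) (hr : IsPrimitive r) (h : norm q * norm r = c ^ 2) :
    (sandwichKer q r c).index = (norm q).lcm (norm r) := by
  rw [index_sandwichKer hc (hq.at c) (hr.at c), h, Nat.gcd_eq_left (dvd_pow_self c two_ne_zero),
    Nat.div_self hc.pos, mul_one]
  generalize norm q = a at h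
  generalize norm r = b at h
  have hg : (a.gcd b) ∣ c := by
    rw [← Nat.pow_dvd_pow_iff two_ne_zero, ← h, sq]
    exact mul_dvd_mul (Nat.gcd_dvd_left _ _) (Nat.gcd_dvd_right _ _)
  have e : c.gcd a * c.gcd b = c * a.gcd b := by
    have h1 : c.gcd a * c.gcd b = (c * c).gcd (c * a.gcd b) := by
      rw [← Nat.gcd_mul_left, ← Nat.gcd_mul_right, ← Nat.gcd_mul_right, h, sq, ← Nat.gcd_mul_left,
        mul_comm a c]
      apply Nat.dvd_antisymm <;> simp only [Nat.dvd_gcd_iff]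
      · exact ⟨(Nat.gcd_dvd_left _ _).trans (Nat.gcd_dvd_left _ _),
          (Nat.gcd_dvd_left _ _).trans (Nat.gcd_dvd_right _ _),
          (Nat.gcd_dvd_right _ _).trans (Nat.gcd_dvd_left _ _)⟩
      · exact ⟨⟨Nat.gcd_dvd_left _ _, (Nat.gcd_dvd_right _ _).trans (Nat.gcd_dvd_left _ _)⟩,
          (Nat.gcd_dvd_right _ _).trans (Nat.gcd_dvd_right _ _), Nat.gcd_dvd_left _ _⟩
    rw [h1, Nat.gcd_eq_right (mul_dvd_mul_left c hg)]
  have ga := Nat.gcd_pos_of_pos_left a hc.pos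
  have gb := Nat.gcd_pos_of_pos_left b hc.pos
  have hu := Nat.div_mul_cancel (Nat.gcd_dvd_left c a)
  have hv := Nat.div_mul_cancel (Nat.gcd_dvd_left c b)
  have hl := Nat.gcd_mul_lcm a b
  apply Nat.eq_of_mul_eq_mul_right (Nat.mul_pos ga gb)
  calc c * (c / c.gcd a) * (c / c.gcd b) * (c.gcd a * c.gcd b)
      = c * (c / c.gcd a * c.gcd a) * (c / c.gcd b * c.gcd b) := by ring
    _ = c * (a.gcd b * a.lcm b) := by rw [hu, hv, hl, h]; ring
    _ = a.lcm b * (c.gcd a * c.gcd b) := by rw [e]; ring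

end Hurwitz

/-! ### Left ideals with a primitive generator, and multiplicativity of their number -/

namespace Hurwitz

open Matrix

/-- The index of a left ideal as an additive subgroup. -/
noncomputable def idealIndex (I : Ideal Hurwitz) : ℕ := (Submodule.toAddSubgroup I).index

theorem eq_of_le_of_idealIndex_eq {I I' : Ideal Hurwitz} (h : I ≤ I')
    (h0 : idealIndex I ≠ 0) (hi : idealIndex I = idealIndex I') : I = I' := by
  have h1 : Submodule.toAddSubgroup I ≤ Submodule.toAddSubgroup I' := h
  have h2 := AddSubgroup.relIndex_mul_index h1
  unfold idealIndex at *
  rw [← hi] at h2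
  have h3 : (Submodule.toAddSubgroup I).relIndex (Submodule.toAddSubgroup I') = 1 :=
    Nat.eq_of_mul_eq_mul_right (Nat.pos_of_ne_zero h0) (by rw [h2, one_mul])
  exact le_antisymm h (AddSubgroup.relIndex_eq_one.1 h3)

theorem mem_span_natCast {m : ℕ} {x : Hurwitz} :
    x ∈ Ideal.span {(m : Hurwitz)} ↔ (m : Hurwitz) ∣ x := by
  rw [Ideal.mem_span_singleton']
  constructor
  · rintro ⟨y, rfl⟩
    exact ⟨y, ((Nat.cast_commute m y).eq).symm⟩
  · rintro ⟨y, rfl⟩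
    exact ⟨y, ((Nat.cast_commute m y).eq).symm⟩

theorem idealIndex_natCast {m : ℕ} (hm : Odd m) : idealIndex (Ideal.span {(m : Hurwitz)}) = m ^ 4 := by
  have e : Submodule.toAddSubgroup (Ideal.span {(m : Hurwitz)}) = sandwichKer 1 1 m := by
    ext x
    rw [mem_sandwichKer, one_mul, mul_one, ← mem_span_natCast]
    rfl
  rw [idealIndex, e, index_sandwichKer hm (isPrimitive_one.at m) (isPrimitive_one.at m)]
  simp
  ring

/-- Right multiplication by `x` modulo `m` has kernel `sandwichKer 1 x m`, of index `m²`. This is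
the index of the multiples of `m` inside the ideal, and those multiples have index `m⁴` in the whole
order. -/
theorem idealIndex_span_pair {m : ℕ} (hm : Odd m) {x : Hurwitz} (hx : PrimitiveAt m x)
    (hn : m ∣ norm x) : idealIndex (Ideal.span {x, (m : Hurwitz)}) = m ^ 2 := by
  set A := Submodule.toAddSubgroup (Ideal.span {(m : Hurwitz)}) with hA
  have e : sandwichKer 1 x m = A.comap (AddMonoidHom.mulRight x) := by
    ext y
    rw [mem_sandwichKer, one_mul, AddSubgroup.mem_comap, ← mem_span_natCast]
    rfl
  have h1 := index_sandwichKer hm (isPrimitive_one.at m) hx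
  rw [e, AddSubgroup.index_comap, ← AddSubgroup.relIndex_sup_right, norm_one, one_mul,
    Nat.gcd_eq_left hn, Nat.div_self hm.pos, Nat.gcd_one_right, Nat.div_one, mul_one, mul_one] at h1
  have e2 : (AddMonoidHom.mulRight x).range ⊔ A =
      Submodule.toAddSubgroup (Ideal.span {x, (m : Hurwitz)}) := by
    ext z
    rw [AddSubgroup.mem_sup, Submodule.mem_toAddSubgroup, Ideal.mem_span_pair]
    constructor
    · rintro ⟨_, ⟨y, rfl⟩, w, hw, rfl⟩
      obtain ⟨v, rfl⟩ := Ideal.mem_span_singleton'.1 hw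
      exact ⟨y, v, rfl⟩
    · rintro ⟨a, b, rfl⟩
      exact ⟨a * x, ⟨a, rfl⟩, b * m, Ideal.mem_span_singleton'.2 ⟨b, rfl⟩, rfl⟩
  rw [e2] at h1
  have hle : A ≤ Submodule.toAddSubgroup (Ideal.span {x, (m : Hurwitz)}) := by
    rw [← e2]; exact le_sup_right
  have h2 := AddSubgroup.relIndex_mul_index hle
  have h3 : A.index = m ^ 4 := idealIndex_natCast hm
  rw [h1, h3] at h2
  apply Nat.eq_of_mul_eq_mul_left (Nat.mul_pos hm.pos hm.pos)
  rw [idealIndex, h2]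
  ring

theorem natCast_norm_mem_span (q : Hurwitz) : (norm q : Hurwitz) ∈ Ideal.span {q} :=
  Ideal.mem_span_singleton'.2 ⟨conj q, conj_mul_self q⟩

theorem idealIndex_span {q : Hurwitz} (hq : IsPrimitive q) (hodd : Odd (norm q)) :
    idealIndex (Ideal.span {q}) = norm q ^ 2 := by
  rw [← idealIndex_span_pair hodd (hq.at _) dvd_rfl]
  congr 1
  rw [Ideal.span_pair_comm, Ideal.span_insert]
  refine (sup_eq_right.2 ?_).symm
  rw [Ideal.span_le, Set.singleton_subset_iff]
  exact natCast_norm_mem_span q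

theorem norm_eq_of_idealIndex {q : Hurwitz} (hq : IsPrimitive q) {m : ℕ} (hm : Odd m)
    (hmem : (m : Hurwitz) ∈ Ideal.span {q}) (hi : idealIndex (Ideal.span {q}) = m ^ 2) :
    norm q = m := by
  obtain ⟨y, hy⟩ := Ideal.mem_span_singleton'.1 hmem
  have h1 : norm q ∣ m ^ 2 := by
    rw [← norm_natCast, ← hy, norm_mul]; exact dvd_mul_left _ _
  have h2 : Odd (norm q) := hm.pow.of_dvd_nat h1
  rw [idealIndex_span hq h2] at hi
  exact Nat.pow_left_injective two_ne_zero hi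

/-- The left ideals generated by the primitive elements of norm `m`. -/
def primIdeals (m : ℕ) : Set (Ideal Hurwitz) :=
  {I | ∃ q, IsPrimitive q ∧ norm q = m ∧ I = Ideal.span {q}}

theorem natCast_mem_of_mem_primIdeals {m : ℕ} {I : Ideal Hurwitz} (h : I ∈ primIdeals m) :
    (m : Hurwitz) ∈ I := by
  obtain ⟨q, hq, rfl, rfl⟩ := h
  exact natCast_norm_mem_span q

theorem idealIndex_of_mem_primIdeals {m : ℕ} (hm : Odd m) {I : Ideal Hurwitz}
    (h : I ∈ primIdeals m) : idealIndex I = m ^ 2 := by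
  obtain ⟨q, hq, rfl, rfl⟩ := h
  exact idealIndex_span hq hm

/-- A prime number dividing a generator would divide both `m` and `x`, which primitivity at `m`
excludes. The norm of the generator is then determined by the index of the ideal. -/
theorem span_pair_mem_primIdeals {m : ℕ} (hm : Odd m) {x : Hurwitz} (hx : PrimitiveAt m x)
    (hn : m ∣ norm x) : Ideal.span {x, (m : Hurwitz)} ∈ primIdeals m := by
  obtain ⟨q, hq⟩ := ideal_eq_span (Ideal.span {x, (m : Hurwitz)})
  have hi := idealIndex_span_pair hm hx hn
  have hxm : x ∈ Ideal.span {x, (m : Hurwitz)} := Ideal.subset_span (by simp)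
  have hmm : (m : Hurwitz) ∈ Ideal.span {x, (m : Hurwitz)} := Ideal.subset_span (by simp)
  rw [hq] at hi hxm hmm
  have hprim : IsPrimitive q := by
    intro p hp hd
    obtain ⟨y, hy⟩ := Ideal.mem_span_singleton'.1 hxm
    obtain ⟨z, hz⟩ := Ideal.mem_span_singleton'.1 hmm
    have h1 : (p : Hurwitz) ∣ x := hy ▸ natCast_dvd_mul_left hd y
    have h2 : (p : Hurwitz) ∣ m := hz ▸ natCast_dvd_mul_left hd z
    have h3 : p ∣ m := by
      have := (natCast_dvd_iff.1 h2).2.1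
      simp only [natCast_b, dvd_neg] at this
      exact_mod_cast this
    exact hx p hp h3 h1
  exact ⟨q, hprim, norm_eq_of_idealIndex hprim hm hmm hi, hq⟩

theorem idealIndex_inf {m n : ℕ} (hm : Odd m) (hn : Odd n) (h : m.Coprime n)
    {I I' : Ideal Hurwitz} (hI : I ∈ primIdeals m) (hI' : I' ∈ primIdeals n) :
    idealIndex (I ⊓ I') = (m * n) ^ 2 := by
  have h1 := idealIndex_of_mem_primIdeals hm hI
  have h2 := idealIndex_of_mem_primIdeals hn hI'
  have e : Submodule.toAddSubgroup (I ⊓ I') =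
    Submodule.toAddSubgroup I ⊓ Submodule.toAddSubgroup I' := rfl
  unfold idealIndex at *
  rw [e, index_inf_of_coprime, h1, h2, mul_pow]
  · rw [h1]; exact pow_ne_zero _ hm.pos.ne'
  · rw [h2]; exact pow_ne_zero _ hn.pos.ne'
  · rw [h1, h2]; exact h.pow 2 2

/-- If `x` generates `I`, then `n x` lies in the intersection. A prime divisor of `m` dividing the
generator of the intersection would divide `n x`, hence the primitive `x`; the primes dividing `n`
are excluded symmetrically. -/
theorem inf_mem_primIdeals {m n : ℕ} (hm : Odd m) (hn : Odd n) (h : m.Coprime n)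
    {I I' : Ideal Hurwitz} (hI : I ∈ primIdeals m) (hI' : I' ∈ primIdeals n) :
    I ⊓ I' ∈ primIdeals (m * n) := by
  obtain ⟨q, hq⟩ := ideal_eq_span (I ⊓ I')
  have hi := idealIndex_inf hm hn h hI hI'
  have hmI := natCast_mem_of_mem_primIdeals hI
  have hnI := natCast_mem_of_mem_primIdeals hI'
  have hmn : ((m * n : ℕ) : Hurwitz) ∈ I ⊓ I' := by
    push_cast
    exact ⟨by rw [(Nat.cast_commute m (n : Hurwitz)).eq]; exact I.mul_mem_left _ hmI,
      I'.mul_mem_left _ hnI⟩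
  have aux : ∀ {m n : ℕ} {I I' : Ideal Hurwitz}, m.Coprime n → I ∈ primIdeals m →
      (n : Hurwitz) ∈ I' → I ⊓ I' = Ideal.span {q} → PrimitiveAt m q := by
    rintro m n I I' h ⟨x, hx, rfl, rfl⟩ hnI hq p hp hpm hd
    have h1 : (n : Hurwitz) * x ∈ Ideal.span {x} ⊓ I' :=
      ⟨Ideal.mul_mem_left _ _ (Ideal.mem_span_singleton_self x), by
        rw [(Nat.cast_commute n x).eq]; exact I'.mul_mem_left _ hnI⟩
    rw [hq] at h1
    obtain ⟨y, hy⟩ := Ideal.mem_span_singleton'.1 h1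
    exact hx p hp (natCast_dvd_of_coprime (h.coprime_dvd_left hpm)
      (hy ▸ natCast_dvd_mul_left hd y))
  have p1 := aux h hI hnI hq
  have p2 := aux h.symm hI' hmI (by rw [inf_comm, hq])
  rw [hq] at hmn hi
  have hprim : IsPrimitive q := by
    intro p hp hd
    obtain ⟨z, hz⟩ := Ideal.mem_span_singleton'.1 hmn
    have h2 : (p : Hurwitz) ∣ (m * n : ℕ) := hz ▸ natCast_dvd_mul_left hd z
    have h3 : p ∣ m * n := by
      have := (natCast_dvd_iff.1 h2).2.1
      simp only [natCast_b, dvd_neg] at this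
      exact_mod_cast this
    rcases (hp.dvd_mul).1 h3 with h | h
    · exact p1 p hp h hd
    · exact p2 p hp h hd
  exact ⟨q, hprim, norm_eq_of_idealIndex hprim (hm.mul hn) hmn hi, hq⟩

/-- One side is contained in the other and both have index `m²`. This recovers `I` from the
intersection, so `(I, I') ↦ I ⊓ I'` is injective. -/
theorem inf_sup_span {m n : ℕ} (hm : Odd m) (hn : Odd n) (h : m.Coprime n)
    {I I' : Ideal Hurwitz} (hI : I ∈ primIdeals m) (hI' : I' ∈ primIdeals n) :
    I ⊓ I' ⊔ Ideal.span {(m : Hurwitz)} = I := by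
  obtain ⟨q, hq, hnq, e⟩ := inf_mem_primIdeals hm hn h hI hI'
  have hle : I ⊓ I' ⊔ Ideal.span {(m : Hurwitz)} ≤ I := by
    refine sup_le inf_le_left ?_
    rw [Ideal.span_le, Set.singleton_subset_iff]
    exact natCast_mem_of_mem_primIdeals hI
  have h1 : idealIndex (I ⊓ I' ⊔ Ideal.span {(m : Hurwitz)}) = m ^ 2 := by
    rw [e, ← Ideal.span_insert]
    exact idealIndex_span_pair hm (hq.at m) (hnq ▸ dvd_mul_right m n)
  refine eq_of_le_of_idealIndex_eq hle ?_ ?_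
  · rw [h1]; exact pow_ne_zero _ hm.pos.ne'
  · rw [h1, idealIndex_of_mem_primIdeals hm hI]

theorem ncard_primIdeals_mul {m n : ℕ} (hm : Odd m) (hn : Odd n) (h : m.Coprime n) :
    (primIdeals (m * n)).ncard = (primIdeals m).ncard * (primIdeals n).ncard := by
  rw [← Set.ncard_prod]
  symm
  refine Set.ncard_congr (fun P _ => P.1 ⊓ P.2) ?_ ?_ ?_
  · rintro ⟨I, I'⟩ ⟨hI, hI'⟩
    exact inf_mem_primIdeals hm hn h hI hI'
  · rintro ⟨I, I'⟩ ⟨L, L'⟩ ⟨hI, hI'⟩ ⟨hL, hL'⟩ he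
    simp only at hI hI' hL hL' he
    have e1 : I = L := by
      rw [← inf_sup_span hm hn h hI hI', he, inf_sup_span hm hn h hL hL']
    have e2 : I' = L' := by
      rw [← inf_sup_span hn hm h.symm hI' hI, inf_comm, he, inf_comm,
        inf_sup_span hn hm h.symm hL' hL]
    rw [e1, e2]
  · rintro _ ⟨q, hq, hnq, rfl⟩
    -- Adjoining `m`, respectively `n`, to the ideal of `q` gives its two components; comparing
    -- indices shows that they intersect in exactly that ideal.
    have h1 := span_pair_mem_primIdeals hm (hq.at m) (hnq ▸ dvd_mul_right m n)
    have h2 := span_pair_mem_primIdeals hn (hq.at n) (hnq ▸ dvd_mul_left n m)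
    refine ⟨(_, _), ⟨h1, h2⟩, ?_⟩
    symm
    refine eq_of_le_of_idealIndex_eq (le_inf ?_ ?_) ?_ ?_
    · exact Ideal.span_mono (by simp)
    · exact Ideal.span_mono (by simp)
    · rw [idealIndex_span hq (hnq ▸ hm.mul hn), hnq]
      exact pow_ne_zero _ (hm.mul hn).pos.ne'
    · rw [idealIndex_span hq (hnq ▸ hm.mul hn), hnq]
      exact (idealIndex_inf hm hn h h1 h2).symm

theorem primIdeals_one : primIdeals 1 = {⊤} := by
  ext I
  simp only [primIdeals, Set.mem_ofPred_eq, Set.mem_singleton_iff]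
  constructor
  · rintro ⟨q, hq, hn, rfl⟩
    rw [Ideal.eq_top_iff_one]
    have := natCast_norm_mem_span q
    rwa [hn, Nat.cast_one] at this
  · rintro rfl
    exact ⟨1, isPrimitive_one, rfl, Ideal.span_singleton_one.symm⟩

end Hurwitz

/-! ### Counting ideals at prime powers, and counting generators -/

namespace Hurwitz

open Matrix

/-- Representatives of the left ideals of `2 × 2` matrices over `K` generated by a row. -/
def rowMatrix {K : Type*} [CommRing K] : K ⊕ {s : K // ¬ IsUnit s} → Matrix (Fin 2) (Fin 2) K
  | .inl t => !![1, t; 0, 0]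
  | .inr s => !![s.1, 1; 0, 0]

/-- The top row of an element of the ideal is a multiple of the row of `σ`. Restricting the second
chart of the projective line to non-units keeps the charts disjoint: for a unit `s`, the row `(s,
1)` is proportional to `(1, s⁻¹)`. -/
theorem rowMatrix_injective {K : Type*} [CommRing K] {σ τ : K ⊕ {s : K // ¬ IsUnit s}}
    (h : rowMatrix τ ∈ Ideal.span {rowMatrix σ}) : σ = τ := by
  obtain ⟨M, hM⟩ := Ideal.mem_span_singleton'.1 h
  have h0 := congrFun (congrFun hM 0) 0
  have h1 := congrFun (congrFun hM 0) 1
  rcases σ with s | ⟨s, hs⟩ <;> rcases τ with t | ⟨t, ht⟩ <;>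
    simp [rowMatrix, Matrix.mul_apply, Fin.sum_univ_two] at h0 h1
  · rw [h0, one_mul] at h1
    rw [h1]
  · rw [h0] at h1
    exact absurd (IsUnit.of_mul_eq_one _ h1) ht
  · exact absurd (IsUnit.of_mul_eq_one _ (mul_comm (M 0 0) s ▸ h0)) hs
  · rw [h1, one_mul] at h0
    simp only [h0]

/-- A scaled matrix unit moves a row with a unit entry to the top and normalises that entry. The
second chart is used only if the first column contains no unit, and this makes its parameter a
non-unit. -/
theorem exists_rowMatrix_mem {K : Type*} [CommRing K] (Q : Matrix (Fin 2) (Fin 2) K)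
    (h : ∃ i j, IsUnit (Q i j)) : ∃ τ, rowMatrix τ ∈ Ideal.span {Q} := by
  obtain ⟨i, j, hij⟩ := h
  by_cases h0 : ∃ i, IsUnit (Q i 0)
  · obtain ⟨i, u, hu⟩ := h0
    have hu' : (u⁻¹ : Kˣ) * Q i 0 = 1 := by rw [← hu]; simp
    refine ⟨.inl ((u⁻¹ : Kˣ) * Q i 1), Ideal.mem_span_singleton'.2
      ⟨Matrix.of fun a b => if a = 0 ∧ b = i then (u⁻¹ : Kˣ) else 0, ?_⟩⟩
    ext a b
    rw [Matrix.mul_apply, Fin.sum_univ_two]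
    fin_cases i <;> fin_cases a <;> fin_cases b <;> simp_all [rowMatrix]
  · have hj : j = 1 := by
      by_contra hj
      obtain rfl : j = 0 := by omega
      exact h0 ⟨i, hij⟩
    subst hj
    obtain ⟨u, hu⟩ := hij
    have hu' : (u⁻¹ : Kˣ) * Q i 1 = 1 := by rw [← hu]; simp
    refine ⟨.inr ⟨(u⁻¹ : Kˣ) * Q i 0, fun hc => h0 ⟨i, ?_⟩⟩, Ideal.mem_span_singleton'.2
      ⟨Matrix.of fun a b => if a = 0 ∧ b = i then (u⁻¹ : Kˣ) else 0, ?_⟩⟩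
    · rwa [Units.isUnit_units_mul] at hc
    ext a b
    rw [Matrix.mul_apply, Fin.sum_univ_two]
    fin_cases i <;> fin_cases a <;> fin_cases b <;> simp_all [rowMatrix]

theorem exists_isUnit_rowMatrix {K : Type*} [CommRing K] (τ : K ⊕ {s : K // ¬ IsUnit s}) :
    ∃ i j, rowMatrix τ i j = 1 := by
  rcases τ with t | s
  · exact ⟨0, 0, rfl⟩
  · exact ⟨0, 1, rfl⟩

theorem comap_span_eq {m : ℕ} {φ : Hurwitz →+* Matrix (Fin 2) (Fin 2) (ZMod m)}
    (hφ : Function.Surjective φ) (hker : ∀ v, φ v = 0 ↔ (m : Hurwitz) ∣ v) (x : Hurwitz) :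
    (Ideal.span {φ x}).comap φ = Ideal.span {x, (m : Hurwitz)} := by
  ext z
  rw [Ideal.mem_comap, Ideal.mem_span_singleton', Ideal.mem_span_pair]
  constructor
  · rintro ⟨M, hM⟩
    obtain ⟨y, rfl⟩ := hφ M
    have h0 : φ (z - y * x) = 0 := by rw [map_sub, map_mul, hM, sub_self]
    obtain ⟨w, hw⟩ := (hker _).1 h0
    exact ⟨y, w, by rw [← (Nat.cast_commute m w).eq, ← hw]; abel⟩
  · rintro ⟨a, b, rfl⟩
    exact ⟨φ a, by
      rw [map_add, map_mul, map_mul, (hker m).2 dvd_rfl, mul_zero, add_zero]⟩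

theorem card_not_isUnit {p r : ℕ} (hp : p.Prime) (hr : 1 ≤ r) :
    Nat.card {s : ZMod (p ^ r) // ¬ IsUnit s} = p ^ (r - 1) := by
  classical
  have : NeZero (p ^ r) := ⟨pow_ne_zero _ hp.ne_zero⟩
  have h1 : Fintype.card {s : ZMod (p ^ r) // IsUnit s} = p ^ (r - 1) * (p - 1) := by
    rw [← Nat.totient_prime_pow hp (by omega), ← ZMod.card_units_eq_totient]
    exact (Fintype.card_congr (Equiv.ofBijective
      (fun u : (ZMod (p ^ r))ˣ => (⟨u.1, u.isUnit⟩ : {s : ZMod (p ^ r) // IsUnit s}))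
      ⟨fun u v h => Units.ext (congrArg Subtype.val h), fun ⟨_, u, hu⟩ => ⟨u, Subtype.ext hu⟩⟩)).symm
  rw [Nat.card_eq_fintype_card, Fintype.card_subtype_compl, h1, ZMod.card]
  obtain ⟨k, rfl⟩ : ∃ k, r = k + 1 := ⟨r - 1, by omega⟩
  have hp1 := hp.pos
  simp only [Nat.add_sub_cancel]
  rw [pow_succ, ← Nat.mul_sub, Nat.sub_sub_self hp1]
  exact mul_one _

/-- These ideals are the preimages under `φ` of the matrix ideals generated by a normalised row,
that is, points of the projective line over `ZMod (p ^ r)`. Surjectivity needs only a containment,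
because the indices agree. -/
theorem ncard_primIdeals_prime_pow {p r : ℕ} (hp : p.Prime) (hp2 : p ≠ 2) (hr : 1 ≤ r) :
    (primIdeals (p ^ r)).ncard = p ^ r + p ^ (r - 1) := by
  obtain ⟨φ, hφ, hker, hdet⟩ := exists_split hp hp2 r
  have hodd : Odd (p ^ r) := (hp.odd_of_ne_two hp2).pow
  have hN : NeZero (p ^ r) := ⟨pow_ne_zero _ hp.ne_zero⟩
  have hmem : ∀ τ, (Ideal.span {rowMatrix τ}).comap φ ∈ primIdeals (p ^ r) := by
    intro τ
    obtain ⟨x, hx⟩ := hφ (rowMatrix τ)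
    rw [← hx, comap_span_eq hφ hker]
    refine span_pair_mem_primIdeals hodd ?_ ?_
    · rintro l hl hlp ⟨y, rfl⟩
      obtain ⟨i, j, hij⟩ := exists_isUnit_rowMatrix τ
      obtain rfl := (Nat.prime_dvd_prime_iff_eq hl hp).1 (hl.dvd_of_dvd_pow hlp)
      rw [← hx, map_mul, map_natCast, ← nsmul_eq_mul, Matrix.smul_apply, nsmul_eq_mul] at hij
      have hu : IsUnit (l : ZMod (l ^ r)) := IsUnit.of_mul_eq_one _ hij
      rw [ZMod.isUnit_iff_coprime, Nat.coprime_pow_right_iff (by omega), Nat.coprime_self] at hu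
      exact hp.one_lt.ne' hu
    · rw [← ZMod.natCast_eq_zero_iff, ← hdet, hx]
      rcases τ with t | s <;> simp [rowMatrix]
  have hcard : Nat.card (ZMod (p ^ r) ⊕ {s : ZMod (p ^ r) // ¬ IsUnit s}) =
      p ^ r + p ^ (r - 1) := by
    rw [Nat.card_sum, Nat.card_zmod, card_not_isUnit hp hr]
  rw [← hcard, ← Set.ncard_univ]
  symm
  refine Set.ncard_congr (fun τ _ => (Ideal.span {rowMatrix τ}).comap φ)
    (fun τ _ => hmem τ) ?_ ?_
  · intro σ τ _ _ h
    apply rowMatrix_injective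
    have h' : Ideal.span {rowMatrix σ} = Ideal.span {rowMatrix τ} :=
      Ideal.comap_injective_of_surjective φ hφ h
    rw [h']
    exact Ideal.mem_span_singleton_self _
  · rintro _ ⟨q, hq, hn, rfl⟩
    obtain ⟨τ, hτ⟩ := exists_rowMatrix_mem (φ q) (exists_isUnit_entry hp hφ hker (hq.at _))
    refine ⟨τ, Set.mem_univ _, ?_⟩
    have e : (Ideal.span {φ q}).comap φ = Ideal.span {q} := by
      rw [comap_span_eq hφ hker, Ideal.span_pair_comm, Ideal.span_insert, sup_eq_right,
        Ideal.span_le, Set.singleton_subset_iff, ← hn]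
      exact natCast_norm_mem_span q
    refine eq_of_le_of_idealIndex_eq ?_ ?_ ?_
    · rw [← e]
      exact Ideal.comap_mono (Ideal.span_le.2 (by simpa using hτ))
    · rw [idealIndex_of_mem_primIdeals hodd (hmem τ)]
      exact pow_ne_zero _ hodd.pos.ne'
    · rw [idealIndex_of_mem_primIdeals hodd (hmem τ), idealIndex_span hq (hn ▸ hodd), hn]

theorem finite_norm_eq (m : ℕ) : {x : Hurwitz | norm x = m}.Finite := by
  let B : Finset ℤ := Finset.Icc (-(2 * m)) (2 * m)
  refine Set.Finite.subset ((B ×ˢ B ×ˢ B ×ˢ B).finite_toSet.image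
    fun v => (⟨v.1, v.2.1, v.2.2.1, v.2.2.2⟩ : Hurwitz)) ?_
  rintro x (hx : norm x = m)
  have h4 := four_mul_normZ x
  rw [← norm_cast, hx] at h4
  have aux : ∀ z : ℤ, z ^ 2 ≤ 4 * m → -(2 * m) ≤ z ∧ z ≤ 2 * m := by
    intro z hz
    have hm : (m : ℤ) ≤ m ^ 2 := by exact_mod_cast Nat.le_self_pow two_ne_zero m
    exact abs_le.1 (abs_le_of_sq_le_sq (by nlinarith) (by positivity))
  have h1 := sq_nonneg x.a
  have h2 := sq_nonneg (x.a + 2 * x.b)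
  have h3 := sq_nonneg (x.a + 2 * x.c)
  have h5 := sq_nonneg (x.a + 2 * x.d)
  have ha := aux x.a (by linarith)
  have hb := aux (x.a + 2 * x.b) (by linarith)
  have hc := aux (x.a + 2 * x.c) (by linarith)
  have hd := aux (x.a + 2 * x.d) (by linarith)
  refine ⟨(x.a, x.b, x.c, x.d), ?_, rfl⟩
  simp only [B, Finset.coe_product, Set.mem_prod, Finset.mem_coe, Finset.mem_Icc]
  omega

/-- By `four_mul_normZ` each of `a`, `a + 2b`, `a + 2c`, `a + 2d` is at most 2 in absolute value.
This confines the coordinates to a box that is enumerated. -/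
theorem ncard_units : {x : Hurwitz | norm x = 1}.ncard = 24 := by
  let B : Finset ℤ := Finset.Icc (-2) 2
  let F : Finset (ℤ × ℤ × ℤ × ℤ) := (B ×ˢ B ×ˢ B ×ˢ B).filter fun v =>
    v.1 ^ 2 + v.1 * (v.2.1 + v.2.2.1 + v.2.2.2) + v.2.1 ^ 2 + v.2.2.1 ^ 2 + v.2.2.2 ^ 2 = 1
  have hF : F.card = 24 := by decide +kernel
  have hinj : Function.Injective fun v : ℤ × ℤ × ℤ × ℤ =>
      (⟨v.1, v.2.1, v.2.2.1, v.2.2.2⟩ : Hurwitz) := by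
    rintro ⟨a, b, c, d⟩ ⟨a', b', c', d'⟩ h
    simpa using h
  have : {x : Hurwitz | norm x = 1} = (fun v : ℤ × ℤ × ℤ × ℤ =>
      (⟨v.1, v.2.1, v.2.2.1, v.2.2.2⟩ : Hurwitz)) '' F := by
    ext x
    simp only [Set.mem_ofPred_eq, Set.mem_image, Finset.mem_coe]
    constructor
    · intro hx
      have h4 := four_mul_normZ x
      have h0 : normZ x = 1 := by rw [← norm_cast, hx]; rfl
      rw [h0] at h4
      have aux : ∀ z : ℤ, z ^ 2 ≤ 4 → -2 ≤ z ∧ z ≤ 2 := fun z hz =>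
        abs_le.1 (abs_le_of_sq_le_sq (by linarith) (by norm_num))
      have h1 := sq_nonneg x.a
      have h2 := sq_nonneg (x.a + 2 * x.b)
      have h3 := sq_nonneg (x.a + 2 * x.c)
      have h5 := sq_nonneg (x.a + 2 * x.d)
      have ha := aux x.a (by linarith)
      have hb := aux (x.a + 2 * x.b) (by linarith)
      have hc := aux (x.a + 2 * x.c) (by linarith)
      have hd := aux (x.a + 2 * x.d) (by linarith)
      refine ⟨(x.a, x.b, x.c, x.d), ?_, rfl⟩
      simp only [F, B, Finset.mem_filter, Finset.mem_product, Finset.mem_Icc]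
      refine ⟨by omega, h0⟩
    · rintro ⟨v, hv, rfl⟩
      have := (Finset.mem_filter.1 hv).2
      rw [norm, normZ]
      simp only at this ⊢
      rw [this]
      rfl
  rw [this, Set.ncard_image_of_injective _ hinj, Set.ncard_coe_finset, hF]

theorem norm_eq_one_of_dvd {x y z : Hurwitz} (hx : x ≠ 0) (h1 : y * x = z)
    (h2 : norm z = norm x) : norm y = 1 := by
  have hpos := Nat.pos_of_ne_zero (mt norm_eq_zero.1 hx)
  rw [← h1, norm_mul] at h2
  exact Nat.eq_of_mul_eq_mul_right hpos (by rw [h2, one_mul])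

theorem IsPrimitive.unit_mul {x u : Hurwitz} (hx : IsPrimitive x) (hu : norm u = 1) :
    IsPrimitive (u * x) := by
  intro p hp hd
  have h1 := natCast_dvd_mul_left hd (Hurwitz.conj u)
  rw [← mul_assoc, conj_mul_self, hu, Nat.cast_one, one_mul] at h1
  exact hx p hp h1

theorem span_unit_mul {x u : Hurwitz} (hu : norm u = 1) : Ideal.span {u * x} = Ideal.span {x} := by
  refine le_antisymm ?_ ?_ <;> rw [Ideal.span_le, Set.singleton_subset_iff, SetLike.mem_coe,
    Ideal.mem_span_singleton']
  · exact ⟨u, rfl⟩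
  · exact ⟨Hurwitz.conj u, by rw [← mul_assoc, conj_mul_self, hu, Nat.cast_one, one_mul]⟩

/-- The primitive elements of norm `m`. -/
def primElts (m : ℕ) : Set Hurwitz := {q | IsPrimitive q ∧ norm q = m}

theorem primElts_finite (m : ℕ) : (primElts m).Finite :=
  (finite_norm_eq m).subset fun _ h => h.2

theorem primIdeals_eq_image (m : ℕ) : primIdeals m = (fun q => Ideal.span {q}) '' primElts m := by
  ext I
  constructor
  · rintro ⟨q, h1, h2, rfl⟩
    exact ⟨q, ⟨h1, h2⟩, rfl⟩
  · rintro ⟨q, ⟨h1, h2⟩, rfl⟩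
    exact ⟨q, h1, h2, rfl⟩

/-- The 24 units act freely on the primitive elements by left multiplication, and the orbits are the
sets of generators of a given ideal. -/
theorem ncard_primElts (m : ℕ) : (primElts m).ncard = 24 * (primIdeals m).ncard := by
  rw [← ncard_units, ← Set.ncard_prod]
  symm
  have hc : ∀ I ∈ primIdeals m, ∃ q, IsPrimitive q ∧ norm q = m ∧ I = Ideal.span {q} :=
    fun I h => h
  choose! g hg1 hg2 hg3 using hc
  refine Set.ncard_congr (fun P _ => P.1 * g P.2) ?_ ?_ ?_
  · rintro ⟨u, I⟩ ⟨hu, hI⟩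
    simp only [Set.mem_ofPred_eq] at hu hI
    exact ⟨(hg1 I hI).unit_mul hu, by rw [norm_mul, hu, hg2 I hI, one_mul]⟩
  · rintro ⟨u, I⟩ ⟨v, I'⟩ ⟨hu, hI⟩ ⟨hv, hI'⟩ h
    simp only [Set.mem_ofPred_eq] at hu hI hv hI' h
    have e : I = I' := by
      rw [hg3 I hI, hg3 I' hI', ← span_unit_mul hu, h, span_unit_mul hv]
    subst e
    rw [mul_right_cancel₀ (hg1 I hI).ne_zero h]
  · rintro q ⟨hq, hn⟩
    have hI : Ideal.span {q} ∈ primIdeals m := ⟨q, hq, hn, rfl⟩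
    have h1 : q ∈ Ideal.span {g (Ideal.span {q})} := by
      rw [← hg3 _ hI]; exact Ideal.mem_span_singleton_self q
    obtain ⟨u, hu⟩ := Ideal.mem_span_singleton'.1 h1
    refine ⟨(u, Ideal.span {q}), ⟨?_, hI⟩, hu⟩
    exact norm_eq_one_of_dvd (hg1 _ hI).ne_zero hu (by rw [hn, hg2 _ hI])

end Hurwitz

/-! ### Matrices of quaternion multiplication -/

section QuaternionMatrices

open Matrix Quaternion

variable {K : Type*} [CommRing K]

/-- The coordinate vector of a quaternion. -/
def quatVec (x : ℍ[K]) : Fin 4 → K := ![x.re, x.imI, x.imJ, x.imK]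

/-- The matrix of left multiplication by a quaternion. -/
def quatLeft (a : ℍ[K]) : Matrix (Fin 4) (Fin 4) K :=
  !![a.re, -a.imI, -a.imJ, -a.imK; a.imI, a.re, -a.imK, a.imJ;
    a.imJ, a.imK, a.re, -a.imI; a.imK, -a.imJ, a.imI, a.re]

/-- The matrix of right multiplication by a quaternion. -/
def quatRight (a : ℍ[K]) : Matrix (Fin 4) (Fin 4) K :=
  !![a.re, -a.imI, -a.imJ, -a.imK; a.imI, a.re, a.imK, -a.imJ;
    a.imJ, -a.imK, a.re, a.imI; a.imK, a.imJ, -a.imI, a.re]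

/-- The quaternion with given coordinates. -/
def quatMk (a b c d : K) : ℍ[K] := ⟨a, b, c, d⟩

@[simp] theorem re_quatMk (a b c d : K) : (quatMk a b c d).re = a := rfl
@[simp] theorem imI_quatMk (a b c d : K) : (quatMk a b c d).imI = b := rfl
@[simp] theorem imJ_quatMk (a b c d : K) : (quatMk a b c d).imJ = c := rfl
@[simp] theorem imK_quatMk (a b c d : K) : (quatMk a b c d).imK = d := rfl

theorem quatVec_surjective : Function.Surjective (quatVec (K := K)) := fun v =>
  ⟨quatMk (v 0) (v 1) (v 2) (v 3), by ext i; fin_cases i <;> rfl⟩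

theorem quatLeft_mulVec (a x : ℍ[K]) : quatLeft a *ᵥ quatVec x = quatVec (a * x) := by
  ext i
  fin_cases i <;> simp [quatLeft, quatVec, mulVec, dotProduct, Fin.sum_univ_four] <;> ring

theorem quatRight_mulVec (a x : ℍ[K]) : quatRight a *ᵥ quatVec x = quatVec (x * a) := by
  ext i
  fin_cases i <;> simp [quatRight, quatVec, mulVec, dotProduct, Fin.sum_univ_four] <;> ring

theorem det_quatLeft (a : ℍ[K]) : (quatLeft a).det = normSq a ^ 2 := by
  rw [quatLeft, det_succ_row_zero, normSq_def']
  simp [Fin.sum_univ_four, det_fin_three, Fin.succAbove, submatrix]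
  ring

theorem det_quatRight (a : ℍ[K]) : (quatRight a).det = normSq a ^ 2 := by
  rw [quatRight, det_succ_row_zero, normSq_def']
  simp [Fin.sum_univ_four, det_fin_three, Fin.succAbove, submatrix]
  ring

theorem quatLeft_mul_transpose (a : ℍ[K]) : quatLeft a * (quatLeft a)ᵀ = normSq a • 1 := by
  rw [quatLeft, normSq_def']
  ext i j
  fin_cases i <;> fin_cases j <;> simp [Matrix.mul_apply, Fin.sum_univ_four] <;> ring

theorem quatRight_mul_transpose (a : ℍ[K]) : quatRight a * (quatRight a)ᵀ = normSq a • 1 := by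
  rw [quatRight, normSq_def']
  ext i j
  fin_cases i <;> fin_cases j <;> simp [Matrix.mul_apply, Fin.sum_univ_four] <;> ring

end QuaternionMatrices

/-! ### Rational rotations of four-space in terms of quaternions -/

section RationalRotations

open Matrix Quaternion

theorem quat_polarization {f : ℍ[ℚ] →ₗ[ℚ] ℍ[ℚ]} (hf : ∀ x, normSq (f x) = normSq x)
    (x y : ℍ[ℚ]) : (f x).re * (f y).re + (f x).imI * (f y).imI + (f x).imJ * (f y).imJ +
      (f x).imK * (f y).imK = x.re * y.re + x.imI * y.imI + x.imJ * y.imJ + x.imK * y.imK := by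
  have h := hf (x + y)
  have hx := hf x
  have hy := hf y
  rw [map_add] at h
  simp only [normSq_def', Quaternion.re_add, Quaternion.imI_add, Quaternion.imJ_add,
    Quaternion.imK_add] at h hx hy
  linarith

/-- Conjugating an isometry by a nonzero quaternion. -/
theorem exists_conj_isometry {f : ℍ[ℚ] →ₗ[ℚ] ℍ[ℚ]} (hf : ∀ x, normSq (f x) = normSq x)
    {w : ℍ[ℚ]} (hw : w ≠ 0) : ∃ g : ℍ[ℚ] →ₗ[ℚ] ℍ[ℚ], (∀ x, normSq (g x) = normSq x) ∧
      ∀ x, g x = w⁻¹ * f x * w := by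
  refine ⟨(LinearMap.mulRight ℚ w).comp ((LinearMap.mulLeft ℚ w⁻¹).comp f), fun x => ?_,
    fun x => rfl⟩
  have hN : normSq w ≠ 0 := Quaternion.normSq_ne_zero.2 hw
  change normSq (w⁻¹ * f x * w) = normSq x
  rw [map_mul, map_mul, hf, normSq_inv]
  field_simp

/-- The isometry is normalised until it fixes `1`, `i` and `j`; then `k` can only go to `±k`. The
normalising quaternions are explicit intertwiners such as `g i + i`, so no square roots are needed
and everything stays rational. -/
theorem quat_isometry_eq {f : ℍ[ℚ] →ₗ[ℚ] ℍ[ℚ]} (hf : ∀ x, normSq (f x) = normSq x) :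
    ∃ (a b : ℍ[ℚ]) (ε : ℚ), normSq a * normSq b = 1 ∧ (ε = 1 ∨ ε = -1) ∧
      ∀ x, f x = a * quatMk x.re x.imI x.imJ (ε * x.imK) * b := by
  -- Reduction to isometries that fix `1`.
  have hu1 : normSq (f 1) = 1 := by rw [hf]; simp
  have hu0 : f 1 ≠ 0 := by
    intro h
    rw [h] at hu1
    simp at hu1
  obtain ⟨g, hg, hgf⟩ : ∃ g : ℍ[ℚ] →ₗ[ℚ] ℍ[ℚ], (∀ x, normSq (g x) = normSq x) ∧
      ∀ x, g x = (f 1)⁻¹ * f x := by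
    refine ⟨(LinearMap.mulLeft ℚ (f 1)⁻¹).comp f, fun x => ?_, fun x => rfl⟩
    change normSq ((f 1)⁻¹ * f x) = normSq x
    rw [map_mul, hf, normSq_inv, hu1]
    simp
  have hg1 : g 1 = 1 := by rw [hgf, inv_mul_cancel₀ hu0]
  -- The image of `i`.
  obtain ⟨i, i0, i1, i2, i3⟩ : ∃ i : ℍ[ℚ], i.re = 0 ∧ i.imI = 1 ∧ i.imJ = 0 ∧ i.imK = 0 :=
    ⟨quatMk 0 1 0 0, rfl, rfl, rfl, rfl⟩
  obtain ⟨j, j0, j1, j2, j3⟩ : ∃ j : ℍ[ℚ], j.re = 0 ∧ j.imI = 0 ∧ j.imJ = 1 ∧ j.imK = 0 :=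
    ⟨quatMk 0 0 1 0, rfl, rfl, rfl, rfl⟩
  obtain ⟨k, k0, k1, k2, k3⟩ : ∃ k : ℍ[ℚ], k.re = 0 ∧ k.imI = 0 ∧ k.imJ = 0 ∧ k.imK = 1 :=
    ⟨quatMk 0 0 0 1, rfl, rfl, rfl, rfl⟩
  obtain ⟨w, hw0, hw⟩ : ∃ w : ℍ[ℚ], w ≠ 0 ∧ g i * w = w * i := by
    have h1 := quat_polarization hg i 1
    have h2 := hg i
    rw [hg1] at h1
    simp [i0, i1, i2, i3] at h1
    simp [normSq_def', i0, i1, i2, i3, h1] at h2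
    by_cases hc : g i = -i
    · refine ⟨j, fun h => ?_, ?_⟩
      · simpa [j2] using congrArg QuaternionAlgebra.imJ h
      · rw [hc]
        ext <;> simp [i0, i1, i2, i3, j0, j1, j2, j3]
    -- As `g i` and `i` both square to `-1`, the sum intertwines them. It vanishes only for `g i =
    -- -i`, and then `j` does the job.
    · refine ⟨g i + i, fun h => hc (eq_neg_of_add_eq_zero_left h), ?_⟩
      ext <;> simp [i0, i1, i2, i3, h1] <;> linarith
  obtain ⟨h, hh, hhg⟩ := exists_conj_isometry hg hw0
  have hh1 : h 1 = 1 := by rw [hhg, hg1, mul_one, inv_mul_cancel₀ hw0]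
  have hhi : h i = i := by rw [hhg, mul_assoc, hw, ← mul_assoc, inv_mul_cancel₀ hw0, one_mul]
  -- The image of `j`.
  obtain ⟨t, ht0, hti, ht⟩ : ∃ t : ℍ[ℚ], t ≠ 0 ∧ i * t = t * i ∧ h j * t = t * j := by
    have h1 := quat_polarization hh j 1
    have h2 := quat_polarization hh j i
    have h3 := hh j
    rw [hh1] at h1
    rw [hhi] at h2
    simp [j0, j1, j2, j3] at h1
    simp [i0, i1, i2, i3, j0, j1, j2, j3] at h2
    simp [normSq_def', j0, j1, j2, j3] at h3
    rw [h1, h2] at h3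
    by_cases hc : h j = -j
    · refine ⟨i, fun h => ?_, rfl, ?_⟩
      · simpa [i1] using congrArg QuaternionAlgebra.imI h
      · rw [hc]
        ext <;> simp [i0, i1, i2, i3, j0, j1, j2, j3]
    -- Since `h j` squares to `-1`, both `h j * t` and `t * j` equal `h j + j`. Orthogonality of `h
    -- j` to `1` and `i` puts `h j * j` in the span of `1` and `i`, so conjugation by `t` still
    -- fixes `i`.
    · refine ⟨1 - h j * j, fun h0 => hc ?_, ?_, ?_⟩
      · have hjj : j * j = -1 := by ext <;> simp [j0, j1, j2, j3]
        have h4 : h j * j = 1 := (sub_eq_zero.1 h0).symm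
        have h5 : h j * j * j = j := by rw [h4, one_mul]
        rw [mul_assoc, hjj, mul_neg, mul_one] at h5
        exact neg_eq_iff_eq_neg.1 h5
      · ext <;> simp [i0, i1, i2, i3, j0, j1, j2, j3, h1, h2]
      · have e1 : (h j).re = 0 := h1
        have e2 : (h j).imI = 0 := h2
        ext <;> simp [j0, j1, j2, j3, e1, e2] <;> linarith
  obtain ⟨m, hm, hmh⟩ := exists_conj_isometry hh ht0
  have hm1 : m 1 = 1 := by rw [hmh, hh1, mul_one, inv_mul_cancel₀ ht0]
  have hmi : m i = i := by rw [hmh, hhi, mul_assoc, hti, ← mul_assoc, inv_mul_cancel₀ ht0, one_mul]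
  have hmj : m j = j := by rw [hmh, mul_assoc, ht, ← mul_assoc, inv_mul_cancel₀ ht0, one_mul]
  obtain ⟨ε, hε, hmk⟩ : ∃ ε : ℚ, (ε = 1 ∨ ε = -1) ∧ m k = ε • k := by
    have h1 := quat_polarization hm k 1
    have h2 := quat_polarization hm k i
    have h3 := quat_polarization hm k j
    have h4 := hm k
    rw [hm1] at h1
    rw [hmi] at h2
    rw [hmj] at h3
    simp [k0, k1, k2, k3] at h1
    simp [i0, i1, i2, i3, k0, k1, k2, k3] at h2
    simp [j0, j1, j2, j3, k0, k1, k2, k3] at h3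
    simp [normSq_def', k0, k1, k2, k3] at h4
    refine ⟨(m k).imK, ?_, ?_⟩
    · rw [h1, h2, h3] at h4
      exact mul_self_eq_one_iff.1 (by rw [← sq]; simpa using h4)
    · ext <;> simp [k0, k1, k2, k3, h1, h2, h3]
  have hmx : ∀ x, m x = quatMk x.re x.imI x.imJ (ε * x.imK) := by
    intro x
    have hx : x = x.re • 1 + x.imI • i + x.imJ • j + x.imK • k := by
      ext <;> simp [i0, i1, i2, i3, j0, j1, j2, j3, k0, k1, k2, k3]
    conv_lhs => rw [hx]
    rw [map_add, map_add, map_add, map_smul, map_smul, map_smul, map_smul, hm1, hmi, hmj, hmk]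
    ext <;> simp [i0, i1, i2, i3, j0, j1, j2, j3, k0, k1, k2, k3] <;> ring
  refine ⟨f 1 * (w * t), (w * t)⁻¹, ε, ?_, hε, fun x => ?_⟩
  · have hN : normSq (w * t) ≠ 0 := Quaternion.normSq_ne_zero.2 (mul_ne_zero hw0 ht0)
    rw [map_mul, hu1, normSq_inv, one_mul, mul_inv_cancel₀ hN]
  · rw [← hmx, hmh, hhg, hgf, _root_.mul_inv_rev]
    have ew := mul_inv_cancel₀ hw0
    have et := mul_inv_cancel₀ ht0
    have eu := mul_inv_cancel₀ hu0
    calc f x = (f 1 * (f 1)⁻¹) * f x := by rw [eu, one_mul]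
      _ = f 1 * (w * w⁻¹) * (f 1)⁻¹ * f x * (w * w⁻¹) := by rw [ew, mul_one, mul_one]
      _ = f 1 * (w * (t * t⁻¹) * w⁻¹) * (f 1)⁻¹ * f x * (w * (t * t⁻¹) * w⁻¹) := by
        rw [et, mul_one]
      _ = _ := by simp only [mul_assoc]

/-- Every rational rotation of four-space is `x ↦ a x b` for quaternions `a`, `b`. -/
theorem exists_quat_of_rotation {R : Matrix (Fin 4) (Fin 4) ℚ} (hR : Rᵀ * R = 1)
    (hdet : R.det = 1) : ∃ a b : ℍ[ℚ], normSq a * normSq b = 1 ∧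
      ∀ x, R *ᵥ quatVec x = quatVec (a * x * b) := by
  let f : ℍ[ℚ] →ₗ[ℚ] ℍ[ℚ] :=
    { toFun := fun x => quatMk ((R *ᵥ quatVec x) 0) ((R *ᵥ quatVec x) 1)
        ((R *ᵥ quatVec x) 2) ((R *ᵥ quatVec x) 3)
      map_add' := fun x y => by
        have : quatVec (x + y) = quatVec x + quatVec y := by
          ext i; fin_cases i <;> simp [quatVec]
        ext <;> simp [this, mulVec_add]
      map_smul' := fun c x => by
        have : quatVec (c • x) = c • quatVec x := by
          ext i; fin_cases i <;> simp [quatVec]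
        ext <;> simp [this, mulVec_smul] }
  have hfR : ∀ x, quatVec (f x) = R *ᵥ quatVec x := by
    intro x
    ext i
    fin_cases i <;> rfl
  have hn : ∀ x : ℍ[ℚ], normSq x = quatVec x ⬝ᵥ quatVec x := by
    intro x
    simp [normSq_def', quatVec, dotProduct, Fin.sum_univ_four]
    ring
  have hf : ∀ x, normSq (f x) = normSq x := by
    intro x
    rw [hn, hn, hfR, dotProduct_mulVec, vecMul_mulVec, hR, vecMul_one]
  obtain ⟨a, b, ε, hab, hε, hx⟩ := quat_isometry_eq hf
  have hRe : R = quatLeft a * quatRight b * diagonal ![1, 1, 1, ε] := by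
    refine Matrix.ext_of_mulVec_single fun i => ?_
    obtain ⟨x, hxi⟩ := quatVec_surjective (Pi.single i (1 : ℚ))
    have hd : diagonal ![1, 1, 1, ε] *ᵥ quatVec x =
        quatVec (quatMk x.re x.imI x.imJ (ε * x.imK)) := by
      ext l
      rw [mulVec_diagonal]
      fin_cases l <;> simp [quatVec]
    rw [← hxi, ← hfR, hx, mul_assoc, ← mulVec_mulVec, ← mulVec_mulVec, hd, quatRight_mulVec,
      quatLeft_mulVec, ← mul_assoc]
  -- Left and right multiplication contribute `(normSq a * normSq b) ^ 2 = 1` to the determinant, so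
  -- `ε` is the determinant.
  have hε1 : ε = 1 := by
    rw [hRe, det_mul, det_mul, det_quatLeft, det_quatRight, det_diagonal, ← mul_pow, hab] at hdet
    simpa [Fin.prod_univ_four] using hdet
  refine ⟨a, b, hab, fun x => ?_⟩
  rw [← hfR, hx, hε1, one_mul]
  rfl

end RationalRotations

open Matrix in
/-- A coincidence isometry of a centred cubic lattice has rational entries. -/
theorem exists_rat_entry {d : ℕ} {R : Matrix (Fin d) (Fin d) ℝ}
    (h : IsCoincidence (centredCubic d) R) (i j : Fin d) : ∃ r : ℚ, R i j = r := by
  have hmem : (Pi.single j 1 : Fin d → ℝ) ∈ centredCubic d :=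
    Or.inl fun l => by
      by_cases hl : l = j
      · subst hl; exact ⟨1, by simp⟩
      · exact ⟨0, by simp [hl]⟩
  have hR : R *ᵥ Pi.single j 1 ∈ rotate R (centredCubic d) := ⟨_, hmem, rfl⟩
  obtain ⟨n, hn, -, hnm⟩ := AddSubgroup.exists_nsmul_mem_of_relIndex_ne_zero h.1 hR
  have hn0 : (n : ℝ) ≠ 0 := by exact_mod_cast hn.ne'
  have e : (n • (R *ᵥ Pi.single j (1 : ℝ))) i = n * R i j := by simp
  have hcase := hnm.1
  rcases hcase with hc | hc
  · obtain ⟨m, hm⟩ := hc i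
    refine ⟨m / n, ?_⟩
    rw [e] at hm
    push_cast
    rw [← hm]
    field_simp
  · obtain ⟨m, hm⟩ := hc i
    refine ⟨(m + 1 / 2) / n, ?_⟩
    rw [e] at hm
    push_cast
    rw [← hm]
    field_simp

/-! ### Representing rotations by pairs of primitive Hurwitz quaternions -/

namespace Hurwitz

open Matrix Quaternion

section embedding
variable (K : Type*) [Field K] [CharZero K]

/-- The embedding of the Hurwitz order into the quaternions over a field. -/
def toQuat : Hurwitz →+* ℍ[K] where
  toFun x := quatMk (x.a / 2) (x.a / 2 + x.b) (x.a / 2 + x.c) (x.a / 2 + x.d)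
  map_zero' := by ext <;> simp
  map_one' := by ext <;> simp
  map_add' x y := by ext <;> simp <;> ring
  map_mul' x y := by ext <;> simp <;> ring

theorem toQuat_apply (x : Hurwitz) :
    toQuat K x = quatMk (x.a / 2 : K) (x.a / 2 + x.b) (x.a / 2 + x.c) (x.a / 2 + x.d) := rfl

theorem normSq_toQuat (x : Hurwitz) : normSq (toQuat K x) = (norm x : K) := by
  have e : (norm x : K) = ((normZ x : ℤ) : K) := by rw [← norm_cast]; simp
  rw [e, normSq_def', toQuat_apply, normZ]
  simp
  ring

end embedding

theorem exists_eq_smul_toQuat {a : ℍ[ℚ]} (ha : a ≠ 0) :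
    ∃ (t : ℚ) (q : Hurwitz), IsPrimitive q ∧ a = t • toQuat ℚ q := by
  have key : ∀ r : ℚ, ∀ N : ℕ, r.den ∣ N → ∃ m : ℤ, (m : ℚ) = N * r := by
    rintro r N ⟨k, rfl⟩
    refine ⟨k * r.num, ?_⟩
    push_cast
    rw [← Rat.den_mul_eq_num]
    ring
  set N := a.re.den * a.imI.den * a.imJ.den * a.imK.den with hN
  have hN0 : N ≠ 0 := by simp [hN]
  have hNQ : (N : ℚ) ≠ 0 := by exact_mod_cast hN0
  obtain ⟨A, hA⟩ := key a.re N ⟨a.imI.den * a.imJ.den * a.imK.den, by rw [hN]; ring⟩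
  obtain ⟨B, hB⟩ := key a.imI N ⟨a.re.den * a.imJ.den * a.imK.den, by rw [hN]; ring⟩
  obtain ⟨C, hC⟩ := key a.imJ N ⟨a.re.den * a.imI.den * a.imK.den, by rw [hN]; ring⟩
  obtain ⟨D, hD⟩ := key a.imK N ⟨a.re.den * a.imI.den * a.imJ.den, by rw [hN]; ring⟩
  -- The integer quaternion `A + B i + C j + D k` in the basis `ω, i, j, k`.
  let x : Hurwitz := ⟨2 * A, B - A, C - A, D - A⟩
  have hx : toQuat ℚ x = (N : ℚ) • a := by
    rw [toQuat_apply]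
    ext <;> simp [x, hA, hB, hC, hD]
  have hx0 : x ≠ 0 := by
    intro h0
    rw [h0, map_zero] at hx
    exact (smul_ne_zero hNQ ha) hx.symm
  obtain ⟨n, q, hn, hq, hxq⟩ := exists_primitive hx0
  refine ⟨n / N, q, hq, ?_⟩
  rw [hxq, map_mul, map_natCast] at hx
  have h1 : (n : ℍ[ℚ]) * toQuat ℚ q = (n : ℚ) • toQuat ℚ q := by
    rw [← Quaternion.coe_natCast, Quaternion.coe_mul_eq_smul]
  rw [h1] at hx
  rw [div_eq_inv_mul, mul_smul, hx, smul_smul, inv_mul_cancel₀ hNQ, one_smul]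

/-- The embedding of the Hurwitz order as a lattice in `ℝ⁴`. -/
noncomputable def emb : Hurwitz →+ (Fin 4 → ℝ) where
  toFun x := quatVec (toQuat ℝ x)
  map_zero' := by ext i; fin_cases i <;> simp [quatVec]
  map_add' x y := by ext i; fin_cases i <;> simp [quatVec]

theorem emb_apply (x : Hurwitz) : emb x = quatVec (toQuat ℝ x) := rfl

theorem emb_eq (x : Hurwitz) :
    emb x = ![(x.a / 2 : ℝ), x.a / 2 + x.b, x.a / 2 + x.c, x.a / 2 + x.d] := rfl

theorem emb_injective : Function.Injective emb := by
  intro x y h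
  rw [emb_eq, emb_eq] at h
  have h0 := congrFun h 0
  have h1 := congrFun h 1
  have h2 := congrFun h 2
  have h3 := congrFun h 3
  simp at h0 h1 h2 h3
  have ha : x.a = y.a := by exact_mod_cast h0
  rw [ha] at h1 h2 h3
  ext
  · exact ha
  · exact_mod_cast add_left_cancel h1
  · exact_mod_cast add_left_cancel h2
  · exact_mod_cast add_left_cancel h3

theorem range_emb : emb.range = D4star := by
  ext v
  constructor
  · rintro ⟨x, rfl⟩
    rw [emb_eq]
    rcases Int.even_or_odd' x.a with ⟨m, hm | hm⟩
    · left
      intro i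
      fin_cases i
      · exact ⟨m, by simp [hm]⟩
      · exact ⟨m + x.b, by simp [hm]⟩
      · exact ⟨m + x.c, by simp [hm]⟩
      · exact ⟨m + x.d, by simp [hm]⟩
    · right
      intro i
      fin_cases i
      · exact ⟨m, by simp [hm]; ring⟩
      · exact ⟨m + x.b, by simp [hm]; ring⟩
      · exact ⟨m + x.c, by simp [hm]; ring⟩
      · exact ⟨m + x.d, by simp [hm]; ring⟩
  · rintro (h | h)
    · choose m hm using h
      refine ⟨⟨2 * m 0, m 1 - m 0, m 2 - m 0, m 3 - m 0⟩, ?_⟩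
      rw [emb_eq]
      ext i
      fin_cases i <;> simp [hm]
    · choose m hm using h
      refine ⟨⟨2 * m 0 + 1, m 1 - m 0, m 2 - m 0, m 3 - m 0⟩, ?_⟩
      rw [emb_eq]
      ext i
      fin_cases i <;> simp [hm] <;> ring

theorem emb_natCast_mul (n : ℕ) (x : Hurwitz) : emb (n * x) = (n : ℝ) • emb x := by
  rw [← nsmul_eq_mul, map_nsmul, Nat.cast_smul_eq_nsmul]

/-- The linear map with matrix `R` is `x ↦ q x p / c`. -/
def Represents (R : Matrix (Fin 4) (Fin 4) ℝ) (q p : Hurwitz) (c : ℕ) : Prop :=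
  ∀ x : Hurwitz, (c : ℝ) • (R *ᵥ emb x) = emb (q * x * p)

theorem isSquare_of_mul_sq_eq_one {t : ℚ} {n : ℕ} (h : t ^ 2 * n = 1) :
    ∃ c : ℕ, 0 < c ∧ n = c ^ 2 ∧ (t * c = 1 ∨ t * c = -1) := by
  have ht : t ≠ 0 := by rintro rfl; simp at h
  have hs : IsSquare ((n : ℕ) : ℚ) := ⟨t⁻¹, by field_simp; linarith⟩
  obtain ⟨c, hc⟩ := Rat.isSquare_natCast_iff.1 hs
  have hc' : (t * c) * (t * c) = 1 := by
    rw [hc] at h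
    push_cast at h
    linarith
  refine ⟨c, Nat.pos_of_ne_zero ?_, by rw [hc, sq], mul_self_eq_one_iff.1 hc'⟩
  rintro rfl
  simp at hc'

/-- With `a = t q` and `b = s p` for primitive `q`, `p`, the relation `(t s)² norm q norm p = 1`
makes the product of norms a perfect square `c²` and gives `t s = ±1 / c`. The sign is absorbed into
`q`. -/
theorem exists_represents {R : Matrix (Fin 4) (Fin 4) ℝ} (hrat : ∀ i j, ∃ r : ℚ, R i j = r)
    (hR : R ∈ specialOrthogonalGroup (Fin 4) ℝ) : ∃ q p c, IsPrimitive q ∧ IsPrimitive p ∧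
      0 < c ∧ norm q * norm p = c ^ 2 ∧ Represents R q p c := by
  choose r hr using hrat
  let R₀ : Matrix (Fin 4) (Fin 4) ℚ := Matrix.of r
  have hinj := (algebraMap ℚ ℝ).injective
  have hR₀ : R₀.map (algebraMap ℚ ℝ) = R := by
    ext i j
    simp [R₀, hr]
  rw [mem_specialOrthogonalGroup_iff, mem_orthogonalGroup_iff'] at hR
  have h1 : R₀ᵀ * R₀ = 1 := by
    apply Matrix.map_injective hinj
    change (R₀ᵀ * R₀).map (algebraMap ℚ ℝ) = (1 : Matrix _ _ ℚ).map (algebraMap ℚ ℝ)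
    rw [Matrix.map_mul, transpose_map, hR₀, Matrix.map_one _ (map_zero _) (map_one _)]
    exact hR.1
  have h2 : R₀.det = 1 := by
    apply hinj
    rw [RingHom.map_det, map_one, RingHom.mapMatrix_apply, hR₀]
    exact hR.2
  obtain ⟨a, b, hab, habx⟩ := exists_quat_of_rotation h1 h2
  have ha0 : a ≠ 0 := by rintro rfl; simp at hab
  have hb0 : b ≠ 0 := by rintro rfl; simp at hab
  obtain ⟨t, q, hq, rfl⟩ := exists_eq_smul_toQuat ha0
  obtain ⟨s, p, hp, rfl⟩ := exists_eq_smul_toQuat hb0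
  rw [normSq_smul, normSq_smul, normSq_toQuat, normSq_toQuat] at hab
  obtain ⟨c, hc, hnc, hts⟩ := isSquare_of_mul_sq_eq_one (t := t * s) (n := norm q * norm p)
    (by push_cast; linarith)
  have hcast : ∀ x : Hurwitz, emb x = algebraMap ℚ ℝ ∘ quatVec (toQuat ℚ x) := by
    intro x
    rw [emb_eq, toQuat_apply]
    ext i
    fin_cases i <;> simp [quatVec]
  have hsm : ∀ (u : ℚ) (x : ℍ[ℚ]), quatVec (u • x) = u • quatVec x := by
    intro u x
    ext i
    fin_cases i <;> simp [quatVec]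
  have hrep : ∀ x : Hurwitz, (c : ℝ) • (R *ᵥ emb x) =
      ((t * s * c : ℚ) : ℝ) • emb (q * x * p) := by
    intro x
    have e := congrArg (fun v => algebraMap ℚ ℝ ∘ v) (habx (toQuat ℚ x))
    rw [smul_mul_assoc, mul_smul_comm, smul_mul_assoc, smul_smul, hsm, ← map_mul, ← map_mul] at e
    have e2 : algebraMap ℚ ℝ ∘ (R₀ *ᵥ quatVec (toQuat ℚ x)) = R *ᵥ emb x := by
      rw [hcast, ← hR₀]
      ext i
      exact RingHom.map_mulVec _ _ _ _
    change algebraMap ℚ ℝ ∘ (R₀ *ᵥ quatVec (toQuat ℚ x)) = _ at e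
    rw [e2] at e
    rw [e, hcast]
    ext i
    simp
    ring
  rcases hts with h | h
  · refine ⟨q, p, c, hq, hp, hc, hnc, fun x => ?_⟩
    rw [hrep, h, Rat.cast_one, one_smul]
  · refine ⟨-q, p, c, hq.neg, hp, hc, by rw [norm_neg, hnc], fun x => ?_⟩
    rw [hrep, h, neg_mul, neg_mul, map_neg]
    simp

theorem Represents.matrix_unique {R R' : Matrix (Fin 4) (Fin 4) ℝ} {q p : Hurwitz} {c : ℕ}
    (hc : 0 < c) (h : Represents R q p c) (h' : Represents R' q p c) : R = R' := by
  refine Matrix.ext_of_mulVec_single fun i => ?_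
  have hmem : (Pi.single i 1 : Fin 4 → ℝ) ∈ D4star :=
    Or.inl fun l => by
      by_cases hl : l = i
      · subst hl; exact ⟨1, by simp⟩
      · exact ⟨0, by simp [hl]⟩
  rw [← range_emb] at hmem
  obtain ⟨x, hx⟩ := hmem
  have hc0 : (c : ℝ) ≠ 0 := by exact_mod_cast hc.ne'
  rw [← hx]
  exact smul_right_injective _ hc0 ((h x).trans (h' x).symm)

theorem exists_rotation {q p : Hurwitz} {c : ℕ} (hc : 0 < c) (h : norm q * norm p = c ^ 2) :
    ∃ R : specialOrthogonalGroup (Fin 4) ℝ, Represents R.1 q p c := by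
  have hc0 : (c : ℝ) ≠ 0 := by exact_mod_cast hc.ne'
  have hR : (norm q : ℝ) * norm p = c ^ 2 := by exact_mod_cast h
  refine ⟨⟨(c : ℝ)⁻¹ • (quatLeft (toQuat ℝ q) * quatRight (toQuat ℝ p)), ?_⟩, fun x => ?_⟩
  · rw [mem_specialOrthogonalGroup_iff, mem_orthogonalGroup_iff]
    constructor
    · rw [transpose_smul,
        transpose_mul, smul_mul_smul_comm, mul_assoc, ← mul_assoc (quatRight _),
        quatRight_mul_transpose, smul_mul_assoc, one_mul, mul_smul_comm, quatLeft_mul_transpose,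
        smul_smul, smul_smul, normSq_toQuat, normSq_toQuat, mul_assoc, mul_comm (norm p : ℝ), hR,
        show (c : ℝ)⁻¹ * (c : ℝ)⁻¹ * (c : ℝ) ^ 2 = 1 by field_simp, one_smul]
    · rw [det_smul, det_mul, det_quatLeft, det_quatRight, normSq_toQuat, normSq_toQuat,
        ← mul_pow, hR, Fintype.card_fin]
      field_simp
  · rw [smul_mulVec, smul_smul, mul_inv_cancel₀ hc0, one_smul, emb_apply, ← mulVec_mulVec,
      quatRight_mulVec, quatLeft_mulVec, emb_apply, map_mul, map_mul, mul_assoc]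

theorem eq_intCast_of_commute {z : Hurwitz} (h : ∀ x, z * x = x * z) : ∃ n : ℤ, z = n := by
  have h1 := h ⟨0, 1, 0, 0⟩
  have h2 := h ⟨0, 0, 1, 0⟩
  have e1 := congrArg Hurwitz.c h1
  have e2 := congrArg Hurwitz.d h1
  have e3 := congrArg Hurwitz.b h2
  have e4 := congrArg Hurwitz.d h2
  simp at e1 e2 e3 e4
  refine ⟨-z.b, ?_⟩
  ext <;> simp <;> linarith

/-- Equality of the two maps makes `z x` proportional to `x w` for all `x`, with `z = q̄' q` and `w
= p' p̄`. Taking `x = 1` shows that `z` is central, hence an integer. So `q` is proportional to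
`q'`, and primitivity leaves only a sign; the same sign follows for `p`. -/
theorem Represents.unique {R : Matrix (Fin 4) (Fin 4) ℝ} {q p q' p' : Hurwitz} {c c' : ℕ}
    (hc : 0 < c) (hc' : 0 < c') (hq : IsPrimitive q) (hp : IsPrimitive p) (hq' : IsPrimitive q')
    (hp' : IsPrimitive p') (h : Represents R q p c) (h' : Represents R q' p' c') :
    (q = q' ∧ p = p') ∨ (q = -q' ∧ p = -p') := by
  have e : ∀ x, (c' : Hurwitz) * (q * x * p) = c * (q' * x * p') := by
    intro x
    apply emb_injective
    rw [emb_natCast_mul, emb_natCast_mul, ← h x, ← h' x, smul_smul, smul_smul, mul_comm]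
  set z := conj q' * q with hz
  set w := p' * conj p with hw
  have e2 : ∀ x, ((c' * norm p : ℕ) : Hurwitz) * (z * x) =
      ((c * norm q' : ℕ) : Hurwitz) * (x * w) := by
    intro x
    have h3 := congrArg (fun y => conj q' * y * conj p) (e x)
    simp only [natCast_mul_left_comm] at h3
    have e3 : (c' : Hurwitz) * (conj q' * (q * x * p)) * conj p =
        ((c' * norm p : ℕ) : Hurwitz) * (z * x) := by
      calc _ = (c' : Hurwitz) * (conj q' * q * x * (p * conj p)) := by simp only [mul_assoc]
        _ = _ := by
          rw [mul_conj, ← (Nat.cast_commute (norm p) (conj q' * q * x)).eq, ← mul_assoc,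
            Nat.cast_mul]
    have e4 : (c : Hurwitz) * (conj q' * (q' * x * p')) * conj p =
        ((c * norm q' : ℕ) : Hurwitz) * (x * w) := by
      calc _ = (c : Hurwitz) * ((conj q' * q') * (x * (p' * conj p))) := by simp only [mul_assoc]
        _ = _ := by rw [conj_mul_self, ← mul_assoc, Nat.cast_mul]
    rw [e3, e4] at h3
    exact h3
  have hcn : ((c' * norm p : ℕ) : Hurwitz) ≠ 0 := by
    exact_mod_cast (Nat.mul_pos hc' hp.norm_pos).ne'
  have hzx : ∀ x, z * x = x * z := by
    intro x
    have h1 := e2 1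
    rw [mul_one, one_mul] at h1
    apply mul_left_cancel₀ hcn
    rw [e2 x, ← natCast_mul_left_comm, ← h1, natCast_mul_left_comm]
  obtain ⟨n, hn⟩ := eq_intCast_of_commute hzx
  have h5 : (norm q' : Hurwitz) * q = (n : Hurwitz) * q' := by
    rw [← mul_conj, mul_assoc, ← hz, hn]
    exact (Int.cast_commute n q').eq.symm
  have h6 := e 1
  rw [mul_one, mul_one] at h6
  have hcc : (c' : Hurwitz) ≠ 0 := by exact_mod_cast hc'.ne'
  rcases hq.eq_or_eq_neg hq' hq'.norm_pos.ne' h5 with ⟨-, rfl⟩ | ⟨-, rfl⟩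
  · left
    rw [← natCast_mul_left_comm, ← natCast_mul_left_comm] at h6
    have h7 : (c' : Hurwitz) * p = ((c : ℤ) : Hurwitz) * p' := by
      rw [Int.cast_natCast]; exact mul_left_cancel₀ hq.ne_zero h6
    rcases hp.eq_or_eq_neg hp' hc'.ne' h7 with ⟨-, h8⟩ | ⟨h8, -⟩
    · exact ⟨rfl, h8⟩
    · omega
  · right
    rw [← natCast_mul_left_comm, ← natCast_mul_left_comm, neg_mul, ← mul_neg, ← mul_neg] at h6
    have h7 : (c' : Hurwitz) * -p = ((c : ℤ) : Hurwitz) * p' := by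
      rw [Int.cast_natCast, mul_neg]
      simpa using mul_left_cancel₀ hq'.ne_zero h6
    rcases hp.neg.eq_or_eq_neg hp' hc'.ne' h7 with ⟨-, h8⟩ | ⟨h8, -⟩
    · exact ⟨rfl, by rw [← h8, neg_neg]⟩
    · omega

end Hurwitz

/-! ### Coincidence rotations of the four-dimensional lattice and odd pairs -/

namespace Hurwitz

open Matrix

/-- The element `i`. -/
def unitI : Hurwitz := ⟨0, 1, 0, 0⟩

theorem pi_mul_pi : pi * pi = (2 : ℕ) * unitI := by rfl

/-- The element `π x` has even norm, so it is of the form `y π`, and `π² = 2i`. Together with the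
converse below, `x ↦ π x π / 2` is a bijection of the order. -/
theorem exists_pi_mul_mul_pi (x : Hurwitz) : ∃ y, pi * x * pi = (2 : ℕ) * y := by
  obtain ⟨y, hy⟩ := exists_mul_pi (x := pi * x) (by rw [norm_mul, norm_pi]; exact dvd_mul_right _ _)
  exact ⟨y * unitI, by rw [hy, mul_assoc, pi_mul_pi, natCast_mul_left_comm]⟩

theorem exists_eq_pi_mul_mul_pi (y : Hurwitz) : ∃ x, pi * x * pi = (2 : ℕ) * y := by
  obtain ⟨z, hz⟩ := exists_pi_mul_mul_pi (conj y)
  have h1 : conj pi * y * conj pi = (2 : ℕ) * conj z := by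
    have := congrArg conj hz
    rw [conj_mul, conj_mul, conj_conj, conj_mul, conj_natCast,
      ← (Nat.cast_commute 2 (conj z)).eq, ← mul_assoc] at this
    exact this
  refine ⟨conj z, ?_⟩
  have h2 : ((2 : ℕ) : Hurwitz) * (pi * conj z * pi) = (2 : ℕ) * ((2 : ℕ) * y) := by
    have e : ((2 : ℕ) : Hurwitz) * (pi * conj z * pi) = pi * ((2 : ℕ) * conj z) * pi := by
      rw [natCast_mul_left_comm, mul_assoc ((2 : ℕ) : Hurwitz) (pi * conj z)]
    rw [e, ← h1]
    calc pi * (conj pi * y * conj pi) * pi = (pi * conj pi) * y * (conj pi * pi) := by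
          simp only [mul_assoc]
      _ = _ := by
        rw [mul_conj, conj_mul_self, norm_pi, ← (Nat.cast_commute 2 _).eq]
  exact mul_left_cancel₀ (Nat.cast_ne_zero.2 two_ne_zero) h2

/-- Two factors `π` would multiply to `2i`, contradicting primitivity; so a primitive element
contains at most one. -/
theorem IsPrimitive.exists_eq_mul_pi {q : Hurwitz} (hq : IsPrimitive q) (h : 2 ∣ norm q) :
    ∃ q', q = q' * pi ∧ IsPrimitive q' ∧ Odd (norm q') := by
  obtain ⟨q', rfl⟩ := exists_mul_pi h
  refine ⟨q', rfl, fun p hp hd => hq p hp (natCast_dvd_mul_right hd _), ?_⟩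
  by_contra hne
  rw [Nat.not_odd_iff_even, even_iff_two_dvd] at hne
  obtain ⟨y, rfl⟩ := exists_mul_pi hne
  refine hq 2 Nat.prime_two ?_
  rw [mul_assoc, pi_mul_pi, natCast_mul_left_comm]
  exact ⟨_, rfl⟩

theorem IsPrimitive.mul_pi {q : Hurwitz} (hq : IsPrimitive q) (h : Odd (norm q)) :
    IsPrimitive (q * pi) := by
  intro p hp hd
  rcases hp.eq_two_or_odd' with rfl | hodd
  · obtain ⟨y, hy⟩ := hd
    have h1 := congrArg norm hy
    rw [norm_mul, norm_mul, norm_pi, norm_natCast] at h1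
    obtain ⟨k, hk⟩ := h
    omega
  · have h1 := natCast_dvd_mul_right hd (Hurwitz.conj pi)
    rw [mul_assoc, mul_conj, norm_pi, ← (Nat.cast_commute 2 q).eq] at h1
    exact hq p hp (natCast_dvd_of_coprime (Nat.coprime_two_right.2 hodd) h1)

theorem IsPrimitive.exists_eq_pi_mul {q : Hurwitz} (hq : IsPrimitive q) (h : 2 ∣ norm q) :
    ∃ q', q = pi * q' ∧ IsPrimitive q' ∧ Odd (norm q') := by
  obtain ⟨q', rfl⟩ := exists_pi_mul h
  refine ⟨q', rfl, fun p hp hd => hq p hp (natCast_dvd_mul_left hd _), ?_⟩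
  by_contra hne
  rw [Nat.not_odd_iff_even, even_iff_two_dvd] at hne
  obtain ⟨y, rfl⟩ := exists_pi_mul hne
  refine hq 2 Nat.prime_two ?_
  rw [← mul_assoc, pi_mul_pi, mul_assoc]
  exact ⟨_, rfl⟩

theorem IsPrimitive.pi_mul {q : Hurwitz} (hq : IsPrimitive q) (h : Odd (norm q)) :
    IsPrimitive (pi * q) := by
  intro p hp hd
  rcases hp.eq_two_or_odd' with rfl | hodd
  · obtain ⟨y, hy⟩ := hd
    have h1 := congrArg norm hy
    rw [norm_mul, norm_mul, norm_pi, norm_natCast] at h1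
    obtain ⟨k, hk⟩ := h
    omega
  · have h1 := natCast_dvd_mul_left hd (Hurwitz.conj pi)
    rw [← mul_assoc, conj_mul_self, norm_pi] at h1
    exact hq p hp (natCast_dvd_of_coprime (Nat.coprime_two_right.2 hodd) h1)

theorem mem_rotate_D4star {R : Matrix (Fin 4) (Fin 4) ℝ} {v : Fin 4 → ℝ} :
    v ∈ rotate R D4star ↔ ∃ x, R *ᵥ emb x = v := by
  rw [← range_emb]
  constructor
  · rintro ⟨_, ⟨x, rfl⟩, rfl⟩
    exact ⟨x, rfl⟩
  · rintro ⟨x, rfl⟩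
    exact ⟨_, ⟨x, rfl⟩, rfl⟩

/-- The two maps differ by `x ↦ π x π / 2`, which permutes the lattice. -/
theorem rotate_eq_of_pi {R R' : Matrix (Fin 4) (Fin 4) ℝ} {q p : Hurwitz} {c : ℕ} (hc : 0 < c)
    (h : Represents R (q * pi) (pi * p) (2 * c)) (h' : Represents R' q p c) :
    rotate R D4star = rotate R' D4star := by
  have hc2 : ((2 * c : ℕ) : ℝ) ≠ 0 := by exact_mod_cast (Nat.mul_pos two_pos hc).ne'
  have key : ∀ x y, pi * x * pi = (2 : ℕ) * y → R *ᵥ emb x = R' *ᵥ emb y := by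
    intro x y hxy
    apply smul_right_injective _ hc2
    have e : q * pi * x * (pi * p) = (2 : ℕ) * (q * y * p) := by
      calc _ = q * (pi * x * pi) * p := by simp only [mul_assoc]
        _ = _ := by rw [hxy, natCast_mul_left_comm, mul_assoc]
    change ((2 * c : ℕ) : ℝ) • (R *ᵥ emb x) = ((2 * c : ℕ) : ℝ) • (R' *ᵥ emb y)
    rw [h x, e, emb_natCast_mul, ← h' y, smul_smul, Nat.cast_mul]
  ext v
  rw [mem_rotate_D4star, mem_rotate_D4star]
  constructor
  · rintro ⟨x, rfl⟩
    obtain ⟨y, hy⟩ := exists_pi_mul_mul_pi x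
    exact ⟨y, (key x y hy).symm⟩
  · rintro ⟨y, rfl⟩
    obtain ⟨x, hx⟩ := exists_eq_pi_mul_mul_pi y
    exact ⟨x, key x y hx⟩

/-- The inverse of `z ↦ q z p / c` is `x ↦ q̄ x p̄ / c`. -/
theorem natCast_mul_eq_iff {q p : Hurwitz} {c : ℕ} (hc : 0 < c)
    (hn : norm q * norm p = c ^ 2) (x z : Hurwitz) :
    (c : Hurwitz) * x = q * z * p ↔ conj q * x * conj p = c * z := by
  have hcH : (c : Hurwitz) ≠ 0 := by exact_mod_cast hc.ne'
  have hcc : ((norm q : ℕ) : Hurwitz) * (norm p : ℕ) = c * c := by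
    rw [← Nat.cast_mul, hn, sq, Nat.cast_mul]
  refine ⟨fun hz => ?_, fun hz => ?_⟩
  · apply mul_left_cancel₀ hcH
    have h2 : conj q * (c * x) * conj p = conj q * (q * z * p) * conj p := by rw [hz]
    rw [natCast_mul_left_comm, mul_assoc (c : Hurwitz)] at h2
    rw [h2]
    calc _ = (conj q * q) * z * (p * conj p) := by simp only [mul_assoc]
      _ = _ := by
        rw [conj_mul_self, mul_conj, ← (Nat.cast_commute (norm p) _).eq, ← mul_assoc, ← mul_assoc,
          ((Nat.cast_commute (norm p) (norm q : Hurwitz)).eq), hcc]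
  · apply mul_left_cancel₀ hcH
    have h2 : q * (conj q * x * conj p) * p = q * (c * z) * p := by rw [hz]
    rw [natCast_mul_left_comm, mul_assoc (c : Hurwitz)] at h2
    rw [← h2]
    calc _ = ((norm q : ℕ) : Hurwitz) * (norm p : ℕ) * x := by rw [hcc, mul_assoc]
      _ = (q * conj q) * x * (conj p * p) := by
        rw [mul_conj, conj_mul_self, mul_assoc, mul_assoc, (Nat.cast_commute (norm p) x).eq]
      _ = _ := by simp only [mul_assoc]

theorem emb_mem_rotate_iff {R : Matrix (Fin 4) (Fin 4) ℝ} {q p : Hurwitz} {c : ℕ} (hc : 0 < c)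
    (hn : norm q * norm p = c ^ 2) (h : Represents R q p c) (x : Hurwitz) :
    emb x ∈ rotate R D4star ↔ (c : Hurwitz) ∣ conj q * x * conj p := by
  have hcR : (c : ℝ) ≠ 0 := by exact_mod_cast hc.ne'
  rw [mem_rotate_D4star]
  refine exists_congr fun z => ?_
  rw [← natCast_mul_eq_iff hc hn, ← (smul_right_injective (Fin 4 → ℝ) hcR).eq_iff,
    ← emb_injective.eq_iff, ← h z, emb_natCast_mul]
  exact eq_comm

theorem coincidenceIndex_of_represents {R : Matrix (Fin 4) (Fin 4) ℝ} {q p : Hurwitz} {c : ℕ}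
    (hc : Odd c) (hq : IsPrimitive q) (hp : IsPrimitive p) (hn : norm q * norm p = c ^ 2)
    (h : Represents R q p c) : coincidenceIndex D4star R = (norm q).lcm (norm p) := by
  have e : (rotate R D4star).comap emb = sandwichKer (conj q) (conj p) c := by
    ext x
    exact emb_mem_rotate_iff hc.pos hn h x
  rw [coincidenceIndex, csl, AddSubgroup.inf_relIndex_left]
  conv_lhs => rw [← range_emb]
  rw [← AddSubgroup.index_comap, range_emb, e,
    index_sandwichKer_of_norm_mul_eq_sq hc hq.conj hp.conj (by simpa using hn), norm_conj,
    norm_conj]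

theorem isCoincidence_of_represents {R : Matrix (Fin 4) (Fin 4) ℝ} {q p : Hurwitz} {c : ℕ}
    (hc : Odd c) (hq : IsPrimitive q) (hp : IsPrimitive p) (hn : norm q * norm p = c ^ 2)
    (h : Represents R q p c) : IsCoincidence D4star R := by
  constructor
  · let f : Hurwitz →+ (Fin 4 → ℝ) := (mulVecLin R).toAddMonoidHom.comp emb
    have hf : f.range = rotate R D4star := by
      ext v
      rw [mem_rotate_D4star]
      rfl
    have e : D4star.comap f = sandwichKer q p c := by
      ext x
      have hcR : (c : ℝ) ≠ 0 := by exact_mod_cast hc.pos.ne'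
      rw [AddSubgroup.mem_comap, ← range_emb, mem_sandwichKer]
      refine exists_congr fun z => ?_
      rw [← (smul_right_injective (Fin 4 → ℝ) hcR).eq_iff, ← emb_injective.eq_iff, ← h x,
        emb_natCast_mul]
      exact eq_comm
    rw [← hf, ← AddSubgroup.index_comap, e]
    exact index_sandwichKer_ne_zero hc (hq.at c) (hp.at c)
  · have h1 := coincidenceIndex_of_represents hc hq hp hn h
    rw [coincidenceIndex, csl, AddSubgroup.inf_relIndex_left] at h1
    rw [h1]
    exact Nat.lcm_ne_zero hq.norm_pos.ne' hp.norm_pos.ne'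

/-- `R` is the rotation belonging to the pair `(q, p)`, or to `(q (1 + i), (1 + i) p)`. -/
def RotationOf (R : Matrix (Fin 4) (Fin 4) ℝ) (t : Hurwitz × Hurwitz) : Bool → Prop
  | false => ∃ c, 0 < c ∧ norm t.1 * norm t.2 = c ^ 2 ∧ Represents R t.1 t.2 c
  | true => ∃ c, 0 < c ∧ norm t.1 * norm t.2 = c ^ 2 ∧
      Represents R (t.1 * pi) (pi * t.2) (2 * c)

/-- The pairs of primitive elements of odd norm that belong to the rotations of index `n`. -/
def oddPairs (n : ℕ) : Set (Hurwitz × Hurwitz) :=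
  {t | IsPrimitive t.1 ∧ IsPrimitive t.2 ∧ Odd (norm t.1) ∧ Odd (norm t.2) ∧
    IsSquare (norm t.1 * norm t.2) ∧ (norm t.1).lcm (norm t.2) = n}

theorem RotationOf.exists_represents {t : Hurwitz × Hurwitz} {β : Bool}
    {R : specialOrthogonalGroup (Fin 4) ℝ} (h : RotationOf R.1 t β) :
    ∃ (R' : specialOrthogonalGroup (Fin 4) ℝ) (c : ℕ), 0 < c ∧
      norm t.1 * norm t.2 = c ^ 2 ∧ Represents R'.1 t.1 t.2 c ∧
        rotate R.1 D4star = rotate R'.1 D4star := by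
  cases β with
  | false =>
    obtain ⟨c, hc, hn, hR⟩ := h
    exact ⟨R, c, hc, hn, hR, rfl⟩
  | true =>
    obtain ⟨c, hc, hn, hR⟩ := h
    obtain ⟨R', hR'⟩ := exists_rotation hc hn
    exact ⟨R', c, hc, hn, hR', rotate_eq_of_pi hc hR hR'⟩

theorem mem_coincidenceRotations_of_rotationOf {n : ℕ} {t : Hurwitz × Hurwitz}
    (ht : t ∈ oddPairs n) {β : Bool} {R : specialOrthogonalGroup (Fin 4) ℝ}
    (h : RotationOf R.1 t β) : R ∈ coincidenceRotations D4star n := by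
  obtain ⟨h1, h2, h3, h4, -, h6⟩ := ht
  obtain ⟨R', c, -, hn, hR', hrot⟩ := h.exists_represents
  have hodd : Odd c := by
    have : Odd (c ^ 2) := hn ▸ h3.mul h4
    rwa [Nat.odd_pow_iff two_ne_zero] at this
  have e1 := coincidenceIndex_of_represents hodd h1 h2 hn hR'
  have e2 := isCoincidence_of_represents hodd h1 h2 hn hR'
  refine ⟨?_, ?_⟩
  · rw [IsCoincidence, hrot]; exact e2
  · rw [coincidenceIndex, csl, hrot]
    rw [coincidenceIndex, csl, h6] at e1
    exact e1

/-- The norms of `q` and `p` multiply to a square and each contains at most one factor 2, so they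
have the same parity. If both are even, a factor `π` is split off on the right of `q` and on the
left of `p`. -/
theorem exists_rotationOf_of_isCoincidence {R : specialOrthogonalGroup (Fin 4) ℝ}
    (hR : IsCoincidence D4star R.1) :
    ∃ t ∈ oddPairs (coincidenceIndex D4star R.1), ∃ β, RotationOf R.1 t β := by
  obtain ⟨t, β, n, ht, h⟩ : ∃ t β n, t ∈ oddPairs n ∧ RotationOf R.1 t β := by
    obtain ⟨q, p, c, hq, hp, hc, hn, h⟩ := exists_represents (exists_rat_entry hR) R.2
    rcases Nat.even_or_odd (norm q) with he | ho
    · obtain ⟨q', rfl, hq', hoq⟩ := hq.exists_eq_mul_pi (even_iff_two_dvd.1 he)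
      have hc2 : 2 ∣ c := by
        have : 2 ∣ c ^ 2 := hn ▸ Dvd.dvd.mul_right (even_iff_two_dvd.1 he) _
        exact Nat.prime_two.dvd_of_dvd_pow this
      obtain ⟨c', rfl⟩ := hc2
      rw [norm_mul, norm_pi] at hn
      have hp2 : 2 ∣ norm p := by
        have h1 : norm q' * norm p = 2 * c' ^ 2 := by nlinarith
        exact (Nat.Coprime.dvd_mul_left (Nat.coprime_two_left.2 hoq)).1 (h1 ▸ dvd_mul_right 2 _)
      obtain ⟨p', rfl, hp', hop⟩ := hp.exists_eq_pi_mul hp2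
      rw [norm_mul, norm_pi] at hn
      have hn' : norm q' * norm p' = c' ^ 2 := by nlinarith
      exact ⟨(q', p'), true, _, ⟨hq', hp', hoq, hop, ⟨c', by rw [← sq]; exact hn'⟩, rfl⟩,
        c', by omega, hn', h⟩
    · have hop : Odd (norm p) := by
        by_contra hne
        rw [Nat.not_odd_iff_even, even_iff_two_dvd] at hne
        obtain ⟨p', rfl, hp', hop⟩ := hp.exists_eq_pi_mul hne
        have hc2 : 2 ∣ c := by
          have : 2 ∣ c ^ 2 := hn ▸ Dvd.dvd.mul_left hne _
          exact Nat.prime_two.dvd_of_dvd_pow this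
        obtain ⟨c', rfl⟩ := hc2
        rw [norm_mul, norm_pi] at hn
        have h1 : norm q * norm p' = 2 * c' ^ 2 := by nlinarith
        have h2 : Odd (norm q * norm p') := ho.mul hop
        rw [h1] at h2
        exact (Nat.not_odd_iff_even.2 (even_two_mul _)) h2
      exact ⟨(q, p), false, _, ⟨hq, hp, ho, hop, ⟨c, by rw [← sq]; exact hn⟩, rfl⟩, c, hc, hn, h⟩
  have h1 := mem_coincidenceRotations_of_rotationOf ht h
  rw [h1.2]
  exact ⟨t, ht, β, h⟩

/-- The primitive pair of a rotation is unique up to sign, and the parity of its norm tells whether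
the factors `π` are present. -/
theorem rotationOf_unique {R : Matrix (Fin 4) (Fin 4) ℝ} {m n : ℕ} {t s : Hurwitz × Hurwitz}
    (ht : t ∈ oddPairs m) (hs : s ∈ oddPairs n) {β γ : Bool} (h : RotationOf R t β)
    (h' : RotationOf R s γ) : β = γ ∧ (t = s ∨ t = -s) := by
  obtain ⟨t1, t2, t3, t4, -, -⟩ := ht
  obtain ⟨s1, s2, s3, s4, -, -⟩ := hs
  have hpi : pi ≠ 0 := fun h => by simpa [pi] using congrArg Hurwitz.a h
  have npi : ∀ x y : Hurwitz, Odd (norm x) → norm x ≠ norm (y * pi) := by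
    intro x y hx he
    rw [he, norm_mul, norm_pi, mul_comm] at hx
    exact (Nat.not_odd_iff_even.2 (even_two_mul _)) hx
  cases β <;> cases γ
  · obtain ⟨c, hc, -, hR⟩ := h
    obtain ⟨d, hd, -, hR'⟩ := h'
    refine ⟨rfl, ?_⟩
    rcases hR.unique hc hd t1 t2 s1 s2 hR' with ⟨e1, e2⟩ | ⟨e1, e2⟩
    · exact Or.inl (Prod.ext e1 e2)
    · exact Or.inr (Prod.ext e1 e2)
  · exfalso
    obtain ⟨c, hc, -, hR⟩ := h
    obtain ⟨d, hd, -, hR'⟩ := h'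
    rcases hR.unique hc (by omega) t1 t2 (s1.mul_pi s3) (s2.pi_mul s4) hR' with ⟨e1, -⟩ | ⟨e1, -⟩
    · exact npi _ _ t3 (congrArg norm e1)
    · exact npi _ _ t3 (by rw [e1, norm_neg])
  · exfalso
    obtain ⟨c, hc, -, hR⟩ := h
    obtain ⟨d, hd, -, hR'⟩ := h'
    rcases hR'.unique hd (by omega) s1 s2 (t1.mul_pi t3) (t2.pi_mul t4) hR with ⟨e1, -⟩ | ⟨e1, -⟩
    · exact npi _ _ s3 (congrArg norm e1)
    · exact npi _ _ s3 (by rw [e1, norm_neg])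
  · obtain ⟨c, hc, -, hR⟩ := h
    obtain ⟨d, hd, -, hR'⟩ := h'
    refine ⟨rfl, ?_⟩
    rcases hR.unique (by omega) (by omega) (t1.mul_pi t3) (t2.pi_mul t4) (s1.mul_pi s3)
      (s2.pi_mul s4) hR' with ⟨e1, e2⟩ | ⟨e1, e2⟩
    · exact Or.inl (Prod.ext (mul_right_cancel₀ hpi e1) (mul_left_cancel₀ hpi e2))
    · rw [← neg_mul] at e1
      rw [← mul_neg] at e2
      exact Or.inr (Prod.ext (mul_right_cancel₀ hpi e1) (mul_left_cancel₀ hpi e2))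

theorem rotationOf_neg {R : Matrix (Fin 4) (Fin 4) ℝ} {t : Hurwitz × Hurwitz} {β : Bool}
    (h : RotationOf R t β) : RotationOf R (-t) β := by
  cases β
  · obtain ⟨c, hc, hn, hR⟩ := h
    exact ⟨c, hc, by simpa using hn, fun x => by rw [hR x]; simp⟩
  · obtain ⟨c, hc, hn, hR⟩ := h
    exact ⟨c, hc, by simpa using hn, fun x => by rw [hR x]; simp⟩

theorem neg_mem_oddPairs {n : ℕ} {t : Hurwitz × Hurwitz} (ht : t ∈ oddPairs n) :
    -t ∈ oddPairs n := by
  obtain ⟨t1, t2, t3, t4, t5, t6⟩ := ht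
  exact ⟨t1.neg, t2.neg, by simpa using t3, by simpa using t4, by simpa using t5,
    by simpa using t6⟩

theorem exists_rotationOf {n : ℕ} {t : Hurwitz × Hurwitz} (ht : t ∈ oddPairs n) (β : Bool) :
    ∃ R : specialOrthogonalGroup (Fin 4) ℝ, RotationOf R.1 t β := by
  obtain ⟨t1, t2, t3, t4, ⟨c, hc⟩, -⟩ := ht
  rw [← sq] at hc
  have hc0 : 0 < c := by
    rcases Nat.eq_zero_or_pos c with rfl | h
    · have := Nat.mul_pos t1.norm_pos t2.norm_pos
      rw [hc] at this
      simp at this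
    · exact h
  cases β
  · obtain ⟨R, hR⟩ := exists_rotation hc0 hc
    exact ⟨R, c, hc0, hc, hR⟩
  · obtain ⟨R, hR⟩ := exists_rotation (q := t.1 * pi) (p := pi * t.2) (c := 2 * c) (by omega)
      (by rw [norm_mul, norm_mul, norm_pi, mul_pow, ← hc]; ring)
    exact ⟨R, c, hc0, hc, hR⟩

theorem RotationOf.matrix_unique {R R' : Matrix (Fin 4) (Fin 4) ℝ} {t : Hurwitz × Hurwitz}
    {β : Bool} (h : RotationOf R t β) (h' : RotationOf R' t β) : R = R' := by
  cases β <;> obtain ⟨c, hc, hn, hR⟩ := h <;> obtain ⟨d, hd, hn', hR'⟩ := h' <;>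
    obtain rfl : c = d := Nat.pow_left_injective two_ne_zero (hn.symm.trans hn')
  · exact hR.matrix_unique hc hR'
  · exact hR.matrix_unique (by omega) hR'

/-- Rotations of index `n` are equinumerous with the pairs in `oddPairs n`. -/
theorem ncard_coincidenceRotations (n : ℕ) :
    (coincidenceRotations D4star n).ncard = (oddPairs n).ncard := by
  have hex : ∀ R : specialOrthogonalGroup (Fin 4) ℝ, R ∈ coincidenceRotations D4star n →
      ∃ (t : Hurwitz × Hurwitz) (β : Bool), t ∈ oddPairs n ∧ RotationOf R.1 t β := by
    rintro R ⟨h1, h2⟩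
    obtain ⟨t, ht, β, h⟩ := exists_rotationOf_of_isCoincidence h1
    rw [h2] at ht
    exact ⟨t, β, ht, h⟩
  choose! g γ hg hγ using hex
  have hne : ∀ t ∈ oddPairs n, t ≠ -t := by
    intro t ht h
    have h1 : t.1 = -t.1 := congrArg Prod.fst h
    have h2 : ((2 : ℕ) : Hurwitz) * t.1 = 0 := by
      rw [Nat.cast_two, two_mul]
      nth_rewrite 2 [h1]
      exact add_neg_cancel _
    exact ht.1.ne_zero ((mul_eq_zero.1 h2).resolve_left (Nat.cast_ne_zero.2 two_ne_zero))
  -- Each rotation comes from two pairs differing by sign, and each pair belongs to two rotations,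
  -- one with and one without the factors `π`. On the left the Boolean is the sign, on the right the
  -- twist, and the factors 2 cancel.
  have hcard : ((coincidenceRotations D4star n) ×ˢ (Set.univ : Set Bool)).ncard =
      ((oddPairs n) ×ˢ (Set.univ : Set Bool)).ncard := by
    refine Set.ncard_congr (fun P _ => (if P.2 then -g P.1 else g P.1, γ P.1)) ?_ ?_ ?_
    · rintro ⟨R, β⟩ ⟨hR, -⟩
      refine ⟨?_, Set.mem_univ _⟩
      cases β
      · exact hg R hR
      · exact neg_mem_oddPairs (hg R hR)
    · rintro ⟨R, β⟩ ⟨R', β'⟩ ⟨hR, -⟩ ⟨hR', -⟩ h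
      have e2 : γ R = γ R' := congrArg Prod.snd h
      have e1 : (if β then -g R else g R) = if β' then -g R' else g R' := congrArg Prod.fst h
      have key : ∀ (R : specialOrthogonalGroup (Fin 4) ℝ) (β : Bool),
          R ∈ coincidenceRotations D4star n →
          RotationOf R.1 (if β then -g R else g R) (γ R) := by
        intro R β hR
        cases β
        · exact hγ R hR
        · exact rotationOf_neg (hγ R hR)
      have k1 := key R β hR
      rw [e1, e2] at k1
      obtain rfl : R = R' := Subtype.ext (k1.matrix_unique (key R' β' hR'))
      have := hne _ (hg R hR)
      cases β <;> cases β' <;> simp_all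
    · rintro ⟨t, β⟩ ⟨ht, -⟩
      simp only at ht
      obtain ⟨R, hR⟩ := exists_rotationOf ht β
      have hRm := mem_coincidenceRotations_of_rotationOf ht hR
      obtain ⟨e1, e2 | e2⟩ := rotationOf_unique ht (hg R hRm) hR (hγ R hRm)
      · exact ⟨(R, false), ⟨hRm, Set.mem_univ _⟩, by simp [e1, e2]⟩
      · exact ⟨(R, true), ⟨hRm, Set.mem_univ _⟩, by simp [e1, e2]⟩
  rw [Set.ncard_prod, Set.ncard_prod] at hcard
  exact Nat.eq_of_mul_eq_mul_right (by simp) hcard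

theorem oddPairs_finite (n : ℕ) : (oddPairs n).Finite := by
  rcases Nat.eq_zero_or_pos n with rfl | hn
  · refine Set.finite_empty.subset ?_
    rintro t ⟨t1, t2, -, -, -, h⟩
    exact absurd h (Nat.lcm_ne_zero t1.norm_pos.ne' t2.norm_pos.ne')
  · have hB : (⋃ m ∈ Finset.Icc 0 n, {x : Hurwitz | norm x = m}).Finite :=
      Set.Finite.biUnion (Finset.finite_toSet _) fun m _ => finite_norm_eq m
    refine (hB.prod hB).subset ?_
    rintro t ⟨-, -, -, -, -, h⟩
    simp only [Set.mem_prod, Set.mem_iUnion, Finset.mem_Icc, Set.mem_ofPred_eq]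
    exact ⟨⟨_, ⟨Nat.zero_le _, Nat.le_of_dvd hn (h ▸ Nat.dvd_lcm_left _ _)⟩, rfl⟩,
      ⟨_, ⟨Nat.zero_le _, Nat.le_of_dvd hn (h ▸ Nat.dvd_lcm_right _ _)⟩, rfl⟩⟩

theorem coincidenceRotations_finite (n : ℕ) : (coincidenceRotations D4star n).Finite := by
  have hex : ∀ R : specialOrthogonalGroup (Fin 4) ℝ, R ∈ coincidenceRotations D4star n →
      ∃ P : (Hurwitz × Hurwitz) × Bool, P.1 ∈ oddPairs n ∧ RotationOf R.1 P.1 P.2 := by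
    rintro R ⟨h1, h2⟩
    obtain ⟨t, ht, β, h⟩ := exists_rotationOf_of_isCoincidence h1
    rw [h2] at ht
    exact ⟨(t, β), ht, h⟩
  choose! g hg hγ using hex
  refine Set.Finite.of_finite_image (f := g) (((oddPairs_finite n).prod
    (Set.finite_univ (α := Bool))).subset ?_) ?_
  · rintro _ ⟨R, hR, rfl⟩
    exact ⟨hg R hR, Set.mem_univ _⟩
  · intro R hR R' hR' h
    have k := hγ R hR
    rw [h] at k
    exact Subtype.ext (k.matrix_unique (hγ R' hR'))

end Hurwitz

/-! ### The symmetry group of order 576 and the count as a sum over norm pairs -/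

namespace Hurwitz

open Matrix

/-- Index 1 forces both norms of the odd pair to be 1, and multiplication by units on either side
preserves the order. -/
theorem mem_symmetryRotations_iff (R : specialOrthogonalGroup (Fin 4) ℝ) :
    R ∈ symmetryRotations D4star ↔ R ∈ coincidenceRotations D4star 1 := by
  constructor
  · intro h
    have h' : rotate R.1 D4star = D4star := h
    refine ⟨?_, ?_⟩
    · rw [IsCoincidence, h']
    · rw [coincidenceIndex, csl, h', inf_idem, AddSubgroup.relIndex_self]
  · rintro ⟨h1, h2⟩
    obtain ⟨t, ⟨t1, t2, -, -, -, t6⟩, β, h⟩ := exists_rotationOf_of_isCoincidence h1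
    rw [h2] at t6
    obtain ⟨R', c, hc, hn, hR', hrot⟩ := h.exists_represents
    have n1 : norm t.1 = 1 := Nat.dvd_one.1 (t6 ▸ Nat.dvd_lcm_left _ _)
    have n2 : norm t.2 = 1 := Nat.dvd_one.1 (t6 ▸ Nat.dvd_lcm_right _ _)
    have hc1 : c = 1 := by
      rw [n1, n2] at hn
      exact (Nat.pow_eq_one.1 (hn.symm.trans (one_mul 1))).resolve_right two_ne_zero
    subst hc1
    change rotate R.1 D4star = D4star
    rw [hrot]
    apply le_antisymm
    · intro v hv
      obtain ⟨x, rfl⟩ := mem_rotate_D4star.1 hv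
      have := hR' x
      rw [Nat.cast_one, one_smul] at this
      rw [this, ← range_emb]
      exact ⟨_, rfl⟩
    · intro v hv
      rw [← range_emb] at hv
      obtain ⟨x, rfl⟩ := hv
      rw [emb_mem_rotate_iff one_pos hn hR', Nat.cast_one]
      exact one_dvd _

open scoped Classical in
/-- The pairs of norms of the elements of `oddPairs n`. -/
noncomputable def normPairs (n : ℕ) : Finset (ℕ × ℕ) :=
  (n.divisors ×ˢ n.divisors).filter fun m =>
    Odd m.1 ∧ Odd m.2 ∧ IsSquare (m.1 * m.2) ∧ m.1.lcm m.2 = n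

theorem ncard_oddPairs {n : ℕ} (hn : n ≠ 0) : (oddPairs n).ncard =
    576 * ∑ m ∈ normPairs n, (primIdeals m.1).ncard * (primIdeals m.2).ncard := by
  classical
  rw [Set.ncard_eq_toFinset_card _ (oddPairs_finite n),
    Finset.card_eq_sum_card_fiberwise (f := fun t => (norm t.1, norm t.2)) (t := normPairs n),
    Finset.mul_sum]
  · refine Finset.sum_congr rfl fun m hm => ?_
    rw [normPairs, Finset.mem_filter] at hm
    obtain ⟨-, m1, m2, m3, m4⟩ := hm
    have e : ((((oddPairs_finite n).toFinset.filter fun t => (norm t.1, norm t.2) = m) :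
        Finset (Hurwitz × Hurwitz)) : Set (Hurwitz × Hurwitz)) = primElts m.1 ×ˢ primElts m.2 := by
      ext t
      simp only [Finset.coe_filter, Set.Finite.mem_toFinset, Set.mem_ofPred_eq, Set.mem_prod,
        primElts]
      constructor
      · rintro ⟨⟨t1, t2, -⟩, rfl⟩
        exact ⟨⟨t1, rfl⟩, t2, rfl⟩
      · rintro ⟨⟨t1, h1⟩, t2, h2⟩
        exact ⟨⟨t1, t2, h1 ▸ m1, h2 ▸ m2, by rw [h1, h2]; exact m3, by rw [h1, h2]; exact m4⟩,
          Prod.ext h1 h2⟩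
    rw [← Set.ncard_coe_finset, e, Set.ncard_prod, ncard_primElts, ncard_primElts]
    ring
  · intro t ht
    obtain ⟨t1, t2, t3, t4, t5, t6⟩ := (oddPairs_finite n).mem_toFinset.1 ht
    simp only [normPairs, Finset.coe_filter, Set.mem_ofPred_eq, Finset.mem_product,
      Nat.mem_divisors]
    exact ⟨⟨⟨t6 ▸ Nat.dvd_lcm_left _ _, hn⟩, ⟨t6 ▸ Nat.dvd_lcm_right _ _, hn⟩⟩, t3, t4, t5, t6⟩

theorem ncard_symmetryRotations :
    ((symmetryRotations D4star : Set (specialOrthogonalGroup (Fin 4) ℝ))).ncard = 576 := by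
  have e : (symmetryRotations D4star : Set (specialOrthogonalGroup (Fin 4) ℝ)) =
      coincidenceRotations D4star 1 := by
    ext R
    exact mem_symmetryRotations_iff R
  have e2 : normPairs 1 = {(1, 1)} := by
    ext ⟨a, b⟩
    simp [normPairs]
    rintro rfl rfl
    simp
  rw [e, ncard_coincidenceRotations, ncard_oddPairs one_ne_zero, e2, Finset.sum_singleton,
    primIdeals_one, Set.ncard_singleton]

/-- The rotations of given index form a union of cosets of the symmetry group, because `R S` and `R`
rotate the lattice to the same image. -/
theorem ncard_coincidenceRotations_eq (n : ℕ) :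
    (coincidenceRotations D4star n).ncard = 576 * cRot D4star n := by
  set f : specialOrthogonalGroup (Fin 4) ℝ → _ ⧸ symmetryRotations D4star := QuotientGroup.mk
  have hinv : ∀ R ∈ coincidenceRotations D4star n, ∀ S ∈ symmetryRotations D4star,
      R * S ∈ coincidenceRotations D4star n := by
    rintro R ⟨h1, h2⟩ S hS
    have e : rotate (R * S).1 D4star = rotate R.1 D4star := by
      change rotate (R.1 * S.1) D4star = _
      rw [rotate_mul, show rotate S.1 D4star = D4star from hS]
    refine ⟨?_, ?_⟩
    · rw [IsCoincidence, e]; exact h1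
    · rw [coincidenceIndex, csl, e]; exact h2
  have hrep : ∀ C ∈ f '' coincidenceRotations D4star n,
      ∃ R, R ∈ coincidenceRotations D4star n ∧ f R = C := fun C h => h
  choose! g hg hgf using hrep
  rw [← ncard_symmetryRotations, mul_comm]
  change _ = (f '' coincidenceRotations D4star n).ncard * _
  rw [← Set.ncard_prod]
  symm
  refine Set.ncard_congr (fun P _ => g P.1 * P.2) ?_ ?_ ?_
  · rintro ⟨C, S⟩ ⟨hC, hS⟩
    exact hinv _ (hg C hC) S hS
  · rintro ⟨C, S⟩ ⟨C', S'⟩ ⟨hC, hS⟩ ⟨hC', hS'⟩ h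
    simp only at hC hS hC' hS' h
    have e1 : ∀ C ∈ f '' coincidenceRotations D4star n, ∀ S ∈ symmetryRotations D4star,
        f (g C * S) = C := by
      intro C hC S hS
      rw [← hgf C hC]
      refine QuotientGroup.eq.2 ?_
      rw [hgf C hC, _root_.mul_inv_rev, inv_mul_cancel_right]
      exact inv_mem hS
    have e2 : C = C' := by rw [← e1 C hC S hS, h, e1 C' hC' S' hS']
    subst e2
    rw [mul_left_cancel h]
  · intro R hR
    have hC : f R ∈ f '' coincidenceRotations D4star n := ⟨R, hR, rfl⟩
    exact ⟨(f R, (g (f R))⁻¹ * R), ⟨hC, QuotientGroup.eq.1 (hgf _ hC)⟩,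
      mul_inv_cancel_left _ _⟩

theorem cRot_eq_sum {n : ℕ} (hn : n ≠ 0) : cRot D4star n =
    ∑ m ∈ normPairs n, (primIdeals m.1).ncard * (primIdeals m.2).ncard := by
  have h := ncard_coincidenceRotations_eq n
  rw [ncard_coincidenceRotations, ncard_oddPairs hn] at h
  exact (Nat.eq_of_mul_eq_mul_left (by norm_num) h).symm

end Hurwitz

/-! ### Coincidence site lattices of the body-centred cubic lattice -/

namespace Hurwitz

open Matrix

theorem natCast_dvd_of_two_mul {n : ℕ} (hn : Odd n) {x : Hurwitz}
    (h : (n : Hurwitz) ∣ (2 : ℕ) * x) : (n : Hurwitz) ∣ x :=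
  natCast_dvd_of_coprime (Nat.coprime_two_right.2 hn) h

/-- The coordinate `a` is the reduced trace, and the sum of `e w ē` over `e = 1, i, j, k` is twice
the trace of `w`. Hence twice the trace of `q u`, times `z`, is divisible by `n`, and the odd `n`
allows the 2 to be cancelled. -/
theorem natCast_dvd_trace_mul {n : ℕ} (hn : Odd n) {z q : Hurwitz}
    (h : ∀ x, (n : Hurwitz) ∣ z * x * q) (u : Hurwitz) :
    (n : Hurwitz) ∣ ((q * u).a : Hurwitz) * z := by
  refine natCast_dvd_of_two_mul hn ?_
  have key : ∀ x y, (n : Hurwitz) ∣ z * (x * (q * u) * y) := fun x y => by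
    have := natCast_dvd_mul_right (h x) (u * y)
    simpa only [mul_assoc] using this
  set w := q * u
  have e : ((2 : ℕ) : Hurwitz) * ((w.a : Hurwitz) * z) =
      z * (1 * w * 1) + z * (⟨0, 1, 0, 0⟩ * w * ⟨0, -1, 0, 0⟩) +
        z * (⟨0, 0, 1, 0⟩ * w * ⟨0, 0, -1, 0⟩) + z * (⟨0, 0, 0, 1⟩ * w * ⟨0, 0, 0, -1⟩) := by
    rw [← mul_add, ← mul_add, ← mul_add, ← mul_assoc]
    have : 1 * w * 1 + (⟨0, 1, 0, 0⟩ * w * ⟨0, -1, 0, 0⟩) +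
        (⟨0, 0, 1, 0⟩ * w * ⟨0, 0, -1, 0⟩) + (⟨0, 0, 0, 1⟩ * w * ⟨0, 0, 0, -1⟩) =
        ((2 * w.a : ℤ) : Hurwitz) := by
      ext <;> simp [-Int.cast_mul] <;> ring
    rw [this, ← (Int.cast_commute _ z).eq]
    push_cast
    rfl
  rw [e]
  exact dvd_add (dvd_add (dvd_add (key _ _) (key _ _)) (key _ _)) (key _ _)

/-- The integers `m` with `n ∣ m z` form an ideal containing `n` and all traces of `q u`, hence all
coordinates of `q`. Primitivity at `n` makes it the unit ideal. -/
theorem natCast_dvd_of_forall {n : ℕ} (hn : Odd n) {z q : Hurwitz} (hq : PrimitiveAt n q)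
    (h : ∀ x, (n : Hurwitz) ∣ z * x * q) : (n : Hurwitz) ∣ z := by
  let I : Ideal ℤ :=
    { carrier := {m | (n : Hurwitz) ∣ (m : Hurwitz) * z}
      zero_mem' := by simp
      add_mem' := fun {a b} ha hb => by
        simp only [Set.mem_ofPred_eq, Int.cast_add, add_mul] at *
        exact dvd_add ha hb
      smul_mem' := fun a b hb => by
        simp only [Set.mem_ofPred_eq, smul_eq_mul, Int.cast_mul, mul_assoc] at *
        exact natCast_dvd_mul_left hb _ }
  have hI : ∀ m : ℤ, m ∈ I ↔ (n : Hurwitz) ∣ (m : Hurwitz) * z := fun m => Iff.rfl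
  have h2 : ∀ m : ℤ, 2 * m ∈ I → m ∈ I := fun m hm => by
    rw [hI] at hm ⊢
    refine natCast_dvd_of_two_mul hn ?_
    rw [Int.cast_mul, mul_assoc] at hm
    exact_mod_cast hm
  have ha : q.a ∈ I := by
    have := natCast_dvd_trace_mul hn h 1
    rwa [mul_one] at this
  have hb : q.b ∈ I := h2 _ <| by
    have e : 2 * q.b = -(q * ⟨0, 1, 0, 0⟩).a - q.a := by simp
    rw [e]
    exact sub_mem (neg_mem (natCast_dvd_trace_mul hn h _)) ha
  have hc : q.c ∈ I := h2 _ <| by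
    have e : 2 * q.c = -(q * ⟨0, 0, 1, 0⟩).a - q.a := by simp
    rw [e]
    exact sub_mem (neg_mem (natCast_dvd_trace_mul hn h _)) ha
  have hd : q.d ∈ I := h2 _ <| by
    have e : 2 * q.d = -(q * ⟨0, 0, 0, 1⟩).a - q.a := by simp
    rw [e]
    exact sub_mem (neg_mem (natCast_dvd_trace_mul hn h _)) ha
  have hnI : (n : ℤ) ∈ I := by rw [hI]; exact ⟨z, by simp⟩
  obtain ⟨g, hg⟩ := (IsPrincipalIdealRing.principal I).principal
  have hmem : ∀ m, m ∈ I → g ∣ m := fun m hm => by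
    rw [hg] at hm
    exact Ideal.mem_span_singleton.1 hm
  have hg1 : g.natAbs = 1 := by
    by_contra hne
    obtain ⟨p, hp, hpg⟩ := Nat.exists_prime_and_dvd hne
    have hp' : (p : ℤ) ∣ g := Int.natCast_dvd.2 hpg
    refine hq p hp (Int.natCast_dvd_natCast.1 (hp'.trans (hmem _ hnI))) ?_
    rw [natCast_dvd_iff]
    exact ⟨hp'.trans (hmem _ ha), hp'.trans (hmem _ hb), hp'.trans (hmem _ hc),
      hp'.trans (hmem _ hd)⟩
  have h1 : (1 : ℤ) ∈ I := by
    rw [hg]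
    exact Ideal.mem_span_singleton.2 (Int.isUnit_iff_natAbs_eq.2 hg1).dvd
  simpa [hI] using h1

/-- The vector part of a Hurwitz quaternion. -/
noncomputable def imEmb : Hurwitz →+ (Fin 3 → ℝ) where
  toFun x i := emb x i.succ
  map_zero' := by ext; simp
  map_add' x y := by ext; simp

theorem imEmb_apply (x : Hurwitz) (i : Fin 3) : imEmb x i = emb x i.succ := rfl

theorem imEmb_eq (x : Hurwitz) :
    imEmb x = ![(x.a / 2 + x.b : ℝ), x.a / 2 + x.c, x.a / 2 + x.d] := by
  ext i
  rw [imEmb_apply, emb_eq]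
  fin_cases i <;> rfl

theorem imEmb_natCast_mul (n : ℕ) (x : Hurwitz) : imEmb (n * x) = (n : ℝ) • imEmb x := by
  rw [← nsmul_eq_mul, map_nsmul, Nat.cast_smul_eq_nsmul]

theorem range_imEmb : imEmb.range = bcc := by
  ext v
  constructor
  · rintro ⟨x, rfl⟩
    rw [imEmb_eq]
    rcases Int.even_or_odd' x.a with ⟨m, hm | hm⟩
    · left
      intro i
      fin_cases i
      · exact ⟨m + x.b, by simp [hm]⟩
      · exact ⟨m + x.c, by simp [hm]⟩
      · exact ⟨m + x.d, by simp [hm]⟩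
    · right
      intro i
      fin_cases i
      · exact ⟨m + x.b, by simp [hm]; ring⟩
      · exact ⟨m + x.c, by simp [hm]; ring⟩
      · exact ⟨m + x.d, by simp [hm]; ring⟩
  · rintro (h | h)
    · choose m hm using h
      refine ⟨⟨0, m 0, m 1, m 2⟩, ?_⟩
      rw [imEmb_eq]
      ext i
      fin_cases i <;> simp [hm]
    · choose m hm using h
      refine ⟨⟨1, m 0, m 1, m 2⟩, ?_⟩
      rw [imEmb_eq]
      ext i
      fin_cases i <;> simp [hm] <;> ring

theorem exists_intCast_of_imEmb_eq_zero {x : Hurwitz} (h : imEmb x = 0) : ∃ m : ℤ, x = m := by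
  rw [imEmb_eq] at h
  have h0 := congrFun h 0
  have h1 := congrFun h 1
  have h2 := congrFun h 2
  simp at h0 h1 h2
  have e0 : x.a = -2 * x.b := by
    have : (x.a : ℝ) = -2 * x.b := by linarith
    exact_mod_cast this
  have e1 : x.c = x.b := by
    have : (x.c : ℝ) = x.b := by linarith
    exact_mod_cast this
  have e2 : x.d = x.b := by
    have : (x.d : ℝ) = x.b := by linarith
    exact_mod_cast this
  refine ⟨-x.b, ?_⟩
  ext <;> simp [e0, e1, e2]

/-- The map `x ↦ Im (q x q̄) / |q|²`. -/
noncomputable def rotHom (q : Hurwitz) : Hurwitz →+ (Fin 3 → ℝ) where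
  toFun x := (norm q : ℝ)⁻¹ • imEmb (q * x * conj q)
  map_zero' := by simp
  map_add' x y := by rw [mul_add, add_mul, map_add, smul_add]

theorem rotHom_apply (q x : Hurwitz) :
    rotHom q x = (norm q : ℝ)⁻¹ • imEmb (q * x * conj q) := rfl

theorem rotHom_eq_iff {q : Hurwitz} (hq : q ≠ 0) {x : Hurwitz} {v : Fin 3 → ℝ} :
    rotHom q x = v ↔ imEmb (q * x * conj q) = (norm q : ℝ) • v := by
  have h : (norm q : ℝ) ≠ 0 := by exact_mod_cast mt norm_eq_zero.1 hq
  rw [rotHom_apply, inv_smul_eq_iff₀ h]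

theorem mul_mul_conj_a (q x : Hurwitz) : (q * x * conj q).a = norm q * x.a := by
  rw [norm_cast]
  simp [normZ]
  ring

/-- A condition on vector parts lifts to whole quaternions: if `N x` and `q z q̄` agree up to an
integer `m`, where `N = norm q`, then comparing traces gives `N ∣ 2m`. So `N ∣ m` by oddness, and
shifting `z` by `m / N` removes the discrepancy. -/
theorem imEmb_mem_range_rotHom {q : Hurwitz} (hq : Odd (norm q)) (x : Hurwitz) :
    imEmb x ∈ (rotHom q).range ↔ (norm q : Hurwitz) ∣ conj q * x * q := by
  have h0 : q ≠ 0 := by rintro rfl; simp [norm_eq_zero.2 rfl] at hq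
  have key := natCast_mul_eq_iff (q := q) (p := conj q) (c := norm q) hq.pos
    (by rw [norm_conj, sq])
  simp only [conj_conj] at key
  constructor
  · rintro ⟨z, hz⟩
    rw [rotHom_eq_iff h0, ← imEmb_natCast_mul, eq_comm, ← sub_eq_zero, ← map_sub] at hz
    obtain ⟨m, hm⟩ := exists_intCast_of_imEmb_eq_zero hz
    have ha := congrArg Hurwitz.a hm
    rw [sub_a, mul_mul_conj_a, ← nsmul_eq_mul] at ha
    have ha' : (norm q : ℤ) * (x.a - z.a) = 2 * m := by
      have e : (norm q • x).a = norm q * x.a := by rw [nsmul_eq_mul]; simp; ring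
      rw [e, intCast_a] at ha
      linarith
    have hd : (norm q : ℤ) ∣ m := by
      have hco : IsCoprime (norm q : ℤ) 2 := by
        exact_mod_cast Nat.isCoprime_iff_coprime.2 (Nat.coprime_two_right.2 hq)
      exact hco.dvd_of_dvd_mul_left ⟨_, ha'.symm⟩
    obtain ⟨k, rfl⟩ := hd
    refine ⟨z + k, (key x (z + k)).1 ?_⟩
    rw [sub_eq_iff_eq_add'] at hm
    rw [hm, mul_add, add_mul, ← (Int.cast_commute k q).eq, mul_assoc (k : Hurwitz), mul_conj,
      Int.cast_mul, Int.cast_natCast, (Int.cast_commute k _).eq]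
  · rintro ⟨z, hz⟩
    refine ⟨z, (rotHom_eq_iff h0).2 ?_⟩
    rw [← imEmb_natCast_mul, (key x z).2 hz]

theorem comap_range_rotHom {q : Hurwitz} (hq : Odd (norm q)) :
    (rotHom q).range.comap imEmb = sandwichKer (conj q) q (norm q) := by
  ext x
  exact imEmb_mem_range_rotHom hq x

theorem conj_pi : conj pi = -(unitI * pi) := by rfl

/-- As `π̄ = -i π`, the map `x ↦ π x π̄ / 2` also permutes the order. -/
theorem range_rotHom_mul_pi (q : Hurwitz) :
    (rotHom (q * pi)).range = (rotHom q).range := by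
  have key : ∀ x y, pi * x * conj pi = (2 : ℕ) * y → rotHom (q * pi) x = rotHom q y := by
    intro x y hxy
    have e : q * pi * x * conj (q * pi) = (2 : ℕ) * (q * y * conj q) := by
      calc _ = q * (pi * x * conj pi) * conj q := by rw [conj_mul]; simp only [mul_assoc]
        _ = _ := by rw [hxy, natCast_mul_left_comm, mul_assoc]
    rw [rotHom_apply, rotHom_apply, e, imEmb_natCast_mul, norm_mul, norm_pi, smul_smul]
    congr 1
    push_cast
    rw [mul_inv, mul_assoc, inv_mul_cancel₀ two_ne_zero, mul_one]
  have hI : unitI * unitI = -1 := by rfl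
  ext v
  constructor
  · rintro ⟨x, rfl⟩
    obtain ⟨y, hy⟩ := exists_pi_mul_mul_pi (-(x * unitI))
    refine ⟨y, (key x y ?_).symm⟩
    rw [← hy, conj_pi]
    simp only [mul_neg, neg_mul, mul_assoc]
  · rintro ⟨y, rfl⟩
    obtain ⟨x, hx⟩ := exists_eq_pi_mul_mul_pi y
    refine ⟨x * unitI, key _ _ ?_⟩
    rw [← hx, conj_pi]
    calc _ = -(pi * x * (unitI * unitI) * pi) := by simp only [mul_neg, mul_assoc]
      _ = _ := by rw [hI]; simp

theorem mulVec_succ {R : Matrix (Fin 4) (Fin 4) ℝ} (h : ∀ i : Fin 3, R i.succ 0 = 0)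
    (v : Fin 4 → ℝ) (i : Fin 3) :
    (R *ᵥ v) i.succ = (R.submatrix Fin.succ Fin.succ *ᵥ fun j => v j.succ) i := by
  simp [mulVec, dotProduct, Fin.sum_univ_succ, h i]

/-- The four-dimensional rotation of the pair `(q, q̄)` fixes `1`, so its lower right block is the
required matrix. -/
theorem exists_orthogonal_of_ne_zero {q : Hurwitz} (hq : q ≠ 0) :
    ∃ R ∈ orthogonalGroup (Fin 3) ℝ, ∀ x, R *ᵥ imEmb x = rotHom q x := by
  have hpos : 0 < norm q := Nat.pos_of_ne_zero (mt norm_eq_zero.1 hq)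
  obtain ⟨R, hR⟩ := exists_rotation (q := q) (p := conj q) (c := norm q) hpos
    (by rw [norm_conj, sq])
  have hN : (norm q : ℝ) ≠ 0 := by exact_mod_cast hpos.ne'
  have h1 : R.1 *ᵥ emb 1 = emb 1 := by
    have := hR 1
    rw [mul_one, mul_conj, ← mul_one (norm q : Hurwitz), emb_natCast_mul] at this
    exact smul_right_injective _ hN this
  have e1 : emb 1 = Pi.single 0 1 := by
    rw [emb_eq]; ext i; fin_cases i <;> simp
  have hcol : ∀ i : Fin 3, R.1 i.succ 0 = 0 := by
    intro i
    have := congrFun h1 i.succ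
    rw [e1, mulVec_single_one] at this
    simpa using this
  have horth := (mem_orthogonalGroup_iff _ _).1 (mem_specialOrthogonalGroup_iff.1 R.2).1
  refine ⟨R.1.submatrix Fin.succ Fin.succ, ?_, fun x => ?_⟩
  · rw [mem_orthogonalGroup_iff]
    ext i j
    have := congrFun (congrFun horth i.succ) j.succ
    rw [mul_apply, Fin.sum_univ_succ, hcol i, zero_mul, zero_add] at this
    rw [mul_apply]
    refine this.trans ?_
    simp [one_apply]
  · symm
    rw [rotHom_eq_iff hq]
    ext i
    have := congrFun (hR x) i.succ
    rw [imEmb_apply, ← this, Pi.smul_apply, Pi.smul_apply, mulVec_succ hcol]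
    rfl

/-- The block matrix `diag(1, R)`. -/
def extend (R : Matrix (Fin 3) (Fin 3) ℝ) : Matrix (Fin 4) (Fin 4) ℝ :=
  Matrix.of (Fin.cons (Pi.single 0 1) fun i => Fin.cons 0 (R i))

section extend
variable (R : Matrix (Fin 3) (Fin 3) ℝ)

@[simp] theorem extend_zero_zero : extend R 0 0 = 1 := rfl
@[simp] theorem extend_zero_succ (i : Fin 3) : extend R 0 i.succ = 0 := rfl
@[simp] theorem extend_succ_zero (i : Fin 3) : extend R i.succ 0 = 0 := rfl
@[simp] theorem extend_succ_succ (i j : Fin 3) : extend R i.succ j.succ = R i j := rfl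

variable {R}

theorem extend_mem (hR : R ∈ orthogonalGroup (Fin 3) ℝ) (hdet : R.det = 1) :
    extend R ∈ specialOrthogonalGroup (Fin 4) ℝ := by
  rw [mem_specialOrthogonalGroup_iff, mem_orthogonalGroup_iff]
  rw [mem_orthogonalGroup_iff] at hR
  constructor
  · ext i j
    rw [mul_apply, Fin.sum_univ_succ]
    cases i using Fin.cases with
    | zero => cases j using Fin.cases with
      | zero => simp
      | succ j => simp [one_apply, (Fin.succ_ne_zero j).symm]
    | succ i => cases j using Fin.cases with
      | zero => simp [one_apply]
      | succ j =>
        have := congrFun (congrFun hR i) j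
        rw [mul_apply] at this
        simpa [one_apply] using this
  · rw [det_succ_row_zero, Fin.sum_univ_succ]
    simp only [extend_zero_zero, extend_zero_succ]
    have : (extend R).submatrix Fin.succ (Fin.succAbove 0) = R := by ext i j; simp
    rw [this]
    simp [hdet]

/-- The extension `diag(1, R)` fixes `1`, so its pair satisfies `q p = c`. Thus `p` is a positive
multiple of `q̄`, and primitivity gives `p = q̄`. -/
theorem exists_rotHom (hR : R ∈ orthogonalGroup (Fin 3) ℝ) (hdet : R.det = 1)
    (hrat : ∀ i j, ∃ r : ℚ, R i j = r) :
    ∃ q, IsPrimitive q ∧ ∀ x, R *ᵥ imEmb x = rotHom q x := by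
  obtain ⟨q, p, c, hq, hp, hc, -, h⟩ := exists_represents (R := extend R) (fun i j => by
    cases i using Fin.cases with
    | zero => cases j using Fin.cases with
      | zero => exact ⟨1, by simp⟩
      | succ j => exact ⟨0, by simp⟩
    | succ i => cases j using Fin.cases with
      | zero => exact ⟨0, by simp⟩
      | succ j => exact hrat i j) (extend_mem hR hdet)
  have h1 : extend R *ᵥ emb 1 = emb 1 := by
    have e1 : emb 1 = Pi.single 0 1 := by
      rw [emb_eq]; ext i; fin_cases i <;> simp
    rw [e1, mulVec_single_one]
    ext i
    cases i using Fin.cases with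
    | zero => simp
    | succ i => simp
  have hqp : q * p = c := by
    apply emb_injective
    have := h 1
    rw [h1, mul_one] at this
    rw [← this, ← emb_natCast_mul, mul_one]
  have hp' : (norm q : Hurwitz) * p = ((c : ℤ) : Hurwitz) * conj q := by
    rw [← conj_mul_self, mul_assoc, hqp, Int.cast_natCast, (Nat.cast_commute c _).eq]
  rcases hp.eq_or_eq_neg hq.conj hq.norm_pos.ne' hp' with ⟨e, rfl⟩ | ⟨e, -⟩
  · refine ⟨q, hq, fun x => ?_⟩
    symm
    rw [rotHom_eq_iff hq.ne_zero]
    ext i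
    have := congrFun (h x) i.succ
    rw [imEmb_apply, ← this, Pi.smul_apply, Pi.smul_apply,
      mulVec_succ (extend_succ_zero R), show norm q = c by exact_mod_cast e]
    rfl
  · have := hq.norm_pos
    omega

end extend

theorem rotate_bcc_eq {R : Matrix (Fin 3) (Fin 3) ℝ} {q : Hurwitz}
    (h : ∀ x, R *ᵥ imEmb x = rotHom q x) : rotate R bcc = (rotHom q).range := by
  ext v
  rw [← range_imEmb]
  constructor
  · rintro ⟨_, ⟨x, rfl⟩, rfl⟩
    exact ⟨x, (h x).symm⟩
  · rintro ⟨x, rfl⟩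
    exact ⟨_, ⟨x, rfl⟩, h x⟩

theorem rotate_neg {d : ℕ} (R : Matrix (Fin d) (Fin d) ℝ) (Γ : AddSubgroup (Fin d → ℝ)) :
    rotate (-R) Γ = rotate R Γ := by
  ext v
  constructor
  · rintro ⟨x, hx, rfl⟩
    exact ⟨-x, neg_mem hx, by simp [mulVec_neg]⟩
  · rintro ⟨x, hx, rfl⟩
    exact ⟨-x, neg_mem hx, by simp [mulVec_neg]⟩

/-- In odd dimension one of `R`, `-R` is a rotation, and both give the same image lattice. A factor
`π` of the resulting quaternion is dropped by `range_rotHom_mul_pi`. -/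
theorem exists_rotate_bcc_eq {R : Matrix (Fin 3) (Fin 3) ℝ} (hR : R ∈ orthogonalGroup (Fin 3) ℝ)
    (h : IsCoincidence bcc R) :
    ∃ q, IsPrimitive q ∧ Odd (norm q) ∧ rotate R bcc = (rotHom q).range := by
  obtain ⟨q, hq, hrot⟩ : ∃ q, IsPrimitive q ∧ rotate R bcc = (rotHom q).range := by
    have hrat := exists_rat_entry h
    have hd : R.det * R.det = 1 := by
      have := congrArg det ((mem_orthogonalGroup_iff _ _).1 hR)
      rwa [det_mul, det_transpose, det_one] at this
    rcases mul_self_eq_one_iff.1 hd with hd | hd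
    · obtain ⟨q, hq, hx⟩ := exists_rotHom hR hd hrat
      exact ⟨q, hq, rotate_bcc_eq hx⟩
    · have hR' : -R ∈ orthogonalGroup (Fin 3) ℝ := by
        rw [mem_orthogonalGroup_iff] at hR ⊢
        rw [transpose_neg, neg_mul_neg, hR]
      obtain ⟨q, hq, hx⟩ := exists_rotHom hR' (by rw [det_neg, hd]; simp; norm_num)
        fun i j => by
          obtain ⟨r, hr⟩ := hrat i j
          exact ⟨-r, by simp [hr]⟩
      exact ⟨q, hq, by rw [← rotate_neg, rotate_bcc_eq hx]⟩
  rcases Nat.even_or_odd (norm q) with he | ho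
  · obtain ⟨q', rfl, hq', ho'⟩ := hq.exists_eq_mul_pi (even_iff_two_dvd.1 he)
    exact ⟨q', hq', ho', by rw [hrot, range_rotHom_mul_pi]⟩
  · exact ⟨q, hq, ho, hrot⟩

theorem coincidenceIndex_bcc {R : Matrix (Fin 3) (Fin 3) ℝ} {q : Hurwitz} (hq : IsPrimitive q)
    (ho : Odd (norm q)) (h : rotate R bcc = (rotHom q).range) :
    coincidenceIndex bcc R = norm q := by
  rw [coincidenceIndex, csl, AddSubgroup.inf_relIndex_left, h, ← range_imEmb,
    ← AddSubgroup.index_comap, comap_range_rotHom ho,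
    index_sandwichKer_of_norm_mul_eq_sq ho hq.conj hq (by rw [norm_conj, sq]), norm_conj,
    Nat.lcm_self]

theorem isCoincidence_bcc {R : Matrix (Fin 3) (Fin 3) ℝ} {q : Hurwitz} (hq : IsPrimitive q)
    (ho : Odd (norm q)) (h : rotate R bcc = (rotHom q).range) : IsCoincidence bcc R := by
  constructor
  · have hle : sandwichKer q (conj q) (norm q) ≤ bcc.comap (rotHom q) := by
      rintro x ⟨z, hz⟩
      rw [AddSubgroup.mem_comap, ← range_imEmb]
      refine ⟨z, ((rotHom_eq_iff hq.ne_zero).2 ?_).symm⟩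
      rw [hz, imEmb_natCast_mul]
    rw [h, ← AddSubgroup.index_comap]
    exact ne_zero_of_dvd_ne_zero
      (index_sandwichKer_ne_zero ho (hq.at _) (hq.conj.at _)) (AddSubgroup.index_dvd_of_le hle)
  · have h1 := coincidenceIndex_bcc hq ho h
    rw [coincidenceIndex, csl, AddSubgroup.inf_relIndex_left] at h1
    rw [h1]
    exact hq.norm_pos.ne'

/-- The coincidence site lattice of the rotation `x ↦ q̄ x q / |q|²`. -/
noncomputable def cslOf (q : Hurwitz) : AddSubgroup (Fin 3 → ℝ) :=
  (sandwichKer q (conj q) (norm q)).map imEmb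

theorem csl_bcc {R : Matrix (Fin 3) (Fin 3) ℝ} {q : Hurwitz} (ho : Odd (norm q))
    (h : rotate R bcc = (rotHom q).range) : csl bcc R = cslOf (conj q) := by
  rw [csl, h, cslOf, conj_conj, norm_conj, ← comap_range_rotHom ho, AddSubgroup.map_comap_eq,
    range_imEmb]

theorem cslsOfIndex_bcc_odd {n : ℕ} (hn : Odd n) : cslsOfIndex bcc n = cslOf '' primElts n := by
  ext Λ
  constructor
  · rintro ⟨R, hR, hc, hi, rfl⟩
    obtain ⟨q, hq, ho, hrot⟩ := exists_rotate_bcc_eq hR hc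
    rw [coincidenceIndex_bcc hq ho hrot] at hi
    exact ⟨conj q, ⟨hq.conj, by rw [norm_conj, hi]⟩, (csl_bcc ho hrot).symm⟩
  · rintro ⟨q, ⟨hq, rfl⟩, rfl⟩
    obtain ⟨R, hR, hx⟩ := exists_orthogonal_of_ne_zero hq.conj.ne_zero
    have hrot := rotate_bcc_eq hx
    have ho : Odd (norm (conj q)) := by rwa [norm_conj]
    exact ⟨R, hR, isCoincidence_bcc hq.conj ho hrot,
      by rw [coincidenceIndex_bcc hq.conj ho hrot, norm_conj],
      by rw [csl_bcc ho hrot, conj_conj]⟩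

theorem cslsOfIndex_bcc_even {n : ℕ} (hn : Even n) : cslsOfIndex bcc n = ∅ := by
  rw [Set.eq_empty_iff_forall_notMem]
  rintro Λ ⟨R, hR, hc, hi, -⟩
  obtain ⟨q, hq, ho, hrot⟩ := exists_rotate_bcc_eq hR hc
  rw [coincidenceIndex_bcc hq ho hrot] at hi
  exact Nat.not_odd_iff_even.2 hn (hi ▸ ho)

theorem cslsOfIndex_bcc_finite (n : ℕ) : (cslsOfIndex bcc n).Finite := by
  rcases Nat.even_or_odd n with h | h
  · rw [cslsOfIndex_bcc_even h]; exact Set.finite_empty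
  · rw [cslsOfIndex_bcc_odd h]; exact (primElts_finite n).image _

/-- The kernel of `imEmb` consists of the integers, and these lie in the sandwich kernel; so passing
to vector parts loses no information. -/
theorem comap_cslOf (q : Hurwitz) : (cslOf q).comap imEmb = sandwichKer q (conj q) (norm q) := by
  refine AddSubgroup.comap_map_eq_self fun x hx => ?_
  obtain ⟨m, rfl⟩ := exists_intCast_of_imEmb_eq_zero hx
  refine ⟨(m : Hurwitz), ?_⟩
  rw [← (Int.cast_commute m q).eq, mul_assoc, mul_conj, (Int.cast_commute m _).eq]

theorem exists_mul_eq_of_span_eq {q q' : Hurwitz} (hq : q ≠ 0) (hn : norm q = norm q')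
    (h : Ideal.span {q} = Ideal.span {q'}) : ∃ u, norm u = 1 ∧ q = u * q' := by
  obtain ⟨u, rfl⟩ := Ideal.mem_span_singleton'.1 (h ▸ Ideal.mem_span_singleton_self q)
  refine ⟨u, ?_, rfl⟩
  rw [norm_mul] at hn
  have h0 : norm q' ≠ 0 := fun h0 => hq (by rw [norm_eq_zero.1 h0, mul_zero])
  exact Nat.eq_of_mul_eq_mul_right (Nat.pos_of_ne_zero h0) (hn.trans (one_mul _).symm)

theorem cslOf_unit_mul {u : Hurwitz} (hu : norm u = 1) (q : Hurwitz) :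
    cslOf q ≤ cslOf (u * q) := by
  refine AddSubgroup.map_mono fun x hx => ?_
  rw [mem_sandwichKer] at hx ⊢
  have e : u * q * x * conj (u * q) = u * (q * x * conj q) * conj u := by
    rw [conj_mul]; simp only [mul_assoc]
  rw [norm_mul, hu, one_mul, e]
  exact natCast_dvd_mul_right (natCast_dvd_mul_left hx _) _

/-- Every `q̄ x` lies in the sandwich kernel of `q`. If it also lies in that of `q'`, then `n ∣ q'
q̄ x q̄'` for all `x`, so `n ∣ q' q̄` by `natCast_dvd_of_forall`. Hence `q'` is a left multiple of
`q`, by a unit since the norms agree. -/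
theorem cslOf_eq_iff {n : ℕ} (hn : Odd n) {q q' : Hurwitz} (hq : q ∈ primElts n)
    (hq' : q' ∈ primElts n) : cslOf q = cslOf q' ↔ Ideal.span {q} = Ideal.span {q'} := by
  obtain ⟨hp, rfl⟩ := hq
  obtain ⟨hp', hqq⟩ := hq'
  constructor
  · intro h
    have h1 := congrArg (AddSubgroup.comap imEmb) h
    rw [comap_cslOf, comap_cslOf, hqq] at h1
    have h2 : (norm q : Hurwitz) ∣ q' * conj q := by
      refine natCast_dvd_of_forall hn (hp'.conj.at _) fun x => ?_
      rw [mul_assoc q', ← mem_sandwichKer, ← h1, mem_sandwichKer, ← mul_assoc, mul_conj, mul_assoc]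
      exact dvd_mul_right _ _
    obtain ⟨w, hw⟩ := h2
    have e : q' = w * q := by
      have h3 : ((norm q : ℕ) : Hurwitz) * q' = (norm q : ℕ) * (w * q) := by
        rw [← mul_assoc, ← hw, mul_assoc, conj_mul_self, (Nat.cast_commute _ q').eq]
      exact mul_left_cancel₀ (by exact_mod_cast hp.norm_pos.ne') h3
    have hw1 : norm w = 1 := by
      rw [e, norm_mul] at hqq
      exact Nat.eq_of_mul_eq_mul_right hp.norm_pos (hqq.trans (one_mul _).symm)
    rw [e, span_unit_mul hw1]
  · intro h
    apply le_antisymm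
    · obtain ⟨u, hu, rfl⟩ := exists_mul_eq_of_span_eq hp'.ne_zero hqq h.symm
      exact cslOf_unit_mul hu q
    · obtain ⟨u, hu, rfl⟩ := exists_mul_eq_of_span_eq hp.ne_zero hqq.symm h
      exact cslOf_unit_mul hu q'

theorem _root_.Set.ncard_image_eq_of_eq_iff {α β γ : Type*} {s : Set α} {f : α → β} {g : α → γ}
    (h : ∀ x ∈ s, ∀ y ∈ s, f x = f y ↔ g x = g y) : (f '' s).ncard = (g '' s).ncard := by
  have hrep : ∀ b ∈ f '' s, ∃ x, x ∈ s ∧ f x = b := fun b hb => hb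
  choose e he hfe using hrep
  refine Set.ncard_congr (fun b hb => g (e b hb)) (fun b hb => ⟨e b hb, he b hb, rfl⟩) ?_ ?_
  · intro b b' hb hb' hbb
    rw [← hfe b hb, ← hfe b' hb']
    exact (h _ (he b hb) _ (he b' hb')).2 hbb
  · rintro _ ⟨x, hx, rfl⟩
    have hfx : f x ∈ f '' s := ⟨x, hx, rfl⟩
    exact ⟨f x, hfx, (h _ (he _ hfx) _ hx).1 (hfe _ hfx)⟩

theorem cCSL_bcc_odd {n : ℕ} (hn : Odd n) : cCSL bcc n = (primIdeals n).ncard := by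
  change (cslsOfIndex bcc n).ncard = _
  rw [cslsOfIndex_bcc_odd hn, primIdeals_eq_image]
  exact Set.ncard_image_eq_of_eq_iff fun q hq q' hq' => cslOf_eq_iff hn hq hq'

theorem cCSL_bcc_even {n : ℕ} (hn : Even n) : cCSL bcc n = 0 := by
  change (cslsOfIndex bcc n).ncard = _
  rw [cslsOfIndex_bcc_even hn, Set.ncard_empty]

end Hurwitz

/-! ### Arithmetic of the counting functions and Dirichlet series -/

namespace Hurwitz

open ArithmeticFunction Finset

theorem cCSL_bcc_isMultiplicative : (cCSL bcc).IsMultiplicative := by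
  refine ⟨by rw [cCSL_bcc_odd odd_one, primIdeals_one, Set.ncard_singleton], fun {m n} h => ?_⟩
  rcases Nat.even_or_odd m with hm | hm
  · rw [cCSL_bcc_even hm, cCSL_bcc_even (hm.mul_right n), zero_mul]
  rcases Nat.even_or_odd n with hn | hn
  · rw [cCSL_bcc_even hn, cCSL_bcc_even (hn.mul_left m), mul_zero]
  rw [cCSL_bcc_odd hm, cCSL_bcc_odd hn, cCSL_bcc_odd (hm.mul hn), ncard_primIdeals_mul hm hn h]

theorem cCSL_bcc_prime_pow {p r : ℕ} (hp : p.Prime) (hp2 : p ≠ 2) (hr : 1 ≤ r) :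
    cCSL bcc (p ^ r) = p ^ r + p ^ (r - 1) := by
  rw [cCSL_bcc_odd (hp.odd_of_ne_two hp2).pow, ncard_primIdeals_prime_pow hp hp2 hr]

/-- At an odd prime power the value consists of the two largest terms of the divisor sum. The bound
serves only for convergence. -/
theorem cCSL_bcc_le_sigma (n : ℕ) : cCSL bcc n ≤ sigma 1 n := by
  induction n using Nat.recOnPosPrimePosCoprime with
  | zero => simp
  | one => simp [cCSL_bcc_isMultiplicative.map_one]
  | prime_pow p k hp hk =>
    obtain ⟨k, rfl⟩ := Nat.exists_eq_succ_of_ne_zero hk.ne'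
    rcases eq_or_ne p 2 with rfl | hp2
    · rw [cCSL_bcc_even (by simp [Nat.even_pow])]
      exact Nat.zero_le _
    · rw [cCSL_bcc_prime_pow hp hp2 hk, sigma_one_apply_prime_pow hp, sum_range_succ,
        sum_range_succ, Nat.succ_eq_add_one, Nat.add_sub_cancel]
      omega
  | coprime a b ha hb hab iha ihb =>
    rw [cCSL_bcc_isMultiplicative.map_mul_of_coprime hab,
      isMultiplicative_sigma.map_mul_of_coprime hab]
    exact Nat.mul_le_mul iha ihb

theorem cRot_D4star_eq_sum {n : ℕ} (hn : n ≠ 0) :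
    cRot D4star n = ∑ m ∈ normPairs n, cCSL bcc m.1 * cCSL bcc m.2 := by
  rw [cRot_eq_sum hn]
  refine sum_congr rfl fun m hm => ?_
  obtain ⟨-, h1, h2, -⟩ := mem_filter.1 hm
  rw [cCSL_bcc_odd h1, cCSL_bcc_odd h2]

theorem mem_normPairs {n : ℕ} (hn : n ≠ 0) {m : ℕ × ℕ} : m ∈ normPairs n ↔
    Odd m.1 ∧ Odd m.2 ∧ IsSquare (m.1 * m.2) ∧ m.1.lcm m.2 = n := by
  rw [normPairs, mem_filter, mem_product, Nat.mem_divisors, Nat.mem_divisors, and_iff_right_iff_imp]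
  rintro ⟨-, -, -, rfl⟩
  exact ⟨⟨Nat.dvd_lcm_left _ _, hn⟩, ⟨Nat.dvd_lcm_right _ _, hn⟩⟩

theorem normPairs_even {n : ℕ} (hn : n ≠ 0) (he : Even n) : normPairs n = ∅ := by
  refine eq_empty_of_forall_notMem fun m hm => ?_
  obtain ⟨h1, h2, -, h⟩ := (mem_normPairs hn).1 hm
  have : n ∣ m.1 * m.2 := h ▸ Nat.lcm_dvd_mul _ _
  exact Nat.not_even_iff_odd.2 (h1.mul h2) (he.trans_dvd this)

theorem cRot_even {n : ℕ} (hn : n ≠ 0) (he : Even n) : cRot D4star n = 0 := by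
  rw [cRot_D4star_eq_sum hn, normPairs_even hn he, sum_empty]

theorem lcm_mul_mul {m n a b a' b' : ℕ} (h : m.Coprime n) (ha : a ∣ m) (hb : b ∣ m)
    (ha' : a' ∣ n) (hb' : b' ∣ n) : (a * a').lcm (b * b') = a.lcm b * a'.lcm b' := by
  apply Nat.dvd_antisymm
  · exact Nat.lcm_dvd (mul_dvd_mul (Nat.dvd_lcm_left _ _) (Nat.dvd_lcm_left _ _))
      (mul_dvd_mul (Nat.dvd_lcm_right _ _) (Nat.dvd_lcm_right _ _))
  · refine ((h.coprime_dvd_left (Nat.lcm_dvd ha hb)).coprime_dvd_right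
      (Nat.lcm_dvd ha' hb')).mul_dvd_of_dvd_of_dvd ?_ ?_
    · exact Nat.lcm_dvd ((dvd_mul_right a a').trans (Nat.dvd_lcm_left _ _))
        ((dvd_mul_right b b').trans (Nat.dvd_lcm_right _ _))
    · exact Nat.lcm_dvd ((dvd_mul_left a' a).trans (Nat.dvd_lcm_left _ _))
        ((dvd_mul_left b' b).trans (Nat.dvd_lcm_right _ _))

theorem isSquare_of_coprime_mul {a b : ℕ} (h : a.Coprime b) (hs : IsSquare (a * b)) :
    IsSquare a := by
  obtain ⟨c, hc⟩ := hs
  obtain ⟨d, hd⟩ := exists_eq_pow_of_mul_eq_pow (k := 2) (Nat.isUnit_iff.2 h) (hc.trans (sq c).symm)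
  exact ⟨d, hd.trans (sq d)⟩

/-- Componentwise multiplication is a bijection from `normPairs m × normPairs n` to `normPairs (m *
n)`: by coprimality, least common multiples multiply, and a product is a square only if both coprime
factors are. -/
theorem cRot_mul {m n : ℕ} (hm : m ≠ 0) (hn : n ≠ 0) (h : m.Coprime n) :
    cRot D4star (m * n) = cRot D4star m * cRot D4star n := by
  rw [cRot_D4star_eq_sum hm, cRot_D4star_eq_sum hn, cRot_D4star_eq_sum (mul_ne_zero hm hn),
    sum_mul_sum, ← sum_product']
  symm
  have hcop : ∀ {a b}, a ∣ m → b ∣ n → a.Coprime b := fun ha hb =>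
    (h.coprime_dvd_left ha).coprime_dvd_right hb
  have hdvd : ∀ {k} {t : ℕ × ℕ}, k ≠ 0 → t ∈ normPairs k → t.1 ∣ k ∧ t.2 ∣ k :=
    fun hk ht => by
      obtain ⟨-, -, -, rfl⟩ := (mem_normPairs hk).1 ht
      exact ⟨Nat.dvd_lcm_left _ _, Nat.dvd_lcm_right _ _⟩
  have hinj : ∀ {a a' b b'}, a ∣ m → a' ∣ n → b ∣ m → b' ∣ n → a * a' = b * b' →
      a = b ∧ a' = b' := by
    intro a a' b b' ha ha' hb hb' e
    refine ⟨Nat.dvd_antisymm ?_ ?_, Nat.dvd_antisymm ?_ ?_⟩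
    · exact (hcop ha hb').dvd_of_dvd_mul_right (e ▸ dvd_mul_right _ _)
    · exact (hcop hb ha').dvd_of_dvd_mul_right (e ▸ dvd_mul_right _ _)
    · exact (hcop hb ha').symm.dvd_of_dvd_mul_left (e ▸ dvd_mul_left _ _)
    · exact (hcop ha hb').symm.dvd_of_dvd_mul_left (e ▸ dvd_mul_left _ _)
  refine sum_bij (fun t _ => (t.1.1 * t.2.1, t.1.2 * t.2.2)) ?_ ?_ ?_ ?_
  · rintro ⟨s, t⟩ hst
    obtain ⟨hs, ht⟩ := mem_product.1 hst
    have ds := hdvd hm hs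
    have dt := hdvd hn ht
    obtain ⟨s1, s2, s3, s4⟩ := (mem_normPairs hm).1 hs
    obtain ⟨t1, t2, t3, t4⟩ := (mem_normPairs hn).1 ht
    refine (mem_normPairs (mul_ne_zero hm hn)).2 ⟨s1.mul t1, s2.mul t2, ?_, ?_⟩
    · dsimp only at s3 t3 ⊢
      rw [mul_mul_mul_comm]
      exact s3.mul t3
    · dsimp only at *
      rw [lcm_mul_mul h ds.1 ds.2 dt.1 dt.2, s4, t4]
  · rintro ⟨s, t⟩ hst ⟨s', t'⟩ hst' e
    obtain ⟨hs, ht⟩ := mem_product.1 hst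
    obtain ⟨hs', ht'⟩ := mem_product.1 hst'
    rw [Prod.mk.injEq] at e
    have e1 := hinj (hdvd hm hs).1 (hdvd hn ht).1 (hdvd hm hs').1 (hdvd hn ht').1 e.1
    have e2 := hinj (hdvd hm hs).2 (hdvd hn ht).2 (hdvd hm hs').2 (hdvd hn ht').2 e.2
    exact Prod.ext (Prod.ext e1.1 e2.1) (Prod.ext e1.2 e2.2)
  · rintro ⟨c, d⟩ hcd
    obtain ⟨hc, hd⟩ := hdvd (mul_ne_zero hm hn) hcd
    obtain ⟨o1, o2, hsq, hl⟩ := (mem_normPairs (mul_ne_zero hm hn)).1 hcd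
    obtain ⟨c1, c2, hc1, hc2, rfl⟩ := (Nat.dvd_mul).1 hc
    obtain ⟨d1, d2, hd1, hd2, rfl⟩ := (Nat.dvd_mul).1 hd
    dsimp only at *
    rw [lcm_mul_mul h hc1 hd1 hc2 hd2] at hl
    obtain ⟨e1, e2⟩ := hinj (Nat.lcm_dvd hc1 hd1) (Nat.lcm_dvd hc2 hd2) dvd_rfl dvd_rfl hl
    rw [mul_mul_mul_comm] at hsq
    have hco : (c1 * d1).Coprime (c2 * d2) := Nat.Coprime.mul_left
      (Nat.Coprime.mul_right (hcop hc1 hc2) (hcop hc1 hd2))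
      (Nat.Coprime.mul_right (hcop hd1 hc2) (hcop hd1 hd2))
    rw [Nat.odd_mul] at o1 o2
    exact ⟨((c1, d1), (c2, d2)), mem_product.2
      ⟨(mem_normPairs hm).2 ⟨o1.1, o2.1, isSquare_of_coprime_mul hco hsq, e1⟩,
        (mem_normPairs hn).2 ⟨o1.2, o2.2,
          isSquare_of_coprime_mul hco.symm (by rwa [mul_comm]), e2⟩⟩, rfl⟩
  · rintro ⟨s, t⟩ hst
    obtain ⟨hs, ht⟩ := mem_product.1 hst
    dsimp only at *
    rw [cCSL_bcc_isMultiplicative.map_mul_of_coprime (hcop (hdvd hm hs).1 (hdvd hn ht).1),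
      cCSL_bcc_isMultiplicative.map_mul_of_coprime (hcop (hdvd hm hs).2 (hdvd hn ht).2)]
    ring

theorem cRot_isMultiplicative : (cRot D4star).IsMultiplicative := by
  rw [IsMultiplicative.iff_ne_zero]
  refine ⟨?_, fun {m n} hm hn h => cRot_mul hm hn h⟩
  have e : normPairs 1 = {(1, 1)} := by
    ext ⟨a, b⟩
    rw [mem_normPairs one_ne_zero, mem_singleton, Prod.mk.injEq]
    constructor
    · rintro ⟨-, -, -, h⟩
      exact ⟨Nat.dvd_one.1 (h ▸ Nat.dvd_lcm_left a b), Nat.dvd_one.1 (h ▸ Nat.dvd_lcm_right a b)⟩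
    · rintro ⟨rfl, rfl⟩
      simp
  rw [cRot_D4star_eq_sum one_ne_zero, e, sum_singleton, cCSL_bcc_isMultiplicative.map_one, one_mul]

theorem isSquare_prime_pow_iff {p k : ℕ} (hp : p.Prime) : IsSquare (p ^ k) ↔ Even k := by
  constructor
  · rintro ⟨x, hx⟩
    obtain ⟨l, -, rfl⟩ := (Nat.dvd_prime_pow hp).1 (Dvd.intro x hx.symm)
    rw [← pow_add] at hx
    exact ⟨l, Nat.pow_right_injective hp.two_le hx⟩
  · rintro ⟨l, rfl⟩
    exact ⟨p ^ l, pow_add p l l⟩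

theorem lcm_prime_pow_eq_iff {p i j r : ℕ} (hp : p.Prime) :
    (p ^ i).lcm (p ^ j) = p ^ r ↔ max i j = r := by
  have e : (p ^ i).lcm (p ^ j) = p ^ max i j := by
    rcases le_total i j with h | h
    · rw [max_eq_right h, Nat.lcm_eq_right (pow_dvd_pow p h)]
    · rw [max_eq_left h, Nat.lcm_eq_left (pow_dvd_pow p h)]
  rw [e]
  exact (Nat.pow_right_injective hp.two_le).eq_iff

/-- The number of coincidence site lattices of index `p ^ j`, for `j < r` with `j ≡ r` modulo `2`. -/
noncomputable def paritySum (p r : ℕ) : ℕ :=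
  ∑ j ∈ range r, if Even (j + r) then cCSL bcc (p ^ j) else 0

/-- The norm pairs are `(p ^ i, p ^ j)` with `max i j = r` and `i + j` even: the pair with both
exponents `r`, and those with one exponent `r` and a smaller one of the same parity, in either
order. -/
theorem cRot_prime_pow_eq {p : ℕ} (hp : p.Prime) (hp2 : p ≠ 2) (r : ℕ) :
    cRot D4star (p ^ r) = cCSL bcc (p ^ r) * (cCSL bcc (p ^ r) + 2 * paritySum p r) := by
  set g := fun i => cCSL bcc (p ^ i) with hg
  have hodd : ∀ i, Odd (p ^ i) := fun i => (hp.odd_of_ne_two hp2).pow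
  have h1 : cRot D4star (p ^ r) = ∑ i ∈ range (r + 1), ∑ j ∈ range (r + 1),
      if Even (i + j) ∧ max i j = r then g i * g j else 0 := by
    classical
    rw [cRot_D4star_eq_sum (pow_ne_zero r hp.ne_zero), normPairs, sum_filter, sum_product,
      Nat.sum_divisors_prime_pow hp]
    refine sum_congr rfl fun i _ => ?_
    rw [Nat.sum_divisors_prime_pow hp]
    refine sum_congr rfl fun j _ => ?_
    simp only [hodd, true_and, ← pow_add, isSquare_prime_pow_iff hp, lcm_prime_pow_eq_iff hp, hg]
  have h2 : ∀ i ∈ range r, (∑ j ∈ range (r + 1),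
      if Even (i + j) ∧ max i j = r then g i * g j else 0) =
      g r * if Even (i + r) then g i else 0 := by
    intro i hi
    rw [mem_range] at hi
    rw [sum_range_succ, sum_eq_zero, zero_add]
    · simp only [max_eq_right hi.le, and_true, ite_mul, zero_mul, mul_comm (g r)]
    · intro j hj
      rw [mem_range] at hj
      rw [if_neg]
      rintro ⟨-, h⟩
      exact (max_lt hi hj).ne h
  have h3 : (∑ j ∈ range (r + 1), if Even (r + j) ∧ max r j = r then g r * g j else 0) =
      g r * paritySum p r + g r * g r := by
    rw [sum_range_succ, paritySum, mul_sum]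
    congr 1
    · refine sum_congr rfl fun j hj => ?_
      rw [mem_range] at hj
      simp only [max_eq_left hj.le, and_true, mul_ite, mul_zero, add_comm r j, hg]
    · simp
  rw [h1, sum_range_succ, sum_congr rfl h2, h3, ← mul_sum]
  change g r * paritySum p r + _ = _
  ring

theorem paritySum_add_two (p r : ℕ) :
    paritySum p (r + 2) = paritySum p r + cCSL bcc (p ^ r) := by
  rw [paritySum, sum_range_succ, sum_range_succ, paritySum]
  have h1 : ¬ Even (r + 1 + (r + 2)) := by
    rw [Nat.not_even_iff_odd]; exact ⟨r + 1, by ring⟩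
  have h2 : Even (r + (r + 2)) := ⟨r + 1, by ring⟩
  rw [if_neg h1, if_pos h2, add_zero]
  congr 1
  refine sum_congr rfl fun j _ => ?_
  have : Even (j + (r + 2)) ↔ Even (j + r) := by
    simp [Nat.even_add]
  simp only [this]

/-- The sum telescopes, since `(p - 1)(p ^ j + p ^ (j - 1)) = p ^ (j + 1) - p ^ (j - 1)` for `j ≥
1`. The term `j = 0` has value 1 and does not fit the pattern, hence the separate case `r = 1`. -/
theorem paritySum_eq {p : ℕ} (hp : p.Prime) (hp2 : p ≠ 2) (r : ℕ) :
    ((p : ℝ) - 1) * paritySum p (r + 1) = (p : ℝ) ^ r - 1 := by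
  induction r using Nat.twoStepInduction with
  | zero => simp [paritySum]
  | one =>
    rw [paritySum_add_two, pow_zero, cCSL_bcc_isMultiplicative.map_one]
    simp [paritySum]
  | more r ih _ =>
    rw [paritySum_add_two, cCSL_bcc_prime_pow hp hp2 (by omega), Nat.cast_add, mul_add, ih,
      Nat.add_sub_cancel]
    push_cast
    ring

theorem cRot_prime_pow {p r : ℕ} (hp : p.Prime) (hp2 : p ≠ 2) (hr : 1 ≤ r) :
    (cRot D4star (p ^ r) : ℝ) =
      ((p : ℝ) + 1) / ((p : ℝ) - 1) * (p : ℝ) ^ (r - 1) *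
        ((p : ℝ) ^ (r + 1) + (p : ℝ) ^ (r - 1) - 2) := by
  obtain ⟨k, rfl⟩ := Nat.exists_eq_add_of_le' hr
  have h1 : (p : ℝ) - 1 ≠ 0 := sub_ne_zero.2 (by exact_mod_cast hp.one_lt.ne')
  have h := paritySum_eq hp hp2 k
  rw [← mul_right_inj' h1, cRot_prime_pow_eq hp hp2, cCSL_bcc_prime_pow hp hp2 hr,
    Nat.add_sub_cancel]
  push_cast
  calc _ = ((p : ℝ) ^ (k + 1) + p ^ k) * (((p : ℝ) - 1) * (p ^ (k + 1) + p ^ k) +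
        2 * (((p : ℝ) - 1) * paritySum p (k + 1))) := by ring
    _ = _ := by rw [h]; field_simp; ring

/-- The Dirichlet convolution of `c_bcc` with `n ↦ n c_bcc(n)`. -/
noncomputable def conv : ArithmeticFunction ℕ := cCSL bcc * (ArithmeticFunction.id.pmul (cCSL bcc))

theorem conv_prime_pow {p r : ℕ} (hp : p.Prime) (hp2 : p ≠ 2) (hr : 1 ≤ r) :
    (conv (p ^ r) : ℝ) =
      ((p : ℝ) + 1) / ((p : ℝ) - 1) * (p : ℝ) ^ (r - 1) *
        ((p : ℝ) ^ (r + 1) + (p : ℝ) ^ (r - 1) - 2) := by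
  obtain ⟨k, rfl⟩ := Nat.exists_eq_add_of_le' hr
  have h1 : (p : ℝ) - 1 ≠ 0 := sub_ne_zero.2 (by exact_mod_cast hp.one_lt.ne')
  have e : conv (p ^ (k + 1)) = ∑ j ∈ range (k + 2),
      cCSL bcc (p ^ (k + 1 - j)) * (p ^ j * cCSL bcc (p ^ j)) := by
    rw [conv, mul_apply, Nat.sum_divisorsAntidiagonal'
      (f := fun a b => cCSL bcc a * (ArithmeticFunction.id.pmul (cCSL bcc)) b),
      Nat.sum_divisors_prime_pow hp]
    refine sum_congr rfl fun j hj => ?_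
    rw [mem_range] at hj
    rw [Nat.pow_div (by omega) hp.pos, pmul_apply, id_apply]
  have hmid : ((p : ℝ) - 1) * ∑ j ∈ range k, (p : ℝ) ^ j = p ^ k - 1 := mul_geom_sum _ _
  -- The inner terms of the convolution form a geometric progression; the two end terms are kept
  -- apart because they involve the exceptional value 1 at `p ^ 0`.
  have e2 : (∑ j ∈ range k, ((cCSL bcc (p ^ (k + 1 - (j + 1))) *
      (p ^ (j + 1) * cCSL bcc (p ^ (j + 1))) : ℕ) : ℝ)) =
      ((p : ℝ) + 1) ^ 2 * p ^ k * ∑ j ∈ range k, (p : ℝ) ^ j := by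
    rw [mul_sum]
    refine sum_congr rfl fun j hj => ?_
    rw [mem_range] at hj
    obtain ⟨l, rfl⟩ := Nat.exists_eq_add_of_lt hj
    rw [show j + l + 1 + 1 - (j + 1) = l + 1 by omega, cCSL_bcc_prime_pow hp hp2 (by omega),
      cCSL_bcc_prime_pow hp hp2 (by omega), Nat.add_sub_cancel, Nat.add_sub_cancel]
    push_cast
    ring
  rw [e, sum_range_succ, sum_range_succ', Nat.cast_add, Nat.cast_add, Nat.cast_sum, e2,
    Nat.sub_self, Nat.sub_zero, pow_zero, cCSL_bcc_isMultiplicative.map_one,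
    cCSL_bcc_prime_pow hp hp2 hr, Nat.add_sub_cancel, ← mul_right_inj' h1]
  push_cast
  calc _ = ((p : ℝ) + 1) ^ 2 * p ^ k * (((p : ℝ) - 1) * ∑ j ∈ range k, (p : ℝ) ^ j) +
        ((p : ℝ) - 1) * ((p ^ (k + 1) + p ^ k) + p ^ (k + 1) * (p ^ (k + 1) + p ^ k)) := by ring
    _ = _ := by rw [hmid]; field_simp; ring

theorem conv_even {n : ℕ} (he : Even n) : conv n = 0 := by
  rw [conv, mul_apply]
  refine sum_eq_zero fun t ht => ?_
  rw [← (Nat.mem_divisorsAntidiagonal.1 ht).1, Nat.even_mul] at he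
  rcases he with h | h
  · rw [cCSL_bcc_even h, zero_mul]
  · rw [pmul_apply, cCSL_bcc_even h, mul_zero, mul_zero]

/-- Both functions are multiplicative, so agreement at prime powers suffices; at powers of 2 both
vanish. -/
theorem cRot_eq_conv : cRot D4star = conv := by
  have hconv : conv.IsMultiplicative :=
    cCSL_bcc_isMultiplicative.mul (isMultiplicative_id.pmul cCSL_bcc_isMultiplicative)
  rw [cRot_isMultiplicative.eq_iff_eq_on_prime_powers _ _ hconv]
  intro p r hp
  rcases Nat.eq_zero_or_pos r with rfl | hr
  · rw [pow_zero, cRot_isMultiplicative.map_one, hconv.map_one]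
  rcases eq_or_ne p 2 with rfl | hp2
  · have he : Even (2 ^ r) := Nat.even_pow.2 ⟨even_two, hr.ne'⟩
    rw [cRot_even (by positivity) he, conv_even he]
  · exact_mod_cast (cRot_prime_pow hp hp2 hr).trans (conv_prime_pow hp hp2 hr).symm

theorem term_natCast_mul (f : ℕ → ℂ) (s : ℂ) :
    LSeries.term (fun n => (n : ℂ) * f n) s = LSeries.term f (s - 1) := by
  ext n
  rcases eq_or_ne n 0 with rfl | hn
  · simp
  · have hn' : (n : ℂ) ≠ 0 := by exact_mod_cast hn
    rw [LSeries.term_of_ne_zero hn, LSeries.term_of_ne_zero hn, Complex.cpow_sub _ _ hn',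
      Complex.cpow_one]
    field_simp

theorem convolution_natCast (f g : ArithmeticFunction ℕ) :
    LSeries.convolution (fun n => (f n : ℂ)) (fun n => (n : ℂ) * (g n : ℂ)) =
      fun n => ((f * ArithmeticFunction.id.pmul g) n : ℂ) := by
  ext n
  rw [LSeries.convolution_def, mul_apply, Nat.cast_sum]
  refine sum_congr rfl fun t _ => ?_
  rw [pmul_apply, id_apply]
  push_cast
  rfl

theorem lseriesSummable_cCSL_bcc {s : ℂ} (hs : 2 < s.re) :
    LSeriesSummable (fun n => (cCSL bcc n : ℂ)) s := by
  have h1 : LSeriesSummable (fun n => ((zeta n : ℕ) : ℂ)) s :=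
    LSeriesSummable_zeta_iff.2 (by linarith)
  have h2 : LSeriesSummable (fun n => (n : ℂ) * ((zeta n : ℕ) : ℂ)) s := by
    rw [LSeriesSummable, term_natCast_mul]
    exact LSeriesSummable_zeta_iff.2 (by simp; linarith)
  have h3 := h1.convolution h2
  rw [convolution_natCast] at h3
  -- The comparison series is that of `σ₁`, the convolution of `1` and `n`, which converges
  -- absolutely for real part above 2.
  have e : zeta * ArithmeticFunction.id.pmul zeta = sigma 1 := by
    ext n
    rw [zeta_mul_apply, sigma_one_apply]
    refine sum_congr rfl fun d hd => ?_
    rw [pmul_apply, id_apply, zeta_apply_ne (Nat.pos_of_mem_divisors hd).ne', mul_one]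
  rw [e] at h3
  refine Summable.of_norm_bounded h3.norm fun n => LSeries.norm_term_le s ?_
  rw [Complex.norm_natCast, Complex.norm_natCast]
  exact_mod_cast cCSL_bcc_le_sigma n

end Hurwitz
theorem mainTheorem8 :
    -- The counting functions count finite sets.
    (∀ n : ℕ, (coincidenceRotations D4star n).Finite ∧ (cslsOfIndex bcc n).Finite) ∧
    -- There are `576 c^rot(n)` coincidence rotations of index `n`.
    (∀ n : ℕ, (coincidenceRotations D4star n).ncard = 576 * cRot D4star n) ∧
    (cRot D4star).IsMultiplicative ∧
    (∀ r : ℕ, 1 ≤ r → cRot D4star (2 ^ r) = 0) ∧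
    (∀ p r : ℕ, p.Prime → p ≠ 2 → 1 ≤ r →
      (cRot D4star (p ^ r) : ℝ) =
        ((p : ℝ) + 1) / ((p : ℝ) - 1) * (p : ℝ) ^ (r - 1) *
          ((p : ℝ) ^ (r + 1) + (p : ℝ) ^ (r - 1) - 2)) ∧
    -- `Ψ^rot(s) = Ψ_bcc(s) Ψ_bcc(s - 1)`, all three series being absolutely convergent.
    (∀ s : ℂ, 3 < s.re →
      LSeriesSummable (fun n => (cRot D4star n : ℂ)) s ∧
      LSeriesSummable (fun n => (cCSL bcc n : ℂ)) s ∧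
      LSeriesSummable (fun n => (cCSL bcc n : ℂ)) (s - 1) ∧
      LSeries (fun n => (cRot D4star n : ℂ)) s =
        LSeries (fun n => (cCSL bcc n : ℂ)) s *
          LSeries (fun n => (cCSL bcc n : ℂ)) (s - 1)) := by
  refine ⟨fun n => ⟨Hurwitz.coincidenceRotations_finite n, Hurwitz.cslsOfIndex_bcc_finite n⟩,
    Hurwitz.ncard_coincidenceRotations_eq, Hurwitz.cRot_isMultiplicative, fun r hr => ?_,
    fun p r hp hp2 hr => Hurwitz.cRot_prime_pow hp hp2 hr, fun s hs => ?_⟩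
  · exact Hurwitz.cRot_even (by positivity) (Nat.even_pow.2 ⟨even_two, by omega⟩)
  · have h1 : LSeriesSummable (fun n => (cCSL bcc n : ℂ)) s :=
      Hurwitz.lseriesSummable_cCSL_bcc (by linarith)
    have h2 : LSeriesSummable (fun n => (cCSL bcc n : ℂ)) (s - 1) :=
      Hurwitz.lseriesSummable_cCSL_bcc (by simp; linarith)
    have h3 : LSeriesSummable (fun n => (n : ℂ) * (cCSL bcc n : ℂ)) s := by
      rw [LSeriesSummable, Hurwitz.term_natCast_mul]
      exact h2
    have e : (fun n => (cRot D4star n : ℂ)) = LSeries.convolution (fun n => (cCSL bcc n : ℂ))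
        (fun n => (n : ℂ) * (cCSL bcc n : ℂ)) := by
      rw [Hurwitz.convolution_natCast, Hurwitz.cRot_eq_conv, Hurwitz.conv]
    refine ⟨e ▸ h1.convolution h3, h1, h2, ?_⟩
    rw [e, LSeries_convolution' h1 h3]
    congr 1
    rw [LSeries, Hurwitz.term_natCast_mul]
    rfl
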